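/- Let $D$ be one of the Dynkin diagrams $D_4, E_6, E_7, E_8$, of rank $r = 4, 6, 7, 8$; let $\ell = 2, 3, 4, 6$ and $(d_1,\dots,d_m) = (2,2,2,2), (3,3,3), (2,4,4), (2,3,6)$, respectively. For $q \in \mathbb{C}^*$ let $B(q)$ be the $\mathbb{C}$-algebra generated by $T_1,\dots,T_m$ with defining relations $T_i^{d_i} = 1$ ($i = 1,\dots,m$) and $T_1 \cdots T_m = q$. Let $A_Q$ be the $\mathbb{C}$-algebra generated by $X^{\pm1}, P^{\pm1}$ with the relation $PX = QXP$, and let $\mathbb{Z}_\ell \ltimes A_{q^\ell}$ be the semidirect product (skew group algebra) in which the generator $s$ of $\mathbb{Z}_\ell$ acts by, respectively, $$\begin{aligned} \ell = 2:&\quad s^{-1}Xs = X^{-1}, && s^{-1}Ps = P^{-1};\\ \ell = 3:&\quad s^{-1}Xs = q^{-1}P^{-1}X^{-1}, && s^{-1}Ps = q^2X;\\ \ell = 4:&\quad s^{-1}Xs = q^{-2}P^{-1}, && s^{-1}Ps = q^2X;\\ \ell = 6:&\quad s^{-1}Xs = q^{-2}XP^{-1}, && s^{-1}Ps = qX. \end{aligned}$$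 Assume that $q$ is not a root of unity. Then $B(q) \cong \mathbb{Z}_\ell \ltimes A_{q^\ell}$ as $\mathbb{C}$-algebras. For $B$ either of these two algebras, the Hochschild cohomology $H^i(B) = H^i(B,B)$ and the Hochschild homology $H_i(B) = H_i(B,B)$ over $\mathbb{C}$ are, as complex vector spaces, $$H^0(B) \cong \mathbb{C}, \quad H^1(B) = 0, \quad H^2(B) \cong \mathbb{C}^{r+1}, \quad H^i(B) = 0 \ \text{ for } i > 2,$$ $$H_0(B) \cong \mathbb{C}^{r+1}, \quad H_1(B) = 0, \quad H_2(B) \cong \mathbb{C}, \quad H_i(B) = 0 \ \text{ for } i > 2.$$ -/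

import Mathlib

open scoped TensorProduct

noncomputable section

/-! ### Hochschild homology and cohomology of an algebra over a field -/

namespace Hochschild

open CategoryTheory MulOpposite ModuleCat

universe u

variable (k A : Type u) [Field k] [Ring A] [Algebra k A]

/-- The enveloping algebra `A ⊗ Aᵒᵖ`; left modules over it are the same as `A`-bimodules on which
`k` acts centrally. -/
abbrev Env : Type u := A ⊗[k] Aᵐᵒᵖ

/-- `A` as a bimodule over itself: `(a ⊗ b) • x = a * x * b`. -/
def regular : ModuleCat.{u} (Env k A) :=
  letI : Module (Env k A) A := instModuleTensorProductMop k A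
  ModuleCat.of (Env k A) A

variable {A} in
/-- The subspace `[A, M]` of a bimodule `M` spanned by the commutators `a m - m a`. -/
def commutators (M : ModuleCat.{u} (Env k A)) : Submodule k M :=
  Submodule.span k
    {x | ∃ (a : A) (m : M), x = (a ⊗ₜ[k] (1 : Aᵐᵒᵖ)) • m - ((1 : A) ⊗ₜ[k] op a) • m}

variable {A} in
theorem commutators_le_comap {M N : ModuleCat.{u} (Env k A)} (f : M ⟶ N) :
    commutators k M ≤ (commutators k N).comap (f.hom.restrictScalars k) := by
  refine Submodule.span_le.2 ?_
  rintro _ ⟨a, m, rfl⟩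
  exact Submodule.subset_span ⟨a, f.hom m, by simp⟩

/-- The functor `M ↦ M / [A, M] = A ⊗_{A ⊗ Aᵒᵖ} M` from bimodules to vector spaces. -/
def commutatorQuotient : ModuleCat.{u} (Env k A) ⥤ ModuleCat.{u} k where
  obj M := ModuleCat.of k (M ⧸ commutators k M)
  map f := ModuleCat.ofHom
    (Submodule.mapQ _ _ (f.hom.restrictScalars k) (commutators_le_comap k f))
  map_id M := by
    ext x
    rfl
  map_comp f g := by
    ext x
    rfl

instance : (commutatorQuotient k A).Additive where
  map_add {M N f g} := by
    ext x
    obtain ⟨x, rfl⟩ := (commutators k M).mkQ_surjective x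
    exact map_add (commutators k N).mkQ (f.hom x) (g.hom x)

/-- Hochschild cohomology `Hⁿ(A) = Hⁿ(A, A) = Extⁿ(A, A)`, where `Ext` is taken in the category of
`A`-bimodules. -/
def cohomology (n : ℕ) : ModuleCat.{u} k :=
  ((Ext k (ModuleCat.{u} (Env k A)) n).obj (Opposite.op (regular k A))).obj (regular k A)

/-- Hochschild homology `Hₙ(A) = Hₙ(A, A) = Torₙ(A, A)` over `A ⊗ Aᵒᵖ`: the left derived functors
of `M ↦ A ⊗_{A ⊗ Aᵒᵖ} M`, evaluated at `A`. -/
def homology (n : ℕ) : ModuleCat.{u} k :=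
  ((commutatorQuotient k A).leftDerived n).obj (regular k A)

end Hochschild

/-! ### The algebras `B(q)` -/

/-- The simply laced Dynkin diagrams whose affinization is star-shaped. -/
inductive StarDiagram : Type
  | D4 | E6 | E7 | E8

namespace StarDiagram

/-- The rank of the Dynkin diagram. -/
def rank : StarDiagram → ℕ
  | D4 => 4 | E6 => 6 | E7 => 7 | E8 => 8

/-- The order `ℓ` of the cyclic group. -/
def ell : StarDiagram → ℕ
  | D4 => 2 | E6 => 3 | E7 => 4 | E8 => 6

/-- The number `m` of legs of the affine diagram. -/
def legs : StarDiagram → ℕ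
  | D4 => 4 | E6 => 3 | E7 => 3 | E8 => 3

/-- The number `d_i`: one plus the length of the `i`-th leg of the affine diagram. -/
def legOrder : (D : StarDiagram) → Fin D.legs → ℕ
  | D4 => ![2, 2, 2, 2]
  | E6 => ![3, 3, 3]
  | E7 => ![2, 4, 4]
  | E8 => ![2, 3, 6]

end StarDiagram

/-- The relations `T_i ^ d_i = 1` and `T_1 ⋯ T_m = q`. -/
inductive BAlgebra.Rel (D : StarDiagram) (q : ℂˣ) :
    FreeAlgebra ℂ (Fin D.legs) → FreeAlgebra ℂ (Fin D.legs) → Prop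
  | pow (i : Fin D.legs) : Rel D q (FreeAlgebra.ι ℂ i ^ D.legOrder i) 1
  | prod : Rel D q (List.ofFn fun i => FreeAlgebra.ι ℂ i).prod
      (algebraMap ℂ (FreeAlgebra ℂ (Fin D.legs)) q)

/-- The algebra `B(q)`, generated over `ℂ` by `T_1, …, T_m` with defining relations
`T_i ^ d_i = 1` and `T_1 ⋯ T_m = q`. -/
def BAlgebra (D : StarDiagram) (q : ℂˣ) : Type := RingQuot (BAlgebra.Rel D q)

namespace BAlgebra

variable (D : StarDiagram) (q : ℂˣ)

instance : Ring (BAlgebra D q) := inferInstanceAs (Ring (RingQuot (Rel D q)))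

instance : Algebra ℂ (BAlgebra D q) := inferInstanceAs (Algebra ℂ (RingQuot (Rel D q)))

end BAlgebra

/-! ### The `Q`-Weyl algebra (quantum torus) -/

namespace QWeyl

/-- The generators `X`, `X⁻¹`, `P`, `P⁻¹`. -/
inductive Gen : Type
  | X | Xinv | P | Pinv

open FreeAlgebra in
/-- The relations of the `Q`-Weyl algebra: invertibility of `X` and `P`, and `P X = Q X P`. -/
inductive Rel (Q : ℂˣ) : FreeAlgebra ℂ Gen → FreeAlgebra ℂ Gen → Prop
  | X_Xinv : Rel Q (ι ℂ Gen.X * ι ℂ Gen.Xinv) 1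
  | Xinv_X : Rel Q (ι ℂ Gen.Xinv * ι ℂ Gen.X) 1
  | P_Pinv : Rel Q (ι ℂ Gen.P * ι ℂ Gen.Pinv) 1
  | Pinv_P : Rel Q (ι ℂ Gen.Pinv * ι ℂ Gen.P) 1
  | P_X : Rel Q (ι ℂ Gen.P * ι ℂ Gen.X) ((Q : ℂ) • (ι ℂ Gen.X * ι ℂ Gen.P))

end QWeyl

/-- The `Q`-Weyl algebra `A_Q`, generated over `ℂ` by `X^{±1}`, `P^{±1}` with the relation
`P X = Q X P`. -/
def QWeyl (Q : ℂˣ) : Type := RingQuot (QWeyl.Rel Q)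

namespace QWeyl

variable {Q : ℂˣ}

instance : Ring (QWeyl Q) := inferInstanceAs (Ring (RingQuot (Rel Q)))

instance : Algebra ℂ (QWeyl Q) := inferInstanceAs (Algebra ℂ (RingQuot (Rel Q)))

/-- The quotient map from the free algebra. -/
def mk (Q : ℂˣ) : FreeAlgebra ℂ Gen →ₐ[ℂ] QWeyl Q := RingQuot.mkAlgHom ℂ (Rel Q)

theorem mk_rel {a b : FreeAlgebra ℂ Gen} (h : Rel Q a b) : mk Q a = mk Q b :=
  RingQuot.mkAlgHom_rel ℂ h

/-- The invertible element `X` of `A_Q`. -/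
def X (Q : ℂˣ) : (QWeyl Q)ˣ where
  val := mk Q (FreeAlgebra.ι ℂ Gen.X)
  inv := mk Q (FreeAlgebra.ι ℂ Gen.Xinv)
  val_inv := by rw [← map_mul, mk_rel Rel.X_Xinv, map_one]
  inv_val := by rw [← map_mul, mk_rel Rel.Xinv_X, map_one]

/-- The invertible element `P` of `A_Q`. -/
def P (Q : ℂˣ) : (QWeyl Q)ˣ where
  val := mk Q (FreeAlgebra.ι ℂ Gen.P)
  inv := mk Q (FreeAlgebra.ι ℂ Gen.Pinv)
  val_inv := by rw [← map_mul, mk_rel Rel.P_Pinv, map_one]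
  inv_val := by rw [← map_mul, mk_rel Rel.Pinv_P, map_one]

/-- Nonzero scalars as invertible elements of an algebra. -/
def scalar (A : Type*) [Ring A] [Algebra ℂ A] : ℂˣ →* Aˣ :=
  Units.map (algebraMap ℂ A : ℂ →* A)

theorem mul_scalar {A : Type*} [Ring A] [Algebra ℂ A] (u : Aˣ) (a : ℂˣ) :
    u * scalar A a = scalar A a * u :=
  Units.ext (Algebra.commutes (a : ℂ) (u : A)).symm

theorem P_mul_X : P Q * X Q = scalar _ Q * (X Q * P Q) := by
  refine Units.ext ?_
  have h := mk_rel (Rel.P_X (Q := Q))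
  rw [map_mul, map_smul, map_mul, Algebra.smul_def] at h
  exact h

/-- The homomorphism from `A_Q` to an algebra `B` given by invertible elements `x`, `p` of `B`
such that `p x = Q x p`. -/
def lift {B : Type*} [Ring B] [Algebra ℂ B] (x p : Bˣ) (h : p * x = scalar B Q * (x * p)) :
    QWeyl Q →ₐ[ℂ] B :=
  RingQuot.liftAlgHom ℂ ⟨FreeAlgebra.lift ℂ fun g => match g with
    | Gen.X => (x : B) | Gen.Xinv => ((x⁻¹ : Bˣ) : B)
    | Gen.P => (p : B) | Gen.Pinv => ((p⁻¹ : Bˣ) : B), by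
    intro a b hab
    cases hab with
    | P_X =>
      simp only [map_mul, map_smul, FreeAlgebra.lift_ι_apply]
      rw [Algebra.smul_def]
      exact congrArg (Units.val (α := B)) h
    | _ => simp⟩

section lift

variable {B : Type*} [Ring B] [Algebra ℂ B] (x p : Bˣ) (h : p * x = scalar B Q * (x * p))

theorem lift_X : Units.map (lift x p h : QWeyl Q →* B) (X Q) = x := by
  refine Units.ext ?_
  change RingQuot.liftAlgHom ℂ _ (RingQuot.mkAlgHom ℂ _ _) = _
  rw [RingQuot.liftAlgHom_mkAlgHom_apply, FreeAlgebra.lift_ι_apply]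

theorem lift_P : Units.map (lift x p h : QWeyl Q →* B) (P Q) = p := by
  refine Units.ext ?_
  change RingQuot.liftAlgHom ℂ _ (RingQuot.mkAlgHom ℂ _ _) = _
  rw [RingQuot.liftAlgHom_mkAlgHom_apply, FreeAlgebra.lift_ι_apply]

end lift

theorem map_scalar {A B : Type*} [Ring A] [Algebra ℂ A] [Ring B] [Algebra ℂ B] (f : A →ₐ[ℂ] B)
    (a : ℂˣ) : Units.map (f : A →* B) (scalar A a) = scalar B a :=
  Units.ext (f.commutes a)

theorem algHom_ext {B : Type*} [Ring B] [Algebra ℂ B] {f g : QWeyl Q →ₐ[ℂ] B}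
    (hX : Units.map (f : QWeyl Q →* B) (X Q) = Units.map (g : QWeyl Q →* B) (X Q))
    (hP : Units.map (f : QWeyl Q →* B) (P Q) = Units.map (g : QWeyl Q →* B) (P Q)) : f = g := by
  refine RingQuot.ringQuot_ext' _ _ _ (FreeAlgebra.hom_ext (funext fun i => ?_))
  cases i with
  | X => exact congrArg Units.val hX
  | P => exact congrArg Units.val hP
  | Xinv => exact congrArg (fun u : Bˣ => ((u⁻¹ : Bˣ) : B)) hX
  | Pinv => exact congrArg (fun u : Bˣ => ((u⁻¹ : Bˣ) : B)) hP

/-- The image of `X` under conjugation `u ↦ s⁻¹ u s` by the generator `s` of `ℤ/ℓ`. -/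
def rotX (D : StarDiagram) (q : ℂˣ) : (QWeyl (q ^ D.ell))ˣ :=
  match D with
  | .D4 => (X _)⁻¹
  | .E6 => scalar _ q⁻¹ * ((P _)⁻¹ * (X _)⁻¹)
  | .E7 => scalar _ (q ^ 2)⁻¹ * (P _)⁻¹
  | .E8 => scalar _ (q ^ 2)⁻¹ * (X _ * (P _)⁻¹)

/-- The image of `P` under the same conjugation. -/
def rotP (D : StarDiagram) (q : ℂˣ) : (QWeyl (q ^ D.ell))ˣ :=
  match D with
  | .D4 => (P _)⁻¹
  | .E6 => scalar _ (q ^ 2) * X _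
  | .E7 => scalar _ (q ^ 2) * X _
  | .E8 => scalar _ q * X _

section normalForm

/-! Rules that bring a word in `x^{±1}`, `p^{±1}` and central elements `c a` to the form
`c a * x ^ i * p ^ j`. -/

variable {G : Type*} [Group G] {c : ℂˣ →* G} {x p : G} {Q : ℂˣ}

theorem inv_mul_of_rel (hc : ∀ u a, u * c a = c a * u) (h : p * x = c Q * (x * p)) :
    p⁻¹ * x = c Q⁻¹ * (x * p⁻¹) := by
  rw [inv_mul_eq_iff_eq_mul, ← mul_assoc, hc, mul_assoc, ← mul_assoc p, h, map_inv]
  group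

theorem mul_inv_of_rel (hc : ∀ u a, u * c a = c a * u) (h : p * x = c Q * (x * p)) :
    p * x⁻¹ = c Q⁻¹ * (x⁻¹ * p) := by
  rw [mul_inv_eq_iff_eq_mul, mul_assoc, mul_assoc, h, ← mul_assoc x⁻¹, hc, map_inv]
  group

theorem inv_mul_inv_of_rel (hc : ∀ u a, u * c a = c a * u) (h : p * x = c Q * (x * p)) :
    p⁻¹ * x⁻¹ = c Q * (x⁻¹ * p⁻¹) := by
  rw [inv_mul_eq_iff_eq_mul, ← mul_assoc, hc, mul_assoc, ← mul_assoc p, mul_inv_of_rel hc h,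
    map_inv]
  group

theorem assoc_of_eq {a b d : G} (h : a * b = d) (u : G) : a * (b * u) = d * u := by
  rw [← mul_assoc, h]

theorem rel_D4 (hc : ∀ u a, u * c a = c a * u) (h : p * x = c Q * (x * p)) :
    p⁻¹ * x⁻¹ = c Q * (x⁻¹ * p⁻¹) := inv_mul_inv_of_rel hc h

theorem rel_E6 {q : ℂˣ} (hc : ∀ u a, u * c a = c a * u) (h : p * x = c (q ^ 3) * (x * p)) :
    c (q ^ 2) * x * (c q⁻¹ * (p⁻¹ * x⁻¹)) =
      c (q ^ 3) * (c q⁻¹ * (p⁻¹ * x⁻¹) * (c (q ^ 2) * x)) := by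
  simp only [mul_assoc, inv_mul_inv_of_rel hc h, inv_mul_of_rel hc h,
    fun a => assoc_of_eq (hc x a), fun a => assoc_of_eq (hc p⁻¹ a),
    fun a => assoc_of_eq (hc x⁻¹ a), mul_inv_cancel_left]
  simp only [← mul_assoc, ← map_mul]
  congr 2
  group

theorem rel_E7 {q : ℂˣ} (hc : ∀ u a, u * c a = c a * u) (h : p * x = c (q ^ 4) * (x * p)) :
    c (q ^ 2) * x * (c (q ^ 2)⁻¹ * p⁻¹) =
      c (q ^ 4) * (c (q ^ 2)⁻¹ * p⁻¹ * (c (q ^ 2) * x)) := by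
  simp only [mul_assoc, inv_mul_of_rel hc h,
    fun a => assoc_of_eq (hc x a), fun a => assoc_of_eq (hc p⁻¹ a)]
  simp only [← mul_assoc, ← map_mul]
  congr 3
  group

theorem rel_E8 {q : ℂˣ} (hc : ∀ u a, u * c a = c a * u) (h : p * x = c (q ^ 6) * (x * p)) :
    c q * x * (c (q ^ 2)⁻¹ * (x * p⁻¹)) =
      c (q ^ 6) * (c (q ^ 2)⁻¹ * (x * p⁻¹) * (c q * x)) := by
  simp only [mul_assoc, inv_mul_of_rel hc h,
    fun a => assoc_of_eq (hc x a), fun a => assoc_of_eq (hc p⁻¹ a)]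
  simp only [← mul_assoc, ← map_mul]
  congr 4
  group

variable {f : G →* G}

theorem pow_D4 (hX : f x = x⁻¹) (hP : f p = p⁻¹) : f (f x) = x ∧ f (f p) = p := by
  simp [hX, hP]

theorem pow_E6 {q : ℂˣ} (hc : ∀ u a, u * c a = c a * u) (hf : ∀ a, f (c a) = c a)
    (hX : f x = c q⁻¹ * (p⁻¹ * x⁻¹)) (hP : f p = c (q ^ 2) * x) :
    f (f (f x)) = x ∧ f (f (f p)) = p := by
  have h2 : f (f p) = c q * (p⁻¹ * x⁻¹) := by
    rw [hP, map_mul, hf, hX, ← mul_assoc, ← map_mul]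
    congr 2
    group
  have h3 : f (f (f p)) = p := by
    have e : x⁻¹ * (c q * (x * p)) = c q * p := by
      rw [assoc_of_eq (hc _ _), mul_assoc, inv_mul_cancel_left]
    have e' : (p⁻¹ * x⁻¹)⁻¹ = x * p := by group
    rw [h2, map_mul, map_mul, hf, map_inv, map_inv, hX, hP, mul_inv_rev, mul_inv_rev, e',
      ← map_inv, ← map_inv, inv_inv, hc (x * p), hc x⁻¹, mul_assoc, e]
    simp only [← mul_assoc, ← map_mul]
    rw [show q * (q ^ 2)⁻¹ * q = 1 by group, map_one, one_mul]
  refine ⟨?_, h3⟩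
  have hx : x = c (q ^ 2)⁻¹ * f p := by rw [hP, map_inv, inv_mul_cancel_left]
  rw [hx, map_mul, map_mul, map_mul, hf, hf, hf, h3]

theorem pow_E7 {q : ℂˣ} (hf : ∀ a, f (c a) = c a)
    (hX : f x = c (q ^ 2)⁻¹ * p⁻¹) (hP : f p = c (q ^ 2) * x) :
    f (f (f (f x))) = x ∧ f (f (f (f p))) = p := by
  have h2 : f (f p) = p⁻¹ := by
    rw [hP, map_mul, hf, hX, ← mul_assoc, ← map_mul, mul_inv_cancel, map_one, one_mul]
  have h4 : f (f (f (f p))) = p := by rw [h2, map_inv, map_inv, h2, inv_inv]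
  refine ⟨?_, h4⟩
  have hx : x = c (q ^ 2)⁻¹ * f p := by rw [hP, map_inv, inv_mul_cancel_left]
  rw [hx, map_mul, map_mul, map_mul, map_mul, hf, hf, hf, hf, h4]

theorem pow_E8 {q : ℂˣ} (hc : ∀ u a, u * c a = c a * u) (hf : ∀ a, f (c a) = c a)
    (h : p * x = c (q ^ 6) * (x * p))
    (hX : f x = c (q ^ 2)⁻¹ * (x * p⁻¹)) (hP : f p = c q * x) :
    f (f (f (f (f (f x))))) = x ∧ f (f (f (f (f (f p))))) = p := by
  have h3 : f (f (f p)) = c (q ^ 2) * p⁻¹ := by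
    have h2 : f (f p) = c q⁻¹ * (x * p⁻¹) := by
      rw [hP, map_mul, hf, hX, ← mul_assoc, ← map_mul]
      congr 2
      group
    rw [h2, map_mul, map_mul, hf, map_inv f p, hX, hP, mul_inv_rev, ← map_inv, hc x⁻¹]
    simp only [mul_assoc, fun a => assoc_of_eq (hc x a), fun a => assoc_of_eq (hc p⁻¹ a),
      inv_mul_inv_of_rel hc h, mul_inv_cancel_left]
    simp only [← mul_assoc, ← map_mul]
    congr 2
    group
  have h6 : f (f (f (f (f (f p))))) = p := by
    rw [h3, map_mul, map_mul, map_mul, hf, hf, hf, map_inv, map_inv, map_inv, h3, mul_inv_rev,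
      inv_inv, ← map_inv, hc, ← mul_assoc, ← map_mul, mul_inv_cancel, map_one, one_mul]
  refine ⟨?_, h6⟩
  have hx : x = c q⁻¹ * f p := by rw [hP, map_inv, inv_mul_cancel_left]
  rw [hx, map_mul, map_mul, map_mul, map_mul, map_mul, map_mul, hf, hf, hf, hf, hf, hf, h6]

end normalForm

theorem rotP_mul_rotX (D : StarDiagram) (q : ℂˣ) :
    rotP D q * rotX D q = scalar _ (q ^ D.ell) * (rotX D q * rotP D q) :=
  match D with
  | .D4 => rel_D4 mul_scalar P_mul_X
  | .E6 => rel_E6 mul_scalar P_mul_X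
  | .E7 => rel_E7 mul_scalar P_mul_X
  | .E8 => rel_E8 mul_scalar P_mul_X

/-- The endomorphism `u ↦ s⁻¹ u s` of `A_{q^ℓ}`. -/
def rot (D : StarDiagram) (q : ℂˣ) : QWeyl (q ^ D.ell) →ₐ[ℂ] QWeyl (q ^ D.ell) :=
  lift (rotX D q) (rotP D q) (rotP_mul_rotX D q)

theorem map_rot_X (D : StarDiagram) (q : ℂˣ) :
    Units.map (rot D q : QWeyl (q ^ D.ell) →* QWeyl (q ^ D.ell)) (X _) = rotX D q := lift_X _ _ _

theorem map_rot_P (D : StarDiagram) (q : ℂˣ) :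
    Units.map (rot D q : QWeyl (q ^ D.ell) →* QWeyl (q ^ D.ell)) (P _) = rotP D q := lift_P _ _ _

theorem rot_pow (D : StarDiagram) (q : ℂˣ) : rot D q ^ D.ell = 1 := by
  have hs := map_scalar (rot D q)
  have hX := map_rot_X D q
  have hP := map_rot_P D q
  have h : (Units.map (rot D q : QWeyl (q ^ D.ell) →* QWeyl (q ^ D.ell)))^[D.ell] (X _) = X _ ∧
      (Units.map (rot D q : QWeyl (q ^ D.ell) →* QWeyl (q ^ D.ell)))^[D.ell] (P _) = P _ := by
    cases D
    · exact pow_D4 hX hP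
    · exact pow_E6 mul_scalar hs hX hP
    · exact pow_E7 hs hX hP
    · exact pow_E8 mul_scalar hs P_mul_X hX hP
  have hn : ∀ (n : ℕ) (u : (QWeyl (q ^ D.ell))ˣ),
      Units.map ((rot D q ^ n : QWeyl (q ^ D.ell) →ₐ[ℂ] QWeyl (q ^ D.ell)) :
        QWeyl (q ^ D.ell) →* QWeyl (q ^ D.ell)) u =
      (Units.map (rot D q : QWeyl (q ^ D.ell) →* QWeyl (q ^ D.ell)))^[n] u := by
    intro n
    induction n with
    | zero => intro u; rfl
    | succ n ih => intro u; rw [Function.iterate_succ_apply, ← ih, pow_succ]; rfl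
  exact algHom_ext ((hn _ _).trans h.1) ((hn _ _).trans h.2)

theorem ell_ne_zero (D : StarDiagram) : D.ell ≠ 0 := by cases D <;> decide

/-- The automorphism `u ↦ s⁻¹ u s` of `A_{q^ℓ}`. -/
def rotEquiv (D : StarDiagram) (q : ℂˣ) : QWeyl (q ^ D.ell) ≃ₐ[ℂ] QWeyl (q ^ D.ell) :=
  AlgEquiv.algHomUnitsEquiv ℂ (QWeyl (q ^ D.ell))
    (Units.ofPowEqOne (rot D q) D.ell (rot_pow D q) (ell_ne_zero D))

theorem rotEquiv_apply (D : StarDiagram) (q : ℂˣ) (u : QWeyl (q ^ D.ell)) :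
    rotEquiv D q u = rot D q u := rfl

theorem rotEquiv_pow (D : StarDiagram) (q : ℂˣ) : rotEquiv D q ^ D.ell = 1 := by
  rw [rotEquiv, ← map_pow, Units.pow_ofPowEqOne, map_one]

/-- The action of `ℤ/ℓ` on `A_{q^ℓ}` by automorphisms: the generator `s` acts by `u ↦ s u s⁻¹`,
the inverse of the automorphism above. -/
def action (D : StarDiagram) (q : ℂˣ) :
    Multiplicative (ZMod D.ell) →* (QWeyl (q ^ D.ell) ≃ₐ[ℂ] QWeyl (q ^ D.ell)) :=
  AddMonoidHom.toMultiplicativeLeft (ZMod.lift D.ell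
    ⟨zmultiplesHom _ (Additive.ofMul (rotEquiv D q)⁻¹), by
      rw [zmultiplesHom_apply, natCast_zsmul, ← ofMul_pow, inv_pow, rotEquiv_pow, inv_one,
        ofMul_one]⟩)

theorem action_generator (D : StarDiagram) (q : ℂˣ) :
    action D q (Multiplicative.ofAdd 1) = (rotEquiv D q)⁻¹ := by
  have h := ZMod.lift_coe D.ell (A := Additive (QWeyl (q ^ D.ell) ≃ₐ[ℂ] QWeyl (q ^ D.ell)))
    ⟨zmultiplesHom _ (Additive.ofMul (rotEquiv D q)⁻¹), by
      rw [zmultiplesHom_apply, natCast_zsmul, ← ofMul_pow, inv_pow, rotEquiv_pow, inv_one,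
        ofMul_one]⟩ 1
  rw [Int.cast_one] at h
  refine Eq.trans (congrArg Additive.toMul h) ?_
  simp

end QWeyl

/-! ### The semidirect product -/

/-- The algebra `A_{q^ℓ}` together with the action of `ℤ/ℓ` attached to the diagram. -/
def RotWeyl (D : StarDiagram) (q : ℂˣ) : Type := QWeyl (q ^ D.ell)

namespace RotWeyl

variable (D : StarDiagram) (q : ℂˣ)

instance : Ring (RotWeyl D q) := inferInstanceAs (Ring (QWeyl (q ^ D.ell)))

instance : Algebra ℂ (RotWeyl D q) := inferInstanceAs (Algebra ℂ (QWeyl (q ^ D.ell)))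

instance : MulSemiringAction (Multiplicative (ZMod D.ell)) (RotWeyl D q) :=
  MulSemiringAction.compHom (QWeyl (q ^ D.ell)) (QWeyl.action D q)

theorem smul_def (g : Multiplicative (ZMod D.ell)) (u : RotWeyl D q) :
    g • u = QWeyl.action D q g u := rfl

instance : SMulCommClass (Multiplicative (ZMod D.ell)) ℂ (RotWeyl D q) where
  smul_comm g a u := map_smul (QWeyl.action D q g) a (u : QWeyl (q ^ D.ell))

end RotWeyl

/-- The semidirect product (skew group algebra) `ℤ/ℓ ⋉ A_{q^ℓ}`: finite sums `∑ u_g g` with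
`u_g ∈ A_{q^ℓ}`, where `g u = (g • u) g`. -/
abbrev SemidirectWeyl (D : StarDiagram) (q : ℂˣ) : Type :=
  SkewMonoidAlgebra (RotWeyl D q) (Multiplicative (ZMod D.ell))

end

/-!
Write `A` for either algebra. A *presentation* of `A` by units `T i` with the relations
`T i ^ d_i = 1` and `T 1 ⋯ T m = q` gives a projective resolution of length two of the bimodule `A`
(`Hochschild.IsPresentation.resolution`). With `E = A ⊗ Aᵒᵖ`, it reads `0 → E → P → E → A → 0`,
where `P` is a direct sum of summands of `E`, one for each `i`, because `T i` generates a separable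
subalgebra. Its exactness in the middle says that derivations of `A` are determined by their values
on the `T i` and can be prescribed there subject to the relations; this is the universal property of
`A`, applied to a trivial square-zero extension. The map `E → P` is injective as soon as no nonzero
element of `E` is fixed by right multiplication with all `T i ⊗ (T i)⁻¹`. Consequently `H⁰` and `H₂`
are the center of `A`, `H²` and `H₀` are `A / [A, A]`, `H¹` and `H₁` vanish if all derivations of `A`
are inner, and everything else vanishes.

The second ingredient is the basis of *monomials* `X ^ i P ^ j s ^ k`, which makes `A` a twisted
group algebra of the group `MonomialGroup D = ℤ² ⋊ ℤ/ℓ`, with a cocycle whose values are powers of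
`q`. Since `q` is not a root of unity, conjugation by `X` and `P` separates the monomials, in the
sense of `IsSeparatingPair`: the center is `ℂ`
(`IsSeparatingPair.nonempty_center_equiv`); every derivation can be corrected by an inner one so
that `X` and `P` become eigenvectors, and is then zero on the `T i`, which are of finite order
(`IsSeparatingPair.exists_eq_commutator`). A monomial whose conjugates by its centralizer include a
nontrivial scalar multiple of it is a commutator, and there is a trace on each conjugacy class of
monomials of finite order, so that `A / [A, A]` has a basis indexed by the classes of finite order
(`TwistedBasis.nonempty_quotient_commutatorSpace_equiv`). These are the classes of `1` and of the
powers `T i ^ j` with `0 < j < d_i`; there are `1 + ∑ (d_i - 1) = r + 1` of them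
(`MonomialGroup.card_classIndex`).

For the isomorphism, each set of generators is expressed by the other (`legGenerator`,
`weylTriple`), and the relations are derived from each other as identities in a group with a central
homomorphism from the nonzero scalars, `isLegTuple_legGenerator` and `isWeylTriple_of_isLegTuple`.
-/

noncomputable section

/-! ### Homology of complexes of modules and resolutions of length two -/

section ModuleComplexes

open CategoryTheory

universe u v

variable {R : Type u} [Ring R] {ι : Type*} {c : ComplexShape ι}
  (K : HomologicalComplex (ModuleCat.{v} R) c) {i j l : ι}

/-- The homology in degree `j` of a complex of modules as an explicit subquotient. -/
theorem nonempty_homology_equiv_subquotient (hi : c.prev j = i) (hl : c.next j = l) :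
    Nonempty (K.homology j ≃ₗ[R]
      LinearMap.ker (K.d j l).hom ⧸ (LinearMap.range (K.d i j).hom).submoduleOf
        (LinearMap.ker (K.d j l).hom)) := by
  let S := K.sc' i j l
  have e₁ : K.homology j ≅ S.homology := ShortComplex.homologyMapIso (K.isoSc' i j l hi hl)
  have e₂ := e₁ ≪≫ S.moduleCatHomologyIso
  refine ⟨e₂.toLinearEquiv.trans (Submodule.quotEquivOfEq _ _ ?_)⟩
  ext x
  constructor
  · rintro ⟨y, rfl⟩
    exact ⟨y, rfl⟩
  · rintro ⟨y, hy⟩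
    exact ⟨y, Subtype.ext hy⟩

theorem nonempty_homology_equiv_of_surjective (hi : c.prev j = i) (hl : c.next j = l)
    {V : Type*} [AddCommGroup V] [Module R V] (f : K.X j →ₗ[R] V) (hd : (K.d j l) = 0)
    (hf : Function.Surjective f)
    (hker : ∀ x, f x = 0 ↔ ∃ y, (K.d i j).hom y = x) :
    Nonempty (K.homology j ≃ₗ[R] V) := by
  obtain ⟨e⟩ := nonempty_homology_equiv_subquotient K hi hl
  have hk : ∀ x, x ∈ LinearMap.ker (K.d j l).hom := fun x => by rw [hd]; rfl
  let g := f.comp (LinearMap.ker (K.d j l).hom).subtype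
  have hg : Function.Surjective g := fun y => by
    obtain ⟨x, rfl⟩ := hf y
    exact ⟨⟨x, hk x⟩, rfl⟩
  refine ⟨e.trans ((Submodule.quotEquivOfEq _ _ ?_).trans (g.quotKerEquivOfSurjective hg))⟩
  ext x
  exact (hker x.1).symm

theorem nonempty_homology_equiv_of_injective (hi : c.prev j = i) (hl : c.next j = l)
    {V : Type*} [AddCommGroup V] [Module R V] (f : V →ₗ[R] K.X j) (hd : (K.d i j) = 0)
    (hf : Function.Injective f)
    (hker : ∀ x, (K.d j l).hom x = 0 ↔ ∃ y, f y = x) :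
    Nonempty (K.homology j ≃ₗ[R] V) := by
  obtain ⟨e⟩ := nonempty_homology_equiv_subquotient K hi hl
  have h0 : (LinearMap.range (K.d i j).hom).submoduleOf (LinearMap.ker (K.d j l).hom) = ⊥ := by
    rw [eq_bot_iff]
    rintro x ⟨y, hy⟩
    rw [hd] at hy
    exact Subtype.ext hy.symm
  refine ⟨e.trans ((Submodule.quotEquivOfEqBot _ h0).trans (LinearEquiv.ofBijective
    (f.codRestrict _ fun y => (hker _).2 ⟨y, rfl⟩) ⟨?_, ?_⟩).symm)⟩
  · intro a b h
    exact hf (congrArg Subtype.val h)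
  · rintro ⟨x, hx⟩
    obtain ⟨y, rfl⟩ := (hker x).1 hx
    exact ⟨y, rfl⟩

theorem subsingleton_homology_of_exact (hi : c.prev j = i) (hl : c.next j = l)
    (h : ∀ x, (K.d j l).hom x = 0 → ∃ y, (K.d i j).hom y = x) :
    Subsingleton (K.homology j) := by
  obtain ⟨e⟩ := nonempty_homology_equiv_subquotient K hi hl
  have : Subsingleton (LinearMap.ker (K.d j l).hom ⧸
      (LinearMap.range (K.d i j).hom).submoduleOf (LinearMap.ker (K.d j l).hom)) := by
    rw [Submodule.Quotient.subsingleton_iff, eq_top_iff]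
    rintro ⟨x, hx⟩ -
    exact h x hx
  exact e.injective.subsingleton

end ModuleComplexes

namespace CategoryTheory.ProjectiveResolution

universe u

variable {R : Type u} [Ring R] {P₀ P₁ P₂ M : ModuleCat.{u} R}

/-- The objects `P₀, P₁, P₂, 0, 0, …`. -/
def lengthTwoObj (P₀ P₁ P₂ : ModuleCat.{u} R) : ℕ → ModuleCat.{u} R
  | 0 => P₀
  | 1 => P₁
  | 2 => P₂
  | _ + 3 => ModuleCat.of R PUnit

/-- The differentials `d₁, d₂, 0, 0, …`. -/
def lengthTwoD (d₁ : P₁ ⟶ P₀) (d₂ : P₂ ⟶ P₁) :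
    (n : ℕ) → (lengthTwoObj P₀ P₁ P₂ (n + 1) ⟶ lengthTwoObj P₀ P₁ P₂ n)
  | 0 => d₁
  | 1 => d₂
  | _ + 2 => 0

theorem lengthTwoD_comp (d₁ : P₁ ⟶ P₀) (d₂ : P₂ ⟶ P₁) (h : d₂ ≫ d₁ = 0) (n : ℕ) :
    lengthTwoD d₁ d₂ (n + 1) ≫ lengthTwoD d₁ d₂ n = 0 := by
  match n with
  | 0 => exact h
  | n + 1 => exact Limits.zero_comp

/-- The chain complex `0 ⟶ P₂ ⟶ P₁ ⟶ P₀`. -/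
def lengthTwoComplex (d₁ : P₁ ⟶ P₀) (d₂ : P₂ ⟶ P₁) (h : d₂ ≫ d₁ = 0) :
    ChainComplex (ModuleCat.{u} R) ℕ :=
  ChainComplex.of (lengthTwoObj P₀ P₁ P₂) (lengthTwoD d₁ d₂) (lengthTwoD_comp d₁ d₂ h)

section

variable (d₁ : P₁ ⟶ P₀) (d₂ : P₂ ⟶ P₁) (h : d₂ ≫ d₁ = 0)

theorem lengthTwoComplex_d (n : ℕ) :
    (lengthTwoComplex d₁ d₂ h).d (n + 1) n = lengthTwoD d₁ d₂ n :=
  ChainComplex.of_d _ _ _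

theorem lengthTwoComplex_d_one_zero : (lengthTwoComplex d₁ d₂ h).d 1 0 = d₁ :=
  lengthTwoComplex_d d₁ d₂ h 0

theorem lengthTwoComplex_d_two_one : (lengthTwoComplex d₁ d₂ h).d 2 1 = d₂ :=
  lengthTwoComplex_d d₁ d₂ h 1

theorem lengthTwoComplex_d_three_two : (lengthTwoComplex d₁ d₂ h).d 3 2 = 0 :=
  lengthTwoComplex_d d₁ d₂ h 2

theorem isZero_lengthTwoComplex_X (n : ℕ) :
    Limits.IsZero ((lengthTwoComplex d₁ d₂ h).X (n + 3)) := by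
  have : Subsingleton (ModuleCat.of R PUnit.{u + 1}) := inferInstanceAs (Subsingleton PUnit)
  exact ModuleCat.isZero_of_subsingleton (ModuleCat.of R PUnit.{u + 1})

end

/-- An exact sequence `0 ⟶ P₂ ⟶ P₁ ⟶ P₀ ⟶ M ⟶ 0` with projective `Pᵢ`, as a projective
resolution of `M`. -/
def lengthTwo [Projective P₀] [Projective P₁] [Projective P₂]
    (d₁ : P₁ ⟶ P₀) (d₂ : P₂ ⟶ P₁) (ε : P₀ ⟶ M) (h : d₂ ≫ d₁ = 0) (hε : d₁ ≫ ε = 0)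
    (surj : Function.Surjective ε.hom)
    (exact₀ : ∀ x, ε.hom x = 0 → ∃ y, d₁.hom y = x)
    (exact₁ : ∀ x, d₁.hom x = 0 → ∃ y, d₂.hom y = x)
    (inj : ∀ x, d₂.hom x = 0 → x = 0) : ProjectiveResolution M where
  complex := lengthTwoComplex d₁ d₂ h
  projective n := by
    match n with
    | 0 => exact inferInstanceAs (Projective P₀)
    | 1 => exact inferInstanceAs (Projective P₁)
    | 2 => exact inferInstanceAs (Projective P₂)
    | n + 3 => exact (isZero_lengthTwoComplex_X d₁ d₂ h n).projective
  π := (ChainComplex.toSingle₀Equiv _ _).symm ⟨ε, by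
    rw [lengthTwoComplex_d_one_zero]
    exact hε⟩
  quasiIso := ⟨fun n => by
    match n with
    | 0 =>
      rw [ChainComplex.quasiIsoAt₀_iff, ShortComplex.quasiIso_iff_of_zeros']
      · refine ⟨?_, (ModuleCat.epi_iff_surjective _).2 ?_⟩
        · rw [ShortComplex.moduleCat_exact_iff]
          intro x hx
          obtain ⟨y, hy⟩ := exact₀ x hx
          refine ⟨y, ?_⟩
          change ((lengthTwoComplex d₁ d₂ h).d 1 0).hom y = x
          rw [lengthTwoComplex_d_one_zero]
          exact hy
        · exact surj
      all_goals rfl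
    | 1 =>
      rw [quasiIsoAt_iff_exactAt' _ _ (ChainComplex.exactAt_succ_single_obj _ _),
        HomologicalComplex.exactAt_iff' _ 2 1 0 (by simp) (by simp),
        ShortComplex.moduleCat_exact_iff]
      intro x hx
      change ((lengthTwoComplex d₁ d₂ h).d 1 0).hom x = 0 at hx
      rw [lengthTwoComplex_d_one_zero] at hx
      obtain ⟨y, hy⟩ := exact₁ x hx
      refine ⟨y, ?_⟩
      change ((lengthTwoComplex d₁ d₂ h).d 2 1).hom y = x
      rw [lengthTwoComplex_d_two_one]
      exact hy
    | 2 =>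
      rw [quasiIsoAt_iff_exactAt' _ _ (ChainComplex.exactAt_succ_single_obj _ _),
        HomologicalComplex.exactAt_iff' _ 3 2 1 (by simp) (by simp),
        ShortComplex.moduleCat_exact_iff]
      intro x hx
      change ((lengthTwoComplex d₁ d₂ h).d 2 1).hom x = 0 at hx
      rw [lengthTwoComplex_d_two_one] at hx
      refine ⟨0, ?_⟩
      rw [map_zero, inj x hx]
      rfl
    | n + 3 =>
      rw [quasiIsoAt_iff_exactAt' _ _ (ChainComplex.exactAt_succ_single_obj _ _),
        HomologicalComplex.exactAt_iff]
      exact ShortComplex.exact_of_isZero_X₂ _ (isZero_lengthTwoComplex_X d₁ d₂ h n)⟩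

end CategoryTheory.ProjectiveResolution
end

noncomputable section

/-! ### Algebras presented by generators of finite order with a prescribed product -/

namespace Hochschild

open MulOpposite

universe u

variable {k A : Type u} [Field k] [Ring A] [Algebra k A]

variable (k) in
/-- The element `u ⊗ u⁻¹` of the enveloping algebra; it acts on a bimodule by `m ↦ u m u⁻¹`. -/
def conj : Aˣ →* Env k A where
  toFun u := (u : A) ⊗ₜ[k] op ((u⁻¹ : Aˣ) : A)
  map_one' := by simp [Algebra.TensorProduct.one_def]
  map_mul' u v := by simp [Algebra.TensorProduct.tmul_mul_tmul, mul_inv_rev]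

theorem conj_apply (u : Aˣ) : conj k u = (u : A) ⊗ₜ[k] op ((u⁻¹ : Aˣ) : A) := rfl

theorem conj_mul_conj_inv (u : Aˣ) : conj k u * conj k u⁻¹ = 1 := by
  rw [← map_mul, mul_inv_cancel, map_one]

theorem conj_scalar (c : kˣ) : conj k (Units.map (algebraMap k A : k →* A) c) = 1 := by
  rw [conj_apply, ← map_inv]
  simp only [Units.coe_map, MonoidHom.coe_coe, Algebra.algebraMap_eq_smul_one, op_smul, op_one,
    ← TensorProduct.smul_tmul', TensorProduct.tmul_smul, smul_smul, Units.inv_mul, one_smul,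
    Algebra.TensorProduct.one_def]

/-- The units `T i` generate the `k`-algebra `A` with the defining relations `T i ^ d i = 1` and
`T 0 ⋯ T (m - 1) = c`. The defining property of the presentation is only required for algebras in
the universe of `A`. -/
structure IsPresentation {m : ℕ} (T : Fin m → Aˣ) (d : Fin m → ℕ) (c : kˣ) : Prop where
  d_ne_zero : ∀ i, d i ≠ 0
  pow_eq_one : ∀ i, T i ^ d i = 1
  prod_eq : Fin.partialProd T (Fin.last m) = Units.map (algebraMap k A : k →* A) c
  adjoin_eq_top : Algebra.adjoin k (Set.range fun i => (T i : A)) = ⊤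
  exists_algHom : ∀ {C : Type u} [Ring C] [Algebra k C] (t : Fin m → Cˣ),
    (∀ i, t i ^ d i = 1) →
    Fin.partialProd t (Fin.last m) = Units.map (algebraMap k C : k →* C) c →
    ∃ f : A →ₐ[k] C, ∀ i, f (T i) = t i

/-- `D : A → M` is a derivation into the bimodule `M`. -/
def IsDerivation {M : Type*} [AddCommGroup M] [Module (Env k A) M] [Module k M]
    (D : A →ₗ[k] M) : Prop :=
  ∀ a b : A, D (a * b) = (a ⊗ₜ[k] (1 : Aᵐᵒᵖ)) • D b + ((1 : A) ⊗ₜ[k] op b) • D a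

variable {m : ℕ} {T : Fin m → Aˣ} {d : Fin m → ℕ} {c : kˣ}

variable (k) in
/-- With `U_j` the product of the first `j` generators, this is the difference of the conjugations
by `U_(i+1)` and `U_i`. The relation `T 0 ⋯ T (m - 1) = c` differentiates to `∑ i, ω_i b_i = 0`
for the derivation that on `T i` is the commutator `T i b_i - b_i T i`. -/
def relDiff (T : Fin m → Aˣ) (i : Fin m) : Env k A :=
  conj k (Fin.partialProd T i.succ) - conj k (Fin.partialProd T i.castSucc)

theorem relDiff_eq (i : Fin m) :
    relDiff k T i = conj k (Fin.partialProd T i.castSucc) * (conj k (T i) - 1) := by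
  rw [relDiff, Fin.partialProd_succ, map_mul, mul_sub, mul_one]

namespace IsPresentation

variable (hT : IsPresentation T d c)
include hT

theorem conj_last : conj k (Fin.partialProd T (Fin.last m)) = 1 := by
  rw [hT.prod_eq, conj_scalar]

theorem sum_relDiff : ∑ i, relDiff k T i = 0 := by
  simp only [relDiff]
  rw [Finset.sum_sub_distrib, sub_eq_zero]
  have h := Fin.sum_univ_succ fun j => conj k (Fin.partialProd T j)
  have h' := Fin.sum_univ_castSucc fun j => conj k (Fin.partialProd T j)
  rw [h, Fin.partialProd_zero, hT.conj_last, map_one, add_comm] at h'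
  exact add_right_cancel h'

theorem induction_generators (S : Subalgebra k A) (h : ∀ i, (T i : A) ∈ S) (a : A) : a ∈ S := by
  have : Algebra.adjoin k (Set.range fun i => (T i : A)) ≤ S :=
    Algebra.adjoin_le (by rintro _ ⟨i, rfl⟩; exact h i)
  rw [hT.adjoin_eq_top] at this
  exact this trivial

/-- The universal property in terms of derivations: the commutators `T i b_i - b_i T i` extend to a
derivation as soon as they are compatible with the relation `T 0 ⋯ T (m - 1) = c`. The relations
`T i ^ d i = 1` impose nothing, because to first order `T i + (T i b_i - b_i T i)` is a conjugate
of `T i`. -/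
theorem exists_derivation {M : Type u} [AddCommGroup M] [Module (Env k A) M] [Module k M]
    [IsScalarTower k (Env k A) M] (b : Fin m → M) (hb : ∑ i, relDiff k T i • b i = 0) :
    ∃ D : A →ₗ[k] M, IsDerivation D ∧ ∀ i, D (T i) =
      ((T i : A) ⊗ₜ[k] (1 : Aᵐᵒᵖ)) • b i - ((1 : A) ⊗ₜ[k] op (T i : A)) • b i := by
  let _ : Module A M :=
    Module.compHom M (Algebra.TensorProduct.includeLeft : A →ₐ[k] Env k A).toRingHom
  let _ : Module Aᵐᵒᵖ M :=
    Module.compHom M (Algebra.TensorProduct.includeRight : Aᵐᵒᵖ →ₐ[k] Env k A).toRingHom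
  have hl : ∀ (a : A) (x : M), a • x = (a ⊗ₜ[k] (1 : Aᵐᵒᵖ)) • x := fun _ _ => rfl
  have hr : ∀ (a : A) (x : M), op a • x = ((1 : A) ⊗ₜ[k] op a) • x := fun _ _ => rfl
  have : SMulCommClass A Aᵐᵒᵖ M := ⟨fun a a' x => by
    obtain ⟨a', rfl⟩ := op_surjective a'
    rw [hl, hr, hl, hr, ← mul_smul, ← mul_smul, Algebra.TensorProduct.tmul_mul_tmul,
      Algebra.TensorProduct.tmul_mul_tmul]
    simp⟩
  have : IsScalarTower k A M := ⟨fun r a x => by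
    rw [hl, hl, ← TensorProduct.smul_tmul', smul_assoc]⟩
  have : IsScalarTower k Aᵐᵒᵖ M := ⟨fun r a x => by
    obtain ⟨a, rfl⟩ := op_surjective a
    rw [← op_smul, hr, hr, op_smul, TensorProduct.tmul_smul, smul_assoc]⟩
  -- The units `1 + x` of the trivial extension `A ⊕ M`, for `x` in `M`.
  let v : M → (TrivSqZeroExt A M)ˣ := fun x =>
    { val := 1 + TrivSqZeroExt.inr x
      inv := 1 - TrivSqZeroExt.inr x
      val_inv := by simp [add_mul, mul_sub]
      inv_val := by simp [sub_mul, mul_add] }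
  have v_add : ∀ x y, v (x + y) = v x * v y := fun x y => Units.ext (by
    simp only [v, Units.val_mul, TrivSqZeroExt.inr_add]
    simp [add_mul, mul_add]
    abel)
  have v_zero : v 0 = 1 := Units.ext (by simp [v])
  let w : Aˣ →* (TrivSqZeroExt A M)ˣ := Units.map (TrivSqZeroExt.inlHom A M : A →* _)
  have v_conj : ∀ (u : Aˣ) (x : M), v (conj k u • x) = w u * v x * (w u)⁻¹ := fun u x => by
    rw [eq_mul_inv_iff_mul_eq]
    refine Units.ext ?_
    change (1 + TrivSqZeroExt.inr (conj k u • x)) * TrivSqZeroExt.inl (u : A) =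
      TrivSqZeroExt.inl (u : A) * (1 + TrivSqZeroExt.inr x)
    rw [mul_add, add_mul, mul_one, one_mul, TrivSqZeroExt.inr_mul_inl,
      TrivSqZeroExt.inl_mul_inr, hl, hr, ← mul_smul, conj_apply,
      Algebra.TensorProduct.tmul_mul_tmul, one_mul, ← op_mul, Units.inv_mul, op_one]
  let t : Fin m → (TrivSqZeroExt A M)ˣ := fun i => v (-b i) * w (T i) * (v (-b i))⁻¹
  have ht : ∀ j : Fin (m + 1), Fin.partialProd t j =
      v (∑ i : Fin m, if i.castSucc < j then relDiff k T i • b i else 0) *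
        w (Fin.partialProd T j) := by
    intro j
    induction j using Fin.induction with
    | zero => simp [v_zero]
    | succ j ih =>
      have hs : (∑ i : Fin m, if i.castSucc < j.succ then relDiff k T i • b i else 0) =
          (∑ i : Fin m, if i.castSucc < j.castSucc then relDiff k T i • b i else 0) +
            relDiff k T j • b j := by
        rw [← Finset.sum_erase_add _ _ (Finset.mem_univ j),
          ← Finset.sum_erase_add (a := j) Finset.univ (fun i : Fin m =>
            if i.castSucc < j.castSucc then relDiff k T i • b i else 0) (Finset.mem_univ j)]
        simp only [lt_self_iff_false, if_false, add_zero, Fin.castSucc_lt_succ, if_true]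
        congr 1
        refine Finset.sum_congr rfl fun i hi => ?_
        have hij : i ≠ j := (Finset.mem_erase.1 hi).1
        have : i.castSucc < j.succ ↔ i.castSucc < j.castSucc := by
          simp only [Fin.lt_def, Fin.val_castSucc, Fin.val_succ]
          have := Fin.val_ne_of_ne hij
          omega
        simp only [this]
      rw [Fin.partialProd_succ, ih, hs, Fin.partialProd_succ, map_mul, v_add]
      have e : v (relDiff k T j • b j) = w (Fin.partialProd T j.castSucc) * t j * (w (T j))⁻¹ *
          (w (Fin.partialProd T j.castSucc))⁻¹ := by
        have h1 : relDiff k T j • b j =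
            conj k (Fin.partialProd T j.castSucc) • (-b j + conj k (T j) • b j) := by
          rw [relDiff_eq, mul_smul, sub_smul, one_smul, neg_add_eq_sub]
        have h2 : (v (-b j))⁻¹ = v (b j) := by
          rw [inv_eq_iff_mul_eq_one, ← v_add, neg_add_cancel, v_zero]
        rw [h1, v_conj, v_add, v_conj]
        simp only [t, h2, mul_assoc]
      rw [e]
      group
  obtain ⟨f, hf⟩ := hT.exists_algHom t
    (fun i => by rw [conj_pow, ← map_pow, hT.pow_eq_one, map_one, mul_one, mul_inv_cancel])
    (by
      rw [ht, hT.prod_eq]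
      simp only [Fin.castSucc_lt_last, if_true, hb, v_zero, one_mul]
      exact Units.ext rfl)
  have hfst : ∀ a, (f a).fst = a := fun a => by
    refine hT.induction_generators
      (AlgHom.equalizer ((TrivSqZeroExt.fstHom k A M).comp f) (AlgHom.id k A)) (fun i => ?_) a
    change (f (T i)).fst = T i
    rw [hf]
    simp [t, v, w]
  refine ⟨(TrivSqZeroExt.sndHom A M).restrictScalars k ∘ₗ f.toLinearMap, fun a a' => ?_,
    fun i => ?_⟩
  · change (f (a * a')).snd = _ • (f a').snd + _ • (f a).snd
    rw [map_mul, TrivSqZeroExt.snd_mul, hfst, hfst]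
    rfl
  · change (f (T i)).snd = _
    rw [hf]
    simp [t, v, w, hl, hr, sub_eq_add_neg]

end IsPresentation

end Hochschild
end

noncomputable section

/-! ### The resolution -/

section Average

variable (k : Type*) {E : Type*} [Field k] [Ring E] [Algebra k E]

/-- The average of the powers of an element `τ` with `τ ^ d = 1`. -/
def powAverage (τ : E) (d : ℕ) : E := (d : k)⁻¹ • ∑ j ∈ Finset.range d, τ ^ j

variable {k} {τ : E} {d : ℕ}

theorem sub_one_mul_powAverage (h : τ ^ d = 1) : (τ - 1) * powAverage k τ d = 0 := by
  rw [powAverage, mul_smul_comm, mul_geom_sum, h, sub_self, smul_zero]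

theorem exists_one_sub_powAverage_eq (hd : (d : k) ≠ 0) :
    ∃ r : E, 1 - powAverage k τ d = r * (τ - 1) := by
  refine ⟨-((d : k)⁻¹ • ∑ j ∈ Finset.range d, ∑ l ∈ Finset.range j, τ ^ l), ?_⟩
  rw [neg_mul, smul_mul_assoc, Finset.sum_mul]
  simp only [geom_sum_mul]
  rw [Finset.sum_sub_distrib, powAverage, smul_sub, neg_sub, Finset.sum_const, Finset.card_range,
    ← Nat.cast_smul_eq_nsmul k, smul_smul, inv_mul_cancel₀ hd, one_smul]

theorem powAverage_mul_self (h : τ ^ d = 1) (hd : (d : k) ≠ 0) :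
    powAverage k τ d * powAverage k τ d = powAverage k τ d := by
  obtain ⟨r, hr⟩ := exists_one_sub_powAverage_eq (k := k) (τ := τ) hd
  have : (1 - powAverage k τ d) * powAverage k τ d = 0 := by
    rw [hr, mul_assoc, sub_one_mul_powAverage h, mul_zero]
  rw [sub_mul, one_mul, sub_eq_zero] at this
  exact this.symm

end Average

universe u

theorem exists_cokernel {E : Type*} [Ring E] {P : Type*} {N : Type u} [AddCommGroup P]
    [AddCommGroup N] [Module E P] [Module E N] (f : P →ₗ[E] N) :
    ∃ (Q : Type u) (_ : AddCommGroup Q) (_ : Module E Q) (π : N →ₗ[E] Q),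
      ∀ z, π z = 0 ↔ ∃ y, f y = z :=
  ⟨N ⧸ LinearMap.range f, inferInstance, inferInstance, (LinearMap.range f).mkQ, fun _ =>
    Submodule.Quotient.mk_eq_zero _⟩

namespace Hochschild

open MulOpposite CategoryTheory ModuleCat

variable {k A : Type u} [Field k] [Ring A] [Algebra k A]

theorem tmul_smul_regular (a b x : A) :
    ((a ⊗ₜ[k] op b : Env k A) • (id x : regular k A) : regular k A) = (a * x * b : A) := by
  let _ : Module (Env k A) A := instModuleTensorProductMop k A
  change (a ⊗ₜ[k] op b : Env k A) • x = _
  rw [TensorProduct.Algebra.smul_def]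
  simp [mul_assoc]

variable (k A) in
/-- The identification of `A` with its underlying bimodule. -/
def toRegular : A ≃ₗ[k] regular k A where
  toFun x := x
  invFun x := x
  left_inv _ := rfl
  right_inv _ := rfl
  map_add' _ _ := rfl
  map_smul' r x := by
    have h := tmul_smul_regular (k := k) (algebraMap k A r) 1 x
    rw [mul_one, ← Algebra.smul_def] at h
    exact h.symm

theorem tmul_smul_toRegular (a b x : A) :
    (a ⊗ₜ[k] op b : Env k A) • toRegular k A x = toRegular k A (a * x * b) :=
  tmul_smul_regular a b x

theorem conj_smul_toRegular (u : Aˣ) (x : A) :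
    conj k u • toRegular k A x = toRegular k A (u * x * (u⁻¹ : Aˣ)) :=
  tmul_smul_toRegular _ _ _

section Derivation

variable {M : Type*} [AddCommGroup M] [Module (Env k A) M] [Module k M]
  [IsScalarTower k (Env k A) M]

/-- The linear map `a ⊗ b ↦ D(a) b` attached to a linear map `D` into a bimodule. -/
def tmulDerivation (D : A →ₗ[k] M) : Env k A →ₗ[k] M := TensorProduct.lift
  { toFun := fun a =>
      { toFun := fun b => ((1 : A) ⊗ₜ[k] b) • D a
        map_add' := fun b b' => by rw [TensorProduct.tmul_add, add_smul]
        map_smul' := fun r b => by rw [TensorProduct.tmul_smul, smul_assoc]; rfl }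
    map_add' := fun a a' => LinearMap.ext fun b => by
      change ((1 : A) ⊗ₜ[k] b) • D (a + a') = ((1 : A) ⊗ₜ[k] b) • D a + ((1 : A) ⊗ₜ[k] b) • D a'
      rw [map_add, smul_add]
    map_smul' := fun r a => LinearMap.ext fun b => by
      change ((1 : A) ⊗ₜ[k] b) • D (r • a) = r • ((1 : A) ⊗ₜ[k] b) • D a
      rw [map_smul, smul_algebra_smul_comm] }

theorem tmulDerivation_tmul (D : A →ₗ[k] M) (a : A) (b : Aᵐᵒᵖ) :
    tmulDerivation D (a ⊗ₜ b) = ((1 : A) ⊗ₜ[k] b) • D a := rfl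

theorem tmulDerivation_mul {D : A →ₗ[k] M} (hD : IsDerivation D) {u : Aˣ} {x : M}
    (hu : D u = ((u : A) ⊗ₜ[k] (1 : Aᵐᵒᵖ)) • x - ((1 : A) ⊗ₜ[k] op (u : A)) • x)
    (y : Env k A) :
    tmulDerivation D (y * (conj k u - 1)) = (y * (conj k u - 1)) • x := by
  induction y using TensorProduct.induction_on with
  | zero =>
    rw [zero_mul, map_zero]
    exact (zero_smul (Env k A) x).symm
  | add x y hx hy => rw [add_mul, map_add, hx, hy, add_smul]
  | tmul a b =>
    obtain ⟨b, rfl⟩ := op_surjective b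
    rw [mul_sub, mul_one, conj_apply, Algebra.TensorProduct.tmul_mul_tmul, ← op_mul, map_sub,
      tmulDerivation_tmul, tmulDerivation_tmul, hD, hu, smul_add, smul_sub, smul_sub, sub_smul]
    simp only [← mul_smul, Algebra.TensorProduct.tmul_mul_tmul, ← op_mul, one_mul, mul_one,
      Units.mul_inv_cancel_left]
    rw [add_sub_cancel_right]

end Derivation

variable {m : ℕ} {T : Fin m → Aˣ} {d : Fin m → ℕ} {c : kˣ}

variable (k) in
/-- The idempotent of the enveloping algebra that projects a bimodule to the centralizer of `T i`,
when `T i ^ d i = 1`. -/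
def centralizerIdem (T : Fin m → Aˣ) (d : Fin m → ℕ) (i : Fin m) : Env k A :=
  powAverage k (conj k (T i)) (d i)

variable (k) in
/-- The sum over `i` of the left ideals generated by `T i ⊗ 1 - 1 ⊗ T i`, which are also generated
by the idempotents `1 - centralizerIdem k T d i`. -/
def relModule (T : Fin m → Aˣ) (d : Fin m → ℕ) : Submodule (Env k A) (Fin m → Env k A) where
  carrier := {z | ∀ i, z i * centralizerIdem k T d i = 0}
  add_mem' {_ _} hy hz i := (add_mul _ _ _).trans (by rw [hy i, hz i, add_zero])
  zero_mem' i := zero_mul _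
  smul_mem' _ _ hz i := (mul_assoc _ _ _).trans (by rw [hz i, mul_zero])

namespace IsPresentation

variable (hT : IsPresentation T d c)
include hT

theorem conj_pow_eq_one (i : Fin m) : conj k (T i) ^ d i = 1 := by
  rw [← map_pow, hT.pow_eq_one, map_one]

theorem sub_one_mul_centralizerIdem (i : Fin m) :
    (conj k (T i) - 1) * centralizerIdem k T d i = 0 :=
  sub_one_mul_powAverage (hT.conj_pow_eq_one i)

section

variable [CharZero k]

theorem exists_one_sub_centralizerIdem_eq (i : Fin m) :
    ∃ r : Env k A, 1 - centralizerIdem k T d i = r * (conj k (T i) - 1) :=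
  exists_one_sub_powAverage_eq (Nat.cast_ne_zero.2 (hT.d_ne_zero i))

theorem centralizerIdem_mul_self (i : Fin m) :
    centralizerIdem k T d i * centralizerIdem k T d i = centralizerIdem k T d i :=
  powAverage_mul_self (hT.conj_pow_eq_one i) (Nat.cast_ne_zero.2 (hT.d_ne_zero i))

theorem projection_mem (z : Fin m → Env k A) :
    (fun i => z i * (1 - centralizerIdem k T d i)) ∈ relModule k T d := fun i => by
  rw [mul_assoc, sub_mul, one_mul, hT.centralizerIdem_mul_self, sub_self, mul_zero]

/-- The projection of `Fin m → Env k A` onto its direct summand `relModule k T d`. -/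
def projection : (Fin m → Env k A) →ₗ[Env k A] relModule k T d where
  toFun z := ⟨_, hT.projection_mem z⟩
  map_add' _ _ := Subtype.ext (funext fun _ => add_mul _ _ _)
  map_smul' _ _ := Subtype.ext (funext fun _ => mul_assoc _ _ _)

theorem projection_apply (z : Fin m → Env k A) (i : Fin m) :
    (hT.projection z : Fin m → Env k A) i = z i * (1 - centralizerIdem k T d i) := rfl

theorem projection_of_mem (z : relModule k T d) : hT.projection z = z :=
  Subtype.ext (funext fun i => by
    rw [projection_apply, mul_sub, mul_one, z.2 i, sub_zero])

theorem projective_relModule : Module.Projective (Env k A) (relModule k T d) :=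
  Module.Projective.of_split (relModule k T d).subtype hT.projection
    (LinearMap.ext hT.projection_of_mem)

/-- The generator `1 - centralizerIdem k T d i` of the `i`-th summand of `relModule k T d`. -/
def gen (i : Fin m) : relModule k T d := hT.projection (Pi.single i 1)

theorem projection_eq_sum (z : Fin m → Env k A) :
    hT.projection z = ∑ i, z i • hT.gen i := by
  conv_lhs => rw [← Finset.univ_sum_single z, map_sum]
  refine Finset.sum_congr rfl fun i _ => ?_
  rw [gen, ← map_smul]
  congr 1
  ext j
  by_cases hj : j = i
  · subst hj
    rw [Pi.smul_apply, Pi.single_eq_same, Pi.single_eq_same, smul_eq_mul, mul_one]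
  · rw [Pi.smul_apply, Pi.single_eq_of_ne hj, Pi.single_eq_of_ne hj, smul_zero]

theorem eq_sum_gen (z : relModule k T d) : z = ∑ i, (z : Fin m → Env k A) i • hT.gen i := by
  rw [← projection_eq_sum, projection_of_mem]

theorem one_sub_centralizerIdem_smul_gen (i : Fin m) :
    (1 - centralizerIdem k T d i) • hT.gen i = hT.gen i := by
  rw [gen, ← map_smul]
  refine Subtype.ext (funext fun j => ?_)
  rw [projection_apply, projection_apply]
  by_cases hj : j = i
  · subst hj
    simp only [Pi.smul_apply, Pi.single_eq_same, smul_eq_mul, one_mul, mul_one, sub_mul, mul_sub,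
      hT.centralizerIdem_mul_self]
    simp
  · simp [Pi.single_eq_of_ne hj]

end

/-- The augmentation `a ⊗ b ↦ a b`. -/
def _root_.Hochschild.augmentation (k A : Type u) [Field k] [Ring A] [Algebra k A] :
    Env k A →ₗ[Env k A] regular k A :=
  LinearMap.toSpanSingleton (Env k A) (regular k A) (toRegular k A 1)

/-- The differential `relModule k T d → Env k A`, which is the inclusion on every summand. -/
def _root_.Hochschild.relSum (k : Type u) {A : Type u} [Field k] [Ring A] [Algebra k A]
    (T : Fin m → Aˣ) (d : Fin m → ℕ) : relModule k T d →ₗ[Env k A] Env k A :=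
  (∑ i, LinearMap.proj i) ∘ₗ (relModule k T d).subtype

omit hT in
theorem _root_.Hochschild.relSum_apply (z : relModule k T d) :
    relSum k T d z = ∑ i, (z : Fin m → Env k A) i := by
  simp [relSum]

/-- The differential `Env k A → relModule k T d` that sends `1` to the derivative of the relation
`T 0 ⋯ T (m - 1) = c`. -/
def relDeriv : Env k A →ₗ[Env k A] relModule k T d where
  toFun y := ⟨fun i => y * relDiff k T i, fun i => by
    change y * relDiff k T i * _ = 0
    rw [relDiff_eq, mul_assoc, mul_assoc, hT.sub_one_mul_centralizerIdem, mul_zero, mul_zero]⟩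
  map_add' _ _ := Subtype.ext (funext fun _ => add_mul _ _ _)
  map_smul' _ _ := Subtype.ext (funext fun _ => mul_assoc _ _ _)

theorem relDeriv_apply (y : Env k A) (i : Fin m) :
    (hT.relDeriv y : Fin m → Env k A) i = y * relDiff k T i := rfl

theorem relSum_relDeriv (y : Env k A) : relSum k T d (hT.relDeriv y) = 0 := by
  simp only [relSum_apply, relDeriv_apply]
  rw [← Finset.mul_sum, hT.sum_relDiff, mul_zero]

omit hT in
theorem _root_.Hochschild.augmentation_tmul (a b : A) :
    augmentation k A (a ⊗ₜ op b) = toRegular k A (a * b) := by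
  rw [augmentation, LinearMap.toSpanSingleton_apply, tmul_smul_toRegular, mul_one]

omit hT in
theorem _root_.Hochschild.augmentation_surjective : Function.Surjective (augmentation k A) :=
  fun x => ⟨((toRegular k A).symm x) ⊗ₜ op 1, by
    rw [augmentation_tmul, mul_one, LinearEquiv.apply_symm_apply]⟩

variable [CharZero k]

theorem relDeriv_one_eq_sum : hT.relDeriv 1 = ∑ i, relDiff k T i • hT.gen i := by
  rw [hT.eq_sum_gen (hT.relDeriv 1)]
  simp only [relDeriv_apply, one_mul]

theorem relSum_gen (i : Fin m) : relSum k T d (hT.gen i) = 1 - centralizerIdem k T d i := by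
  rw [relSum_apply, Finset.sum_eq_single i]
  · rw [gen, projection_apply, Pi.single_eq_same, one_mul]
  · intro j _ hj
    rw [gen, projection_apply, Pi.single_eq_of_ne hj, zero_mul]
  · simp

theorem augmentation_relSum (z : relModule k T d) : augmentation k A (relSum k T d z) = 0 := by
  rw [hT.eq_sum_gen z, map_sum, map_sum]
  refine Finset.sum_eq_zero fun i _ => ?_
  obtain ⟨r, hr⟩ := hT.exists_one_sub_centralizerIdem_eq i
  rw [map_smul, map_smul, hT.relSum_gen, hr, augmentation, LinearMap.toSpanSingleton_apply,
    mul_smul, sub_smul, conj_smul_toRegular, mul_one, Units.mul_inv, one_smul, sub_self,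
    smul_zero, smul_zero]

/-- The kernel of the augmentation is generated by the elements `T i ⊗ 1 - 1 ⊗ T i`, because the
`T i` generate `A`. -/
theorem exists_relSum_eq (x : Env k A) (hx : augmentation k A x = 0) :
    ∃ z, relSum k T d z = x := by
  let J := LinearMap.range (relSum k T d)
  have hgen : ∀ i, (T i : A) ⊗ₜ[k] (1 : Aᵐᵒᵖ) - (1 : A) ⊗ₜ[k] op (T i : A) ∈ J := fun i => by
    refine ⟨((T i : A) ⊗ₜ[k] (1 : Aᵐᵒᵖ) - (1 : A) ⊗ₜ[k] op (T i : A)) • hT.gen i, ?_⟩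
    have h : ((T i : A) ⊗ₜ[k] (1 : Aᵐᵒᵖ) - (1 : A) ⊗ₜ[k] op (T i : A)) =
        ((1 : A) ⊗ₜ[k] op (T i : A)) * (conj k (T i) - 1) := by
      rw [mul_sub, mul_one, conj_apply, Algebra.TensorProduct.tmul_mul_tmul, one_mul, ← op_mul,
        Units.inv_mul, op_one]
    rw [map_smul, hT.relSum_gen, smul_eq_mul, mul_sub, mul_one, h, mul_assoc,
      hT.sub_one_mul_centralizerIdem, mul_zero, sub_zero]
  have hmem : ∀ a : A, a ⊗ₜ[k] (1 : Aᵐᵒᵖ) - (1 : A) ⊗ₜ[k] op a ∈ J := fun a =>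
    hT.induction_generators
      { carrier := {a | a ⊗ₜ[k] (1 : Aᵐᵒᵖ) - (1 : A) ⊗ₜ[k] op a ∈ J}
        mul_mem' := fun {a b} ha hb => by
          have h1 := J.smul_mem (a ⊗ₜ[k] (1 : Aᵐᵒᵖ)) hb
          have h2 := J.smul_mem ((1 : A) ⊗ₜ[k] op b) ha
          simp only [smul_eq_mul, mul_sub, Algebra.TensorProduct.tmul_mul_tmul, mul_one,
            one_mul, ← op_mul] at h1 h2
          have h3 := J.add_mem h1 h2
          rw [sub_add_sub_cancel] at h3
          exact h3
        add_mem' := fun {a b} ha hb => by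
          have h3 := J.add_mem ha hb
          rw [Set.mem_ofPred_eq, TensorProduct.add_tmul, MulOpposite.op_add, TensorProduct.tmul_add,
            add_sub_add_comm]
          exact h3
        algebraMap_mem' := fun r => by
          rw [Set.mem_ofPred_eq, Algebra.algebraMap_eq_smul_one, op_smul, op_one,
            TensorProduct.tmul_smul, TensorProduct.smul_tmul', sub_self]
          exact J.zero_mem } hgen a
  -- Modulo the image, `a ⊗ b` agrees with `a b ⊗ 1`.
  have hall : ∀ x : Env k A,
      x - (toRegular k A).symm (augmentation k A x) ⊗ₜ[k] (1 : Aᵐᵒᵖ) ∈ J := fun x => by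
    induction x using TensorProduct.induction_on with
    | zero =>
      rw [map_zero, map_zero, TensorProduct.zero_tmul, sub_zero]
      exact J.zero_mem
    | tmul a b =>
      obtain ⟨b, rfl⟩ := op_surjective b
      have h1 := J.neg_mem (J.smul_mem (a ⊗ₜ[k] (1 : Aᵐᵒᵖ)) (hmem b))
      rw [smul_eq_mul, mul_sub, Algebra.TensorProduct.tmul_mul_tmul,
        Algebra.TensorProduct.tmul_mul_tmul, mul_one, mul_one, one_mul, neg_sub] at h1
      rw [augmentation_tmul, LinearEquiv.symm_apply_apply]
      exact h1
    | add x y hx hy =>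
      have h1 := J.add_mem hx hy
      rw [← add_sub_add_comm] at h1
      rw [map_add, map_add, TensorProduct.add_tmul]
      exact h1
  have h := hall x
  rw [hx, map_zero, TensorProduct.zero_tmul, sub_zero] at h
  exact h

/-- Exactness at `relModule k T d`. The universal derivation with values in the cokernel of
`relDeriv` provides a one-sided inverse of the map that `relSum` induces on this cokernel. -/
theorem exists_relDeriv_eq (z : relModule k T d) (hz : relSum k T d z = 0) :
    ∃ y, hT.relDeriv y = z := by
  obtain ⟨Q, _, _, π, hπ⟩ := exists_cokernel (E := Env k A) (P := Env k A)
    (N := relModule k T d) hT.relDeriv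
  let _ : Module k Q := Module.compHom Q (algebraMap k (Env k A))
  have : IsScalarTower k (Env k A) Q := ⟨fun r a x =>
    (congrArg (· • x) (Algebra.smul_def r a)).trans (mul_smul _ _ _)⟩
  have hb : ∑ i, relDiff k T i • π (hT.gen i) = 0 := by
    simp only [← map_smul]
    rw [← map_sum, ← hT.relDeriv_one_eq_sum]
    exact (hπ _).2 ⟨1, rfl⟩
  obtain ⟨D, hD, hDT⟩ := hT.exists_derivation _ hb
  have hFz : tmulDerivation D (relSum k T d z) = π z := by
    rw [hT.eq_sum_gen z, map_sum, map_sum, map_sum]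
    refine Finset.sum_congr rfl fun i _ => ?_
    obtain ⟨r, hr⟩ := hT.exists_one_sub_centralizerIdem_eq i
    rw [map_smul (relSum k T d), hT.relSum_gen, hr, smul_eq_mul, ← mul_assoc,
      tmulDerivation_mul hD (hDT i), mul_assoc, ← hr, mul_smul, ← map_smul,
      hT.one_sub_centralizerIdem_smul_gen, ← map_smul]
  rw [hz, map_zero] at hFz
  exact (hπ z).1 hFz.symm

omit [CharZero k] in
/-- Injectivity of the last differential, when no nonzero element of the enveloping algebra is
fixed by the right multiplications with `conj k (T i)`. -/
theorem relDeriv_injective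
    (hreg : ∀ z : Env k A, (∀ i, z * conj k (T i) = z) → z = 0)
    (y : Env k A) (hy : hT.relDeriv y = 0) : y = 0 := by
  have h : ∀ i, y * relDiff k T i = 0 := fun i => congrFun (congrArg Subtype.val hy) i
  have hU : ∀ j, y * conj k (Fin.partialProd T j) = y := fun j => by
    induction j using Fin.induction with
    | zero => rw [Fin.partialProd_zero, map_one, mul_one]
    | succ j ih =>
      have := h j
      rw [relDiff, mul_sub, ih, sub_eq_zero] at this
      exact this
  refine hreg y fun i => ?_
  have h1 := hU i.succ
  rw [Fin.partialProd_succ, map_mul, ← mul_assoc, hU] at h1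
  exact h1

variable (k A) in
omit hT [CharZero k] in
/-- The free bimodule of rank one. -/
def _root_.Hochschild.freeBimodule : ModuleCat.{u} (Env k A) := ModuleCat.of (Env k A) (Env k A)

variable (k) in
omit hT [CharZero k] in
/-- The left module `relModule k T d` as a bimodule. -/
def _root_.Hochschild.relBimodule (T : Fin m → Aˣ) (d : Fin m → ℕ) : ModuleCat.{u} (Env k A) :=
  ModuleCat.of (Env k A) (relModule k T d)

omit hT [CharZero k] in
/-- A linear map out of `Env k A`, as a morphism of bimodules. -/
def _root_.Hochschild.ofFree {N : ModuleCat.{u} (Env k A)} (f : Env k A →ₗ[Env k A] N) :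
    freeBimodule k A ⟶ N :=
  @ModuleCat.ofHom (Env k A) _ (Env k A) N _ _ _ _ f

omit hT [CharZero k] in
/-- A linear map out of `relModule k T d`, as a morphism of bimodules. -/
def _root_.Hochschild.ofRel {N : ModuleCat.{u} (Env k A)}
    (f : relModule k T d →ₗ[Env k A] N) : relBimodule k T d ⟶ N :=
  @ModuleCat.ofHom (Env k A) _ (relModule k T d) N _ _ _ _ f

/-- The projective resolution
`0 ⟶ Env k A ⟶ relModule k T d ⟶ Env k A ⟶ A ⟶ 0` of the bimodule `A`. -/
def resolution (hreg : ∀ z : Env k A, (∀ i, z * conj k (T i) = z) → z = 0) :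
    ProjectiveResolution (regular k A) :=
  have : Projective (freeBimodule k A) :=
    (IsProjective.iff_projective (Env k A)).1 inferInstance
  have : Projective (relBimodule k T d) :=
    (IsProjective.iff_projective (relModule k T d)).1 hT.projective_relModule
  ProjectiveResolution.lengthTwo
    (ofRel (N := freeBimodule k A) (relSum k T d)) (ofFree (N := relBimodule k T d) hT.relDeriv)
    (ofFree (augmentation k A))
    (ModuleCat.hom_ext (LinearMap.ext hT.relSum_relDeriv))
    (ModuleCat.hom_ext (LinearMap.ext hT.augmentation_relSum))
    augmentation_surjective hT.exists_relSum_eq hT.exists_relDeriv_eq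
    (hT.relDeriv_injective hreg)

end IsPresentation

end Hochschild
end

noncomputable section

/-! ### The terms of the complexes that compute Hochschild homology and cohomology -/

namespace Hochschild

open MulOpposite CategoryTheory ModuleCat

universe u

variable {k A : Type u} [Field k] [Ring A] [Algebra k A]

variable (k A) in
/-- The subspace `[A, A]` of `A` spanned by the commutators. -/
def commutatorSpace : Submodule k A := Submodule.span k {x | ∃ a b : A, x = a * b - b * a}

theorem commutator_mem (a b : A) : a * b - b * a ∈ commutatorSpace k A :=
  Submodule.subset_span ⟨a, b, rfl⟩

theorem conj_sub_mem_commutatorSpace (u : Aˣ) (a : A) :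
    (u : A) * a * (u⁻¹ : Aˣ) - a ∈ commutatorSpace k A := by
  have h := commutator_mem (k := k) ((u : A) * a) ((u⁻¹ : Aˣ) : A)
  rwa [Units.inv_mul_cancel_left] at h

variable (k A) in
/-- The linear map `a ⊗ b ↦ b a`, which identifies the commutator quotient of the free bimodule
`Env k A` with `A`. -/
def mulSwap : Env k A →ₗ[k] A := TensorProduct.lift
  { toFun := fun a =>
      { toFun := fun b => b.unop * a
        map_add' := fun _ _ => add_mul _ _ _
        map_smul' := fun _ _ => smul_mul_assoc _ _ _ }
    map_add' := fun _ _ => LinearMap.ext fun _ => mul_add _ _ _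
    map_smul' := fun _ _ => LinearMap.ext fun _ => mul_smul_comm _ _ _ }

theorem mulSwap_tmul (a b : A) : mulSwap k A (a ⊗ₜ op b) = b * a := rfl

theorem mulSwap_mul_conj (y : Env k A) (u : Aˣ) :
    mulSwap k A (y * conj k u) = (u⁻¹ : Aˣ) * mulSwap k A y * u := by
  induction y using TensorProduct.induction_on with
  | zero => rw [zero_mul, map_zero, mul_zero, zero_mul]
  | add x y hx hy => rw [add_mul, map_add, map_add, hx, hy, mul_add, add_mul]
  | tmul a b =>
    obtain ⟨b, rfl⟩ := op_surjective b
    rw [conj_apply, Algebra.TensorProduct.tmul_mul_tmul, ← op_mul, mulSwap_tmul, mulSwap_tmul]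
    simp only [mul_assoc]

theorem mulSwap_left_sub_right (a : A) (y : Env k A) :
    mulSwap k A (a ⊗ₜ[k] (1 : Aᵐᵒᵖ) * y - (1 : A) ⊗ₜ[k] op a * y) = 0 := by
  rw [map_sub, sub_eq_zero]
  induction y using TensorProduct.induction_on with
  | zero => simp only [mul_zero]
  | add x y hx hy => rw [mul_add, mul_add, map_add, map_add, hx, hy]
  | tmul b c =>
    obtain ⟨c, rfl⟩ := op_surjective c
    rw [Algebra.TensorProduct.tmul_mul_tmul, Algebra.TensorProduct.tmul_mul_tmul, ← op_mul,
      one_mul, one_mul, mulSwap_tmul, mulSwap_tmul, mul_assoc]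

variable (k A) in
/-- `mulSwap` on the free bimodule. -/
def mulSwapFree : freeBimodule k A →ₗ[k] A where
  toFun y := mulSwap k A y
  map_add' _ _ := map_add (mulSwap k A) _ _
  map_smul' r y :=
    (congrArg (mulSwap k A) (Algebra.smul_def (A := Env k A) r y).symm).trans
      (LinearMap.map_smul (mulSwap k A) r _)

variable (k) in
theorem one_tmul_sub_mem (y : Env k A) : (id (y - (1 : A) ⊗ₜ[k] op (mulSwap k A y)) :
    freeBimodule k A) ∈ commutators k (freeBimodule k A) := by
  induction y using TensorProduct.induction_on with
  | zero =>
    rw [map_zero, op_zero, TensorProduct.tmul_zero, sub_zero]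
    exact Submodule.zero_mem _
  | add x y hx hy =>
    rw [map_add, MulOpposite.op_add, TensorProduct.tmul_add, add_sub_add_comm]
    exact Submodule.add_mem _ hx hy
  | tmul a b =>
    obtain ⟨b, rfl⟩ := op_surjective b
    refine Submodule.subset_span ⟨a, ((1 : A) ⊗ₜ[k] op b : Env k A), ?_⟩
    change _ = a ⊗ₜ[k] (1 : Aᵐᵒᵖ) * (1 : A) ⊗ₜ[k] op b -
      (1 : A) ⊗ₜ[k] op a * (1 : A) ⊗ₜ[k] op b
    rw [Algebra.TensorProduct.tmul_mul_tmul, Algebra.TensorProduct.tmul_mul_tmul, ← op_mul,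
      one_mul, one_mul, mul_one, mulSwap_tmul]
    rfl

theorem commutators_freeBimodule :
    commutators k (freeBimodule k A) = LinearMap.ker (mulSwapFree k A) := by
  apply le_antisymm
  · refine Submodule.span_le.2 ?_
    rintro _ ⟨a, y, rfl⟩
    exact mulSwap_left_sub_right a y
  · have h : ∀ y : Env k A, mulSwap k A y = 0 →
        (id y : freeBimodule k A) ∈ commutators k (freeBimodule k A) := fun y hy => by
      have h1 := one_tmul_sub_mem k y
      rwa [hy, op_zero, TensorProduct.tmul_zero, sub_zero] at h1
    exact h

theorem _root_.Fin.sum_succ_sub_castSucc {M : Type*} [AddCommGroup M] {m : ℕ}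
    (f : Fin (m + 1) → M) : ∑ i : Fin m, (f i.succ - f i.castSucc) = f (Fin.last m) - f 0 := by
  have h := (Fin.sum_univ_succ f).symm.trans (Fin.sum_univ_castSucc f)
  rw [Finset.sum_sub_distrib, sub_eq_sub_iff_add_eq_add, add_comm, h, add_comm]

variable {m : ℕ} {T : Fin m → Aˣ} {d : Fin m → ℕ} {c : kˣ}

namespace IsPresentation

variable (hT : IsPresentation T d c)
include hT

theorem commutatorSpace_le (S : Submodule k A)
    (h : ∀ i a, (T i : A) * a * ((T i)⁻¹ : Aˣ) - a ∈ S) : commutatorSpace k A ≤ S := by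
  refine Submodule.span_le.2 ?_
  rintro _ ⟨a, b, rfl⟩
  refine hT.induction_generators
    { carrier := {a | ∀ b, a * b - b * a ∈ S}
      mul_mem' := fun {a a'} ha ha' b => ?_
      add_mem' := fun {a a'} ha ha' b => ?_
      algebraMap_mem' := fun r b => ?_ } (fun i b => ?_) a b
  · have := S.add_mem (ha (a' * b)) (ha' (b * a))
    simp only [mul_assoc, sub_add_sub_cancel] at this ⊢
    exact this
  · rw [add_mul, mul_add, add_sub_add_comm]
    exact S.add_mem (ha b) (ha' b)
  · rw [Algebra.commutes, sub_self]
    exact S.zero_mem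
  · have := h i (b * T i)
    rwa [← mul_assoc, Units.mul_inv_cancel_right] at this

theorem mem_center_of_commute (x : A) (h : ∀ i, (T i : A) * x = x * T i) :
    x ∈ Subalgebra.center k A := by
  rw [Subalgebra.mem_center_iff]
  intro a
  refine hT.induction_generators (Subalgebra.centralizer k {x}) (fun i => ?_) a x rfl |>.symm
  rw [Subalgebra.mem_centralizer_iff]
  rintro _ rfl
  exact (h i).symm

variable [CharZero k]

section

variable {N : Type*} [AddCommGroup N] [Module (Env k A) N]

theorem map_eq_sum (φ : relModule k T d →ₗ[Env k A] N) (z : relModule k T d) :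
    φ z = ∑ i, (z : Fin m → Env k A) i • φ (hT.gen i) := by
  conv_lhs => rw [hT.eq_sum_gen z, map_sum]
  simp only [map_smul]

theorem exists_eq_mul_conj_sub_one (z : relModule k T d) (i : Fin m) :
    ∃ y : Env k A, (z : Fin m → Env k A) i = y * (conj k (T i) - 1) := by
  obtain ⟨r, hr⟩ := hT.exists_one_sub_centralizerIdem_eq i
  refine ⟨(z : Fin m → Env k A) i * r, ?_⟩
  rw [mul_assoc, ← hr, mul_sub, mul_one, z.2 i, sub_zero]

theorem map_relDeriv_one (φ : relModule k T d →ₗ[Env k A] N) :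
    φ (hT.relDeriv 1) = ∑ i, relDiff k T i • φ (hT.gen i) := by
  rw [hT.map_eq_sum]
  simp only [relDeriv_apply, one_mul]

end

theorem relSum_smul_eq_zero_iff (x : A) :
    (∀ z : relModule k T d, relSum k T d z • toRegular k A x = 0) ↔
      x ∈ Subalgebra.center k A := by
  constructor
  · intro h
    refine hT.mem_center_of_commute x fun i => ?_
    have h1 := h ((1 * (conj k (T i) - 1)) • hT.gen i)
    rw [map_smul, hT.relSum_gen, smul_eq_mul, one_mul, mul_sub, mul_one,
      hT.sub_one_mul_centralizerIdem, sub_zero, sub_smul, one_smul, sub_eq_zero,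
      conj_smul_toRegular] at h1
    have h2 := (toRegular k A).injective h1
    rwa [Units.mul_inv_eq_iff_eq_mul] at h2
  · intro hx z
    rw [relSum_apply, Finset.sum_smul]
    refine Finset.sum_eq_zero fun i _ => ?_
    obtain ⟨y, hy⟩ := hT.exists_eq_mul_conj_sub_one z i
    rw [hy, mul_smul, sub_smul, one_smul, conj_smul_toRegular,
      (Subalgebra.mem_center_iff.1 hx (T i)), Units.mul_inv_cancel_right, sub_self, smul_zero]

/-- A cocycle on `relModule k T d` is the restriction of a derivation to the generators, so it is a
coboundary when this derivation is inner. -/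
theorem exists_eq_relSum_smul
    (hinner : ∀ D : A →ₗ[k] A, (∀ a b, D (a * b) = a * D b + D a * b) →
      ∃ x, ∀ a, D a = a * x - x * a)
    (φ : relModule k T d →ₗ[Env k A] regular k A) (hφ : φ (hT.relDeriv 1) = 0) :
    ∃ x : A, ∀ z, φ z = relSum k T d z • toRegular k A x := by
  rw [hT.map_relDeriv_one] at hφ
  obtain ⟨D, hD, hDT⟩ := hT.exists_derivation _ hφ
  obtain ⟨x, hx⟩ := hinner ((toRegular k A).symm.toLinearMap ∘ₗ D) fun a b => by
    have h := hD a b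
    rw [← (toRegular k A).apply_symm_apply (D b), ← (toRegular k A).apply_symm_apply (D a),
      tmul_smul_toRegular, ← op_one, tmul_smul_toRegular, ← map_add, mul_one, one_mul] at h
    exact (congrArg (toRegular k A).symm h).trans ((toRegular k A).symm_apply_apply _)
  refine ⟨x, fun z => ?_⟩
  rw [hT.map_eq_sum, relSum_apply, Finset.sum_smul]
  refine Finset.sum_congr rfl fun i _ => ?_
  obtain ⟨y, hy⟩ := hT.exists_eq_mul_conj_sub_one z i
  have h1 : D (T i) = ((T i : A) ⊗ₜ[k] (1 : Aᵐᵒᵖ)) • toRegular k A x -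
      ((1 : A) ⊗ₜ[k] op (T i : A)) • toRegular k A x := by
    rw [tmul_smul_toRegular, ← op_one, tmul_smul_toRegular, ← map_sub, mul_one, one_mul, ← hx]
    exact ((toRegular k A).apply_symm_apply _).symm
  rw [hy, ← tmulDerivation_mul hD (hDT i), tmulDerivation_mul hD h1]

theorem mem_commutatorSpace_iff_exists_map (x : A) :
    x ∈ commutatorSpace k A ↔
      ∃ φ : relModule k T d →ₗ[Env k A] regular k A, φ (hT.relDeriv 1) = toRegular k A x := by
  constructor
  · -- The image is invariant under conjugation by the partial products, hence by all generators.
    let S : Submodule k A :=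
      { carrier := {x | ∃ b : Fin m → A,
          ∑ i, relDiff k T i • toRegular k A (b i) = toRegular k A x}
        zero_mem' := ⟨0, by simp⟩
        add_mem' := by
          rintro _ _ ⟨b, hb⟩ ⟨b', hb'⟩
          refine ⟨b + b', ?_⟩
          simp only [Pi.add_apply, map_add, smul_add, Finset.sum_add_distrib, hb, hb']
        smul_mem' := by
          rintro r _ ⟨b, hb⟩
          refine ⟨r • b, ?_⟩
          simp only [Pi.smul_apply, map_smul, smul_algebra_smul_comm, ← Finset.smul_sum, hb] }
    have hS : ∀ (i : Fin m) (b : A), (toRegular k A).symm (relDiff k T i • toRegular k A b) ∈ S :=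
      fun i b => by
        refine ⟨Pi.single i b, ?_⟩
        rw [Finset.sum_eq_single i, Pi.single_eq_same, LinearEquiv.apply_symm_apply]
        · intro j _ hj
          rw [Pi.single_eq_of_ne hj, map_zero, smul_zero]
        · simp
    have hU : ∀ (j : Fin (m + 1)) (b : A), (toRegular k A).symm
        (conj k (Fin.partialProd T j) • toRegular k A b) - b ∈ S := fun j => by
      induction j using Fin.induction with
      | zero =>
        intro b
        rw [Fin.partialProd_zero, map_one, one_smul, LinearEquiv.symm_apply_apply, sub_self]
        exact S.zero_mem
      | succ j ih =>
        intro b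
        have h := S.add_mem (hS j b) (ih b)
        rwa [relDiff, sub_smul, map_sub, sub_add_sub_cancel] at h
    have hle : commutatorSpace k A ≤ S := hT.commutatorSpace_le S fun i a => by
      have h := S.sub_mem (hU i.succ a) (hU i.castSucc (T i * a * ((T i)⁻¹ : Aˣ)))
      rwa [Fin.partialProd_succ, map_mul, mul_smul, conj_smul_toRegular (T i), sub_sub_sub_cancel_left]
        at h
    intro hx
    obtain ⟨b, hb⟩ := hle hx
    refine ⟨(∑ i, (LinearMap.toSpanSingleton (Env k A) _ (toRegular k A (b i))) ∘ₗ
      (LinearMap.proj i)) ∘ₗ (relModule k T d).subtype, ?_⟩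
    rw [← hb, LinearMap.comp_apply, LinearMap.sum_apply]
    refine Finset.sum_congr rfl fun i _ => ?_
    simp [relDeriv_apply]
  · rintro ⟨φ, hφ⟩
    rw [hT.map_relDeriv_one] at hφ
    rw [← (toRegular k A).symm_apply_apply x, ← hφ, map_sum]
    refine Submodule.sum_mem _ fun i _ => ?_
    rw [← (toRegular k A).apply_symm_apply (φ (hT.gen i)), relDiff, sub_smul, map_sub,
      conj_smul_toRegular, conj_smul_toRegular, LinearEquiv.symm_apply_apply,
      LinearEquiv.symm_apply_apply, ← sub_sub_sub_cancel_right _ _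
        ((toRegular k A).symm (φ (hT.gen i)))]
    exact Submodule.sub_mem _ (conj_sub_mem_commutatorSpace _ _) (conj_sub_mem_commutatorSpace _ _)

theorem mulSwap_relModule (z : relModule k T d) (i : Fin m) :
    ∃ w : A, mulSwap k A ((z : Fin m → Env k A) i) = ((T i)⁻¹ : Aˣ) * w * T i - w := by
  obtain ⟨y, hy⟩ := hT.exists_eq_mul_conj_sub_one z i
  exact ⟨mulSwap k A y, by rw [hy, mul_sub, mul_one, map_sub, mulSwap_mul_conj]⟩

omit [CharZero k] in
theorem mulSwap_relDeriv (v : A) (i : Fin m) :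
    mulSwap k A ((hT.relDeriv ((1 : A) ⊗ₜ op v) : Fin m → Env k A) i) =
      ((Fin.partialProd T i.succ)⁻¹ : Aˣ) * v * Fin.partialProd T i.succ -
      ((Fin.partialProd T i.castSucc)⁻¹ : Aˣ) * v * Fin.partialProd T i.castSucc := by
  rw [relDeriv_apply, relDiff, mul_sub, map_sub, mulSwap_mul_conj, mulSwap_mul_conj,
    mulSwap_tmul, mul_one]

theorem mulSwap_mem_commutatorSpace_iff (v : A) :
    v ∈ commutatorSpace k A ↔ ∃ z : relModule k T d, mulSwap k A (relSum k T d z) = v := by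
  constructor
  · intro hv
    refine hT.commutatorSpace_le
      (LinearMap.range (mulSwap k A ∘ₗ (relSum k T d).restrictScalars k)) (fun i a => ?_) hv
    refine ⟨((((1 : A) ⊗ₜ[k] op (-(T i * a * ((T i)⁻¹ : Aˣ)) : A))) * (conj k (T i) - 1)) •
      hT.gen i, ?_⟩
    change mulSwap k A (relSum k T d _) = _
    rw [map_smul, hT.relSum_gen, smul_eq_mul, mul_assoc, mul_sub (conj k (T i) - 1), mul_one,
      hT.sub_one_mul_centralizerIdem, sub_zero, mul_sub, mul_one, map_sub,
      mulSwap_mul_conj, mulSwap_tmul]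
    simp only [mul_one, mul_neg, neg_mul, mul_assoc, Units.inv_mul_cancel_left, Units.inv_mul]
    rw [neg_sub_neg]
  · rintro ⟨z, rfl⟩
    rw [relSum_apply, map_sum]
    refine Submodule.sum_mem _ fun i _ => ?_
    obtain ⟨w, hw⟩ := hT.mulSwap_relModule z i
    rw [hw]
    have := conj_sub_mem_commutatorSpace (k := k) (T i)⁻¹ w
    rwa [inv_inv] at this

omit [CharZero k] in
theorem mulSwap_relDeriv_eq_zero_iff (v : A) :
    (∀ i, mulSwap k A ((hT.relDeriv ((1 : A) ⊗ₜ op v) : Fin m → Env k A) i) = 0) ↔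
      v ∈ Subalgebra.center k A := by
  simp only [mulSwap_relDeriv]
  constructor
  · intro h
    have hU : ∀ j : Fin (m + 1),
        ((Fin.partialProd T j)⁻¹ : Aˣ) * v * Fin.partialProd T j = v := fun j => by
      induction j using Fin.induction with
      | zero => simp
      | succ j ih =>
        have := h j
        rwa [ih, sub_eq_zero] at this
    refine hT.mem_center_of_commute v fun i => ?_
    have h1 := hU i.succ
    rw [Fin.partialProd_succ, mul_inv_rev, Units.val_mul, Units.val_mul] at h1
    have h2 : ((T i)⁻¹ : Aˣ) * (((Fin.partialProd T i.castSucc)⁻¹ : Aˣ) * v *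
        Fin.partialProd T i.castSucc : A) * T i = v := by
      simpa only [mul_assoc] using h1
    rw [hU, mul_assoc, Units.inv_mul_eq_iff_eq_mul] at h2
    exact h2.symm
  · intro hv i
    rw [Subalgebra.mem_center_iff] at hv
    rw [hv, hv, mul_assoc, mul_assoc, Units.inv_mul, Units.inv_mul, sub_self]

/-- Exactness of the homology complex in degree one. With `s_i` the sum of the components of the
cycle before the `i`-th one, the commutators `T i b_i - b_i T i` for `b_i = w_i - s_i` are compatible
with the relation `T 0 ⋯ T (m - 1) = c`, and the inner derivation that they extend to
provides the element whose boundary is the given cycle. -/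
theorem exists_mulSwap_relDeriv_eq
    (hinner : ∀ D : A →ₗ[k] A, (∀ a b, D (a * b) = a * D b + D a * b) →
      ∃ x, ∀ a, D a = a * x - x * a)
    (z : relModule k T d) (hz : mulSwap k A (relSum k T d z) = 0) :
    ∃ v : A, ∀ i, mulSwap k A ((z : Fin m → Env k A) i) =
      mulSwap k A ((hT.relDeriv ((1 : A) ⊗ₜ op v) : Fin m → Env k A) i) := by
  choose w hw using hT.mulSwap_relModule z
  let g : Fin m → ConjAct Aˣ := fun i => ConjAct.toConjAct (T i)
  let P : Fin (m + 1) → ConjAct Aˣ := fun j => ConjAct.toConjAct (Fin.partialProd T j)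
  have hg : ∀ (i : Fin m) (a : A), g i • a = T i * a * ((T i)⁻¹ : Aˣ) := fun i a =>
    ConjAct.units_smul_def _ _
  have hP : ∀ i : Fin m, P i.succ = P i.castSucc * g i := fun i => by
    simp only [P, g, Fin.partialProd_succ, map_mul]
  have hP0 : P 0 = 1 := by simp only [P, Fin.partialProd_zero, map_one]
  have hconj : ∀ (j : Fin (m + 1)) (a : A),
      conj k (Fin.partialProd T j) • toRegular k A a = toRegular k A (P j • a) := fun j a => by
    rw [conj_smul_toRegular]
    exact congrArg _ (ConjAct.units_smul_def (ConjAct.toConjAct (Fin.partialProd T j)) a).symm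
  let y : Fin m → A := fun i => mulSwap k A ((z : Fin m → Env k A) i)
  have hy : ∀ i, y i = (g i)⁻¹ • w i - w i := fun i => by
    rw [eq_sub_iff_add_eq, eq_inv_smul_iff, hg]
    simp only [y, hw, sub_add_cancel, mul_assoc, Units.mul_inv_cancel_left, Units.mul_inv, mul_one]
  let s := Fin.partialSum y
  have hs : ∀ i : Fin m, s i.succ = s i.castSucc + y i := fun i => Fin.partialSum_succ _ _
  have hs0 : s 0 = 0 := Fin.partialSum_zero _
  have hslast : s (Fin.last m) = 0 := by
    have h := Fin.sum_succ_sub_castSucc s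
    simp only [hs, add_sub_cancel_left, hs0, sub_zero] at h
    rw [← h, ← hz, relSum_apply, map_sum]
  have hb : ∑ i, relDiff k T i • toRegular k A (w i - s i.castSucc) = 0 := by
    have h1 : ∀ i, relDiff k T i • toRegular k A (w i - s i.castSucc) =
        toRegular k A (-(P i.succ • s i.succ - P i.castSucc • s i.castSucc)) := fun i => by
      rw [relDiff, sub_smul, hconj, hconj, ← map_sub, hs, hP, hy]
      simp only [mul_smul, smul_sub, smul_add, smul_inv_smul]
      congr 1
      abel
    simp only [h1]
    rw [← map_sum, Finset.sum_neg_distrib, Fin.sum_succ_sub_castSucc fun j => P j • s j]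
    simp only [hs0, hslast, smul_zero, sub_zero, neg_zero, map_zero]
  obtain ⟨D, hD, hDT⟩ := hT.exists_derivation _ hb
  obtain ⟨x, hx⟩ := hinner ((toRegular k A).symm.toLinearMap ∘ₗ D) fun a b => by
    have h := hD a b
    rw [← (toRegular k A).apply_symm_apply (D b), ← (toRegular k A).apply_symm_apply (D a),
      tmul_smul_toRegular, ← op_one, tmul_smul_toRegular, ← map_add, mul_one, one_mul] at h
    exact (congrArg (toRegular k A).symm h).trans ((toRegular k A).symm_apply_apply _)
  have hgx : ∀ i, (g i)⁻¹ • (w i - s i.castSucc - x) = w i - s i.castSucc - x := fun i => by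
    have h1 := (hx (T i)).symm
    have h2 := congrArg (toRegular k A).symm (hDT i)
    rw [tmul_smul_toRegular, ← op_one, tmul_smul_toRegular, ← map_sub, mul_one, one_mul,
      LinearEquiv.symm_apply_apply] at h2
    have h3 := h1.trans h2
    rw [inv_smul_eq_iff, hg, Units.eq_mul_inv_iff_mul_eq, mul_sub, sub_mul]
    rw [sub_eq_sub_iff_sub_eq_sub]
    rw [← neg_sub ((T i : A) * (w i - s i.castSucc)), ← h3, neg_sub]
  have hxs : ∀ i, x + s i.succ = (g i)⁻¹ • (x + s i.castSucc) := fun i => by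
    have h1 := hgx i
    rw [hs, hy]
    simp only [smul_sub, smul_add] at h1 ⊢
    rw [sub_sub, sub_sub, sub_eq_sub_iff_add_eq_add] at h1
    have h2 : (g i)⁻¹ • w i = w i - (s i.castSucc + x) + ((g i)⁻¹ • s i.castSucc + (g i)⁻¹ • x) := by
      rw [sub_add_eq_add_sub, ← h1, add_sub_cancel_right]
    rw [h2]
    abel
  have hPx : ∀ j, x + s j = (P j)⁻¹ • x := fun j => by
    induction j using Fin.induction with
    | zero => rw [hP0, inv_one, one_smul, hs0, add_zero]
    | succ j ih => rw [hxs, ih, hP, mul_inv_rev, mul_smul]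
  refine ⟨x, fun i => ?_⟩
  have hPinv : ∀ j, (P j)⁻¹ • x =
      ((Fin.partialProd T j)⁻¹ : Aˣ) * x * Fin.partialProd T j := fun j => by
    rw [inv_smul_eq_iff]
    have := ConjAct.units_smul_def (P j)
      (((Fin.partialProd T j)⁻¹ : Aˣ) * x * Fin.partialProd T j : A)
    rw [this]
    simp [P, mul_assoc]
  rw [mulSwap_relDeriv, ← hPinv, ← hPinv, ← hPx, ← hPx, hs, add_sub_add_left_eq_sub,
    add_sub_cancel_left]

theorem mem_commutators_relBimodule_iff (z : relModule k T d) :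
    (id z : relBimodule k T d) ∈ commutators k (relBimodule k T d) ↔
      ∀ i, mulSwap k A ((z : Fin m → Env k A) i) = 0 := by
  constructor
  · intro h i
    have h1 := commutators_le_comap k (ofRel (T := T) (d := d) (N := freeBimodule k A)
      ((LinearMap.proj i) ∘ₗ (relModule k T d).subtype)) h
    rw [commutators_freeBimodule] at h1
    exact h1
  · intro h
    have h1 := Submodule.sum_mem (commutators k (relBimodule k T d))
      (t := Finset.univ) (f := fun i => (z : Fin m → Env k A) i • hT.gen i) fun i _ => by
        have h2 : (id ((z : Fin m → Env k A) i) : freeBimodule k A) ∈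
            commutators k (freeBimodule k A) := by
          rw [commutators_freeBimodule]
          exact h i
        exact commutators_le_comap k (ofFree (N := relBimodule k T d)
          (LinearMap.toSpanSingleton (Env k A) (relModule k T d) (hT.gen i))) h2
    exact (congrArg (fun y => (id y : relBimodule k T d) ∈ commutators k (relBimodule k T d))
      (hT.eq_sum_gen z)).mpr h1

end IsPresentation

end Hochschild
end

noncomputable section

/-! ### Hochschild homology and cohomology in terms of the center and of commutators -/

namespace Hochschild

open MulOpposite CategoryTheory ModuleCat

universe u

variable {k A : Type u} [Field k] [Ring A] [Algebra k A]

namespace IsPresentation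

variable {m : ℕ} {T : Fin m → Aˣ} {d : Fin m → ℕ} {c : kˣ} [CharZero k]
  (hT : IsPresentation T d c) (hreg : ∀ z : Env k A, (∀ i, z * conj k (T i) = z) → z = 0)

theorem resolution_d_one_zero : (hT.resolution hreg).complex.d 1 0 =
    ofRel (N := freeBimodule k A) (relSum k T d) :=
  ProjectiveResolution.lengthTwoComplex_d_one_zero _ _
    (ModuleCat.hom_ext (LinearMap.ext hT.relSum_relDeriv))

theorem resolution_d_two_one : (hT.resolution hreg).complex.d 2 1 =
    ofFree (N := relBimodule k T d) hT.relDeriv :=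
  ProjectiveResolution.lengthTwoComplex_d_two_one _ _
    (ModuleCat.hom_ext (LinearMap.ext hT.relSum_relDeriv))

theorem resolution_d_three_two : (hT.resolution hreg).complex.d 3 2 = 0 :=
  ProjectiveResolution.lengthTwoComplex_d_three_two _ _
    (ModuleCat.hom_ext (LinearMap.ext hT.relSum_relDeriv))

theorem isZero_resolution_X (n : ℕ) : Limits.IsZero ((hT.resolution hreg).complex.X (n + 3)) :=
  ProjectiveResolution.isZero_lengthTwoComplex_X _ _
    (ModuleCat.hom_ext (LinearMap.ext hT.relSum_relDeriv)) n

/-- The cochain complex that computes the cohomology of `A`. -/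
def cochains : CochainComplex (ModuleCat.{u} k) ℕ :=
  (hT.resolution hreg).complex.linearYonedaObj k (regular k A)

theorem cochains_d (i j : ℕ) (f : (hT.resolution hreg).complex.X i ⟶ regular k A) :
    ((hT.cochains hreg).d i j).hom f = (hT.resolution hreg).complex.d j i ≫ f :=
  congrArg (fun g => g.hom f)
    (ChainComplex.linearYonedaObj_d (hT.resolution hreg).complex k (regular k A) i j)

theorem cochains_d_zero_one (φ : freeBimodule k A ⟶ regular k A) :
    ((hT.cochains hreg).d 0 1).hom φ = ofRel (N := freeBimodule k A) (relSum k T d) ≫ φ :=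
  (hT.cochains_d hreg 0 1 φ).trans (congrArg (· ≫ φ) (hT.resolution_d_one_zero hreg))

theorem cochains_d_one_two (φ : relBimodule k T d ⟶ regular k A) :
    ((hT.cochains hreg).d 1 2).hom φ = ofFree (N := relBimodule k T d) hT.relDeriv ≫ φ :=
  (hT.cochains_d hreg 1 2 φ).trans (congrArg (· ≫ φ) (hT.resolution_d_two_one hreg))

theorem cochains_d_two_three : (hT.cochains hreg).d 2 3 = 0 := by
  have h : ∀ φ : (hT.resolution hreg).complex.X 2 ⟶ regular k A,
      (hT.resolution hreg).complex.d 3 2 ≫ φ = 0 := fun φ => by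
    rw [hT.resolution_d_three_two, Limits.zero_comp]
  exact ModuleCat.hom_ext (LinearMap.ext fun φ => (hT.cochains_d hreg 2 3 φ).trans (h φ))

theorem nonempty_cohomology_equiv_homology (n : ℕ) :
    Nonempty (cohomology k A n ≃ₗ[k] (hT.cochains hreg).homology n) :=
  ⟨((hT.resolution hreg).isoExt n (regular k A)).toLinearEquiv⟩

/-- The chain complex that computes the homology of `A`. -/
def chains : ChainComplex (ModuleCat.{u} k) ℕ :=
  ((commutatorQuotient k A).mapHomologicalComplex _).obj (hT.resolution hreg).complex

theorem nonempty_homology_equiv_homology (n : ℕ) :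
    Nonempty (homology k A n ≃ₗ[k] (hT.chains hreg).homology n) :=
  ⟨((hT.resolution hreg).isoLeftDerivedObj (commutatorQuotient k A) n).toLinearEquiv⟩

theorem chains_d_one_zero : (hT.chains hreg).d 1 0 =
    (commutatorQuotient k A).map (ofRel (N := freeBimodule k A) (relSum k T d)) :=
  congrArg (commutatorQuotient k A).map (hT.resolution_d_one_zero hreg)

theorem chains_d_two_one : (hT.chains hreg).d 2 1 =
    (commutatorQuotient k A).map (ofFree (N := relBimodule k T d) hT.relDeriv) :=
  congrArg (commutatorQuotient k A).map (hT.resolution_d_two_one hreg)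

theorem chains_d_three_two : (hT.chains hreg).d 3 2 = 0 := by
  have h := congrArg (commutatorQuotient k A).map (hT.resolution_d_three_two hreg)
  rw [Functor.map_zero] at h
  exact h

include hT hreg

/-- The zeroth cohomology is the center. -/
theorem nonempty_cohomology_zero_equiv :
    Nonempty (cohomology k A 0 ≃ₗ[k] Subalgebra.center k A) := by
  obtain ⟨e⟩ := hT.nonempty_cohomology_equiv_homology hreg 0
  let f : Subalgebra.center k A →ₗ[k] (hT.cochains hreg).X 0 :=
    { toFun := fun z => ofFree (LinearMap.toSpanSingleton (Env k A) (regular k A)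
        (toRegular k A z))
      map_add' := fun y z => ModuleCat.hom_ext (LinearMap.ext fun x => smul_add _ _ _)
      map_smul' := fun r z => ModuleCat.hom_ext (LinearMap.ext fun (x : Env k A) => by
        change x • toRegular k A (r • (z : A)) = r • x • toRegular k A z
        rw [map_smul, smul_algebra_smul_comm]) }
  obtain ⟨e'⟩ := nonempty_homology_equiv_of_injective (hT.cochains hreg) (i := 0) (j := 0) (l := 1)
    (by simp) (by simp) f ((hT.cochains hreg).shape _ _ (by simp)) (fun y z h => by
      have h1 := congrArg (fun g => g.hom (1 : Env k A)) h
      exact Subtype.ext ((toRegular k A).injective ((one_smul _ _).symm.trans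
        (h1.trans (one_smul _ _))))) (fun φ => by
      refine Iff.trans (Eq.congr_left (hT.cochains_d_zero_one hreg φ)) ?_
      let φ' : Env k A →ₗ[Env k A] regular k A := φ.hom
      have hφ : ∀ y, φ' y = y • φ' 1 := fun y => by
        rw [← map_smul, smul_eq_mul, mul_one]
      constructor
      · intro h
        have hz : ∀ z : relModule k T d, φ' (relSum k T d z) = 0 := fun z =>
          congrArg (fun g => g.hom z) h
        refine ⟨⟨(toRegular k A).symm (φ' 1), (hT.relSum_smul_eq_zero_iff _).1 fun z => ?_⟩, ?_⟩
        · rw [LinearEquiv.apply_symm_apply, ← hφ]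
          exact hz z
        · have h1 : ∀ y : Env k A, y • toRegular k A ((toRegular k A).symm (φ' 1)) = φ' y :=
            fun y => by rw [LinearEquiv.apply_symm_apply, hφ y]
          exact ModuleCat.hom_ext (LinearMap.ext h1)
      · rintro ⟨z, rfl⟩
        exact ModuleCat.hom_ext (LinearMap.ext fun y =>
          (hT.relSum_smul_eq_zero_iff _).2 z.2 y))
  exact ⟨e.trans e'⟩

/-- The first cohomology vanishes when all derivations are inner. -/
theorem subsingleton_cohomology_one
    (hinner : ∀ D : A →ₗ[k] A, (∀ a b, D (a * b) = a * D b + D a * b) →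
      ∃ x, ∀ a, D a = a * x - x * a) : Subsingleton (cohomology k A 1) := by
  obtain ⟨e⟩ := hT.nonempty_cohomology_equiv_homology hreg 1
  have := subsingleton_homology_of_exact (hT.cochains hreg) (i := 0) (j := 1) (l := 2)
    (by simp) (by simp) (fun φ hφ => by
      replace hφ := (hT.cochains_d_one_two hreg φ).symm.trans hφ
      let φ' : relModule k T d →ₗ[Env k A] regular k A := φ.hom
      obtain ⟨x, hx⟩ := hT.exists_eq_relSum_smul hinner φ'
        (congrArg (fun g => g.hom (1 : Env k A)) hφ)
      refine ⟨ofFree (LinearMap.toSpanSingleton (Env k A) (regular k A) (toRegular k A x)), ?_⟩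
      refine (hT.cochains_d_zero_one hreg _).trans ?_
      exact ModuleCat.hom_ext (LinearMap.ext fun z => (hx z).symm))
  exact e.injective.subsingleton

/-- The second cohomology is the quotient of `A` by the commutators. -/
theorem nonempty_cohomology_two_equiv :
    Nonempty (cohomology k A 2 ≃ₗ[k] A ⧸ commutatorSpace k A) := by
  obtain ⟨e⟩ := hT.nonempty_cohomology_equiv_homology hreg 2
  let f : (hT.cochains hreg).X 2 →ₗ[k] A ⧸ commutatorSpace k A :=
    { toFun := fun φ => (commutatorSpace k A).mkQ ((toRegular k A).symm (φ.hom (1 : Env k A)))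
      map_add' := fun φ ψ => by
        rw [← map_add, ← map_add]
        rfl
      map_smul' := fun r φ => by
        rw [RingHom.id_apply, ← map_smul, ← map_smul]
        rfl }
  obtain ⟨e'⟩ := nonempty_homology_equiv_of_surjective (hT.cochains hreg)
    (i := 1) (j := 2) (l := 3) (by simp) (by simp) f (hT.cochains_d_two_three hreg) (fun x => by
      obtain ⟨x, rfl⟩ := Submodule.mkQ_surjective _ x
      refine ⟨ofFree (LinearMap.toSpanSingleton (Env k A) (regular k A) (toRegular k A x)), ?_⟩
      change (commutatorSpace k A).mkQ ((toRegular k A).symm ((1 : Env k A) • toRegular k A x)) = _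
      rw [one_smul, LinearEquiv.symm_apply_apply]) (fun φ => by
      let φ' : Env k A →ₗ[Env k A] regular k A := φ.hom
      have hφ : ∀ y, φ' y = y • φ' 1 := fun y => by
        rw [← map_smul, smul_eq_mul, mul_one]
      refine (Submodule.Quotient.mk_eq_zero _).trans
        ((hT.mem_commutatorSpace_iff_exists_map _).trans ⟨?_, ?_⟩)
      · rintro ⟨ψ, hψ⟩
        refine ⟨ofRel ψ, ?_⟩
        rw [LinearEquiv.apply_symm_apply] at hψ
        have h1 : ∀ y : Env k A, ψ (hT.relDeriv y) = φ' y := fun y => by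
          rw [hφ y, show φ' 1 = _ from hψ.symm, ← map_smul, ← map_smul, smul_eq_mul, mul_one]
        exact (hT.cochains_d_one_two hreg _).trans (ModuleCat.hom_ext (LinearMap.ext h1))
      · rintro ⟨ψ, hψ⟩
        refine ⟨ψ.hom, ?_⟩
        rw [LinearEquiv.apply_symm_apply]
        have h := (hT.cochains_d_one_two hreg ψ).symm.trans hψ
        exact congrArg (fun g => g.hom (1 : Env k A)) h)
  exact ⟨e.trans e'⟩

theorem subsingleton_cohomology_of_two_lt (n : ℕ) (hn : 2 < n) :
    Subsingleton (cohomology k A n) := by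
  obtain ⟨n, rfl⟩ := Nat.exists_eq_add_of_le' hn
  obtain ⟨e⟩ := hT.nonempty_cohomology_equiv_homology hreg (n + 3)
  have := subsingleton_homology_of_exact (hT.cochains hreg)
    (i := n + 2) (j := n + 3) (l := n + 4) (by simp) (by simp)
    (fun φ _ => ⟨0, by
      rw [map_zero]
      exact (hT.isZero_resolution_X hreg n).eq_of_src _ _⟩)
  exact e.injective.subsingleton

omit hT hreg [CharZero k] in
variable (k A) in
/-- The commutator quotient of the free bimodule is `A`. -/
theorem exists_commutatorQuotient_free_equiv :
    ∃ e : (commutatorQuotient k A).obj (freeBimodule k A) ≃ₗ[k] A,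
      ∀ y : Env k A, e (Submodule.Quotient.mk (p := commutators k (freeBimodule k A)) y) =
        mulSwap k A y :=
  ⟨(Submodule.quotEquivOfEq _ _ commutators_freeBimodule).trans
    ((mulSwapFree k A).quotKerEquivOfSurjective fun a =>
      ⟨(1 : A) ⊗ₜ[k] op a, (mulSwap_tmul _ _).trans (mul_one a)⟩), fun _ => rfl⟩

/-- The zeroth homology is the quotient of `A` by the commutators. -/
theorem nonempty_homology_zero_equiv :
    Nonempty (homology k A 0 ≃ₗ[k] A ⧸ commutatorSpace k A) := by
  obtain ⟨e⟩ := hT.nonempty_homology_equiv_homology hreg 0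
  obtain ⟨μ, hμ⟩ := exists_commutatorQuotient_free_equiv k A
  let f : (hT.chains hreg).X 0 →ₗ[k] A ⧸ commutatorSpace k A :=
    (commutatorSpace k A).mkQ ∘ₗ μ.toLinearMap
  obtain ⟨e'⟩ := nonempty_homology_equiv_of_surjective (hT.chains hreg)
    (i := 1) (j := 0) (l := 0) (by simp) (by simp) f ((hT.chains hreg).shape _ _ (by simp))
    ((Submodule.mkQ_surjective _).comp μ.surjective) (fun x => by
      rw [hT.chains_d_one_zero]
      refine (Submodule.Quotient.mk_eq_zero _).trans
        ((hT.mulSwap_mem_commutatorSpace_iff _).trans ⟨?_, ?_⟩)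
      · rintro ⟨z, hz⟩
        refine ⟨Submodule.Quotient.mk (p := commutators k (relBimodule k T d)) z, ?_⟩
        refine μ.injective ?_
        exact (hμ _).trans hz
      · rintro ⟨z, rfl⟩
        obtain ⟨z, rfl⟩ := Submodule.Quotient.mk_surjective _ z
        exact ⟨z, (hμ _).symm⟩)
  exact ⟨e.trans e'⟩

/-- The first homology vanishes when all derivations are inner. -/
theorem subsingleton_homology_one
    (hinner : ∀ D : A →ₗ[k] A, (∀ a b, D (a * b) = a * D b + D a * b) →
      ∃ x, ∀ a, D a = a * x - x * a) : Subsingleton (homology k A 1) := by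
  obtain ⟨e⟩ := hT.nonempty_homology_equiv_homology hreg 1
  obtain ⟨μ, hμ⟩ := exists_commutatorQuotient_free_equiv k A
  have := subsingleton_homology_of_exact (hT.chains hreg) (i := 2) (j := 1) (l := 0)
    (by simp) (by simp) (fun z hz => by
      rw [hT.chains_d_one_zero] at hz
      rw [hT.chains_d_two_one]
      obtain ⟨z, rfl⟩ := Submodule.Quotient.mk_surjective (commutators k (relBimodule k T d)) z
      change relModule k T d at z
      obtain ⟨v, hv⟩ := hT.exists_mulSwap_relDeriv_eq hinner z
        ((hμ _).symm.trans ((congrArg μ hz).trans (map_zero μ)))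
      refine ⟨Submodule.Quotient.mk (p := commutators k (freeBimodule k A))
        ((1 : A) ⊗ₜ[k] op v : Env k A), ?_⟩
      refine (Submodule.Quotient.eq (commutators k (relBimodule k T d))).2 ?_
      refine (hT.mem_commutators_relBimodule_iff
        (hT.relDeriv ((1 : A) ⊗ₜ[k] op v : Env k A) - z)).2 fun i => ?_
      rw [Submodule.coe_sub, Pi.sub_apply, map_sub, hv, sub_self])
  exact e.injective.subsingleton

/-- The second homology is the center. -/
theorem nonempty_homology_two_equiv :
    Nonempty (homology k A 2 ≃ₗ[k] Subalgebra.center k A) := by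
  obtain ⟨e⟩ := hT.nonempty_homology_equiv_homology hreg 2
  obtain ⟨μ, hμ⟩ := exists_commutatorQuotient_free_equiv k A
  let f : Subalgebra.center k A →ₗ[k] (hT.chains hreg).X 2 :=
    μ.symm.toLinearMap ∘ₗ (Subalgebra.toSubmodule (Subalgebra.center k A)).subtype
  have key : ∀ v : A, ((hT.chains hreg).d 2 1).hom (μ.symm v) = 0 ↔ v ∈ Subalgebra.center k A :=
    fun v => by
      have hv : μ.symm v = Submodule.Quotient.mk (p := commutators k (freeBimodule k A))
          ((1 : A) ⊗ₜ[k] op v : Env k A) := by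
        refine (μ.symm_apply_eq).2 (Eq.symm ((hμ _).trans ?_))
        rw [mulSwap_tmul, mul_one]
      rw [hT.chains_d_two_one, hv, ← hT.mulSwap_relDeriv_eq_zero_iff,
        ← hT.mem_commutators_relBimodule_iff]
      exact Submodule.Quotient.mk_eq_zero (commutators k (relBimodule k T d))
  obtain ⟨e'⟩ := nonempty_homology_equiv_of_injective (hT.chains hreg)
    (i := 3) (j := 2) (l := 1) (by simp) (by simp) f (hT.chains_d_three_two hreg)
    (μ.symm.injective.comp Subtype.val_injective) (fun x => by
      obtain ⟨v, rfl⟩ := μ.symm.surjective x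
      refine (key v).trans ⟨fun hv => ⟨⟨v, hv⟩, rfl⟩, ?_⟩
      rintro ⟨w, hw⟩
      rw [← μ.symm.injective hw]
      exact w.2)
  exact ⟨e.trans e'⟩

theorem subsingleton_homology_of_two_lt (n : ℕ) (hn : 2 < n) :
    Subsingleton (homology k A n) := by
  obtain ⟨n, rfl⟩ := Nat.exists_eq_add_of_le' hn
  obtain ⟨e⟩ := hT.nonempty_homology_equiv_homology hreg (n + 3)
  have hX : Limits.IsZero ((hT.chains hreg).X (n + 3)) :=
    (commutatorQuotient k A).map_isZero (hT.isZero_resolution_X hreg n)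
  have := ModuleCat.subsingleton_of_isZero hX
  have := subsingleton_homology_of_exact (hT.chains hreg)
    (i := n + 4) (j := n + 3) (l := n + 2) (by simp) (by simp)
    (fun φ _ => ⟨0, Subsingleton.elim _ _⟩)
  exact e.injective.subsingleton

end IsPresentation

end Hochschild
end

noncomputable section

/-! ### Operators that permute a basis up to scalars -/

namespace MonomialOperator

open Module

variable {k M Λ : Type*} [Field k] [AddCommGroup M] [Module k M] (b : Basis Λ k M)
  {X P : M →ₗ[k] M} {σ τ : Equiv.Perm Λ} {χ ψ : Λ → k}

theorem repr_apply (hX : ∀ g, X (b g) = χ g • b (σ g)) (m : M) (g : Λ) :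
    b.repr (X m) (σ g) = χ g * b.repr m g := by
  suffices h : Finsupp.lapply (σ g) ∘ₗ b.repr.toLinearMap ∘ₗ X =
      χ g • (Finsupp.lapply g ∘ₗ b.repr.toLinearMap) from LinearMap.congr_fun h m
  refine b.ext fun h => ?_
  simp only [LinearMap.comp_apply, LinearEquiv.coe_coe, hX, map_smul, Basis.repr_self,
    Finsupp.lapply_apply, LinearMap.smul_apply, smul_eq_mul]
  by_cases e : h = g
  · rw [e, Finsupp.single_eq_same, Finsupp.single_eq_same]
  · rw [Finsupp.single_eq_of_ne fun e' => e (σ.injective e'.symm),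
      Finsupp.single_eq_of_ne (Ne.symm e)]
    simp

theorem repr_pow_apply_eq_zero (hX : ∀ g, X (b g) = χ g • b (σ g)) {m : M} {g : Λ}
    (h : b.repr m g = 0) (n : ℕ) : b.repr ((X ^ n) m) ((σ ^ n) g) = 0 := by
  induction n with
  | zero => exact h
  | succ n ih =>
    rw [pow_succ', pow_succ', Module.End.mul_apply, Equiv.Perm.mul_apply, repr_apply b hX, ih,
      mul_zero]

/-- A vector fixed by the operator has no component along an infinite orbit. -/
theorem repr_eq_zero_of_fixed (hX : ∀ g, X (b g) = χ g • b (σ g)) (hχ : ∀ g, χ g ≠ 0) {m : M}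
    (hm : X m = m) {g : Λ} (hg : Function.Injective fun n : ℕ => (σ ^ n) g) :
    b.repr m g = 0 := by
  by_contra h
  have hn : ∀ n : ℕ, (σ ^ n) g ∈ (b.repr m).support := fun n => by
    induction n with
    | zero => simpa using h
    | succ n ih =>
      rw [Finsupp.mem_support_iff, pow_succ', Equiv.Perm.mul_apply, ← hm, repr_apply b hX]
      exact mul_ne_zero (hχ _) (Finsupp.mem_support_iff.1 ih)
  exact Set.infinite_of_injective_forall_mem hg hn (b.repr m).support.finite_toSet

open Classical in
/-- The projection onto the span of the basis vectors with index in `U`. -/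
def restrict (U : Set Λ) : M →ₗ[k] M :=
  b.repr.symm.toLinearMap ∘ₗ
    ({ toFun := Finsupp.filter (· ∈ U)
       map_add' := fun _ _ => Finsupp.filter_add
       map_smul' := fun _ _ => Finsupp.filter_smul } : (Λ →₀ k) →ₗ[k] Λ →₀ k) ∘ₗ
    b.repr.toLinearMap

open Classical in
theorem repr_restrict (U : Set Λ) (m : M) (g : Λ) :
    b.repr (restrict b U m) g = if g ∈ U then b.repr m g else 0 := by
  simp [restrict, Finsupp.filter_apply]

theorem restrict_eq_self {U : Set Λ} {m : M} (h : ∀ g, g ∉ U → b.repr m g = 0) :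
    restrict b U m = m := by
  refine b.ext_elem fun g => ?_
  rw [repr_restrict]
  split_ifs with hg
  · rfl
  · exact (h g hg).symm

theorem restrict_eq_zero {U : Set Λ} {m : M} (h : ∀ g ∈ U, b.repr m g = 0) :
    restrict b U m = 0 := by
  refine b.ext_elem fun g => ?_
  rw [repr_restrict, map_zero, Finsupp.zero_apply]
  split_ifs with hg
  · exact h g hg
  · rfl

theorem restrict_comm (hX : ∀ g, X (b g) = χ g • b (σ g)) {U : Set Λ}
    (hU : ∀ g, σ g ∈ U ↔ g ∈ U) (m : M) : restrict b U (X m) = X (restrict b U m) := by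
  refine b.ext_elem fun g => ?_
  obtain ⟨g, rfl⟩ := σ.surjective g
  rw [repr_restrict, repr_apply b hX, repr_apply b hX, repr_restrict]
  by_cases hg : g ∈ U
  · rw [if_pos hg, if_pos ((hU g).2 hg)]
  · rw [if_neg hg, if_neg fun h => hg ((hU g).1 h), mul_zero]

/-- The index `g` has trivial stabilizer under the pair of permutations. -/
def IsFree (σ τ : Equiv.Perm Λ) (g : Λ) : Prop :=
  ∀ i j : ℤ, (σ ^ i * τ ^ j) g = g → i = 0 ∧ j = 0

theorem IsFree.of_commute {σ τ ρ : Equiv.Perm Λ} (hσ : Commute ρ σ) (hτ : Commute ρ τ) {g : Λ} :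
    IsFree σ τ (ρ g) ↔ IsFree σ τ g := by
  refine forall₂_congr fun i j => ?_
  rw [← Equiv.Perm.mul_apply,
    ← ((hσ.zpow_right i).mul_right (hτ.zpow_right j)).eq, Equiv.Perm.mul_apply,
    ρ.injective.eq_iff]

theorem IsFree.injective {σ τ : Equiv.Perm Λ} {g : Λ} (hg : IsFree σ τ g) :
    Function.Injective fun n : ℕ => (σ ^ n) g := fun i j e => by
  have e' : (σ ^ ((i : ℤ) - j) * τ ^ (0 : ℤ)) g = g := by
    rw [sub_eq_neg_add, zpow_add, zpow_neg, zpow_natCast, zpow_natCast, zpow_zero, mul_one,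
      Equiv.Perm.mul_apply, Equiv.Perm.inv_eq_iff_eq]
    exact e
  have := (hg _ _ e').1
  omega

theorem exists_pow_notMem {σ τ : Equiv.Perm Λ} (hστ : Commute σ τ) (s : Finset Λ)
    (hs : ∀ g ∈ s, IsFree σ τ g) :
    ∃ n : ℕ, ∀ g ∈ s, ∀ i : ℤ, (σ ^ i * τ ^ n) g ∉ s := by
  have hfin : (⋃ g ∈ s, ⋃ h ∈ s, {n : ℕ | ∃ i : ℤ, (σ ^ i * τ ^ n) g = h}).Finite := by
    refine s.finite_toSet.biUnion fun g hg => s.finite_toSet.biUnion fun h _ => ?_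
    refine Set.Subsingleton.finite ?_
    rintro n ⟨i, hi⟩ n' ⟨i', hi'⟩
    have hz : ∀ (i : ℤ) (n : ℕ), σ ^ i * τ ^ n = σ ^ i * τ ^ (n : ℤ) := fun i n => by
      rw [zpow_natCast]
    rw [hz] at hi hi'
    have h1 : (σ ^ (-i' + i) * τ ^ (-(n' : ℤ) + n)) g = g := by
      rw [zpow_add, zpow_add, mul_assoc, ← mul_assoc (σ ^ i),
        ((hστ.zpow_zpow i (-(n' : ℤ)))).eq, mul_assoc, ← mul_assoc, Equiv.Perm.mul_apply, hi, ← hi',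
        ← Equiv.Perm.mul_apply, zpow_neg, zpow_neg, ← mul_inv_rev,
        ((hστ.zpow_zpow i' (n' : ℤ))).eq, inv_mul_cancel, Equiv.Perm.one_apply]
    have := (hs g hg _ _ h1).2
    omega
  obtain ⟨n, hn⟩ := hfin.exists_notMem
  refine ⟨n, fun g hg i hi => hn ?_⟩
  simp only [Set.mem_iUnion]
  exact ⟨g, hg, _, hi, i, rfl⟩

/-- The first cohomology of `ℤ²` with coefficients in the span of free orbits vanishes: modulo
`X - 1`, the vector `a` agrees with all its translates `Pⁿ a`, and for large `n` these live on
other `X`-orbits. -/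
theorem exists_eq_restrict_free (hX : ∀ g, X (b g) = χ g • b (σ g))
    (hP : ∀ g, P (b g) = ψ g • b (τ g)) (hχ : ∀ g, χ g ≠ 0)
    (hστ : Commute σ τ) (hXP : Commute X P) {v w : M} (h : X w - w = P v - v) :
    ∃ m, restrict b {g | IsFree σ τ g} m = m ∧
      X m - m = restrict b {g | IsFree σ τ g} v ∧ P m - m = restrict b {g | IsFree σ τ g} w := by
  set S : Set Λ := {g | IsFree σ τ g} with hSdef
  have hσS : ∀ g, σ g ∈ S ↔ g ∈ S := fun g => IsFree.of_commute (Commute.refl σ) hστ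
  have hτS : ∀ g, τ g ∈ S ↔ g ∈ S := fun g => IsFree.of_commute hστ.symm (Commute.refl τ)
  have hXP' : ∀ m, X (P m) = P (X m) := fun m => LinearMap.congr_fun hXP m
  set v' := restrict b S v with hv'
  set w' := restrict b S w with hw'
  have h' : X w' - w' = P v' - v' := by
    have := congrArg (restrict b S) h
    rwa [map_sub, map_sub, restrict_comm b hX hσS, restrict_comm b hP hτS] at this
  have hsupp : ∀ g ∈ (b.repr v').support, g ∈ S := fun g hg => by
    by_contra hgS
    rw [Finsupp.mem_support_iff, hv', repr_restrict, if_neg hgS] at hg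
    exact hg rfl
  obtain ⟨n, hn⟩ := exists_pow_notMem hστ (b.repr v').support hsupp
  let U : Set Λ := {g | ∃ i : ℤ, (σ ^ i) g ∈ (b.repr v').support}
  have hU : ∀ g, σ g ∈ U ↔ g ∈ U := fun g => by
    constructor
    · rintro ⟨i, hi⟩
      refine ⟨i + 1, ?_⟩
      rw [zpow_add_one, Equiv.Perm.mul_apply]
      exact hi
    · rintro ⟨i, hi⟩
      refine ⟨i - 1, ?_⟩
      rw [zpow_sub_one, Equiv.Perm.mul_apply, Equiv.Perm.inv_def, Equiv.symm_apply_apply]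
      exact hi
  have hUS : ∀ g ∈ U, g ∈ S := fun g ⟨i, hi⟩ => by
    have := hsupp _ hi
    exact (IsFree.of_commute ((Commute.refl σ).zpow_left i) (hστ.zpow_left i)).1 this
  let wn := (∑ i ∈ Finset.range n, P ^ i) w'
  have hcomm : Commute X (∑ i ∈ Finset.range n, P ^ i) :=
    Commute.sum_right _ _ _ fun i _ => hXP.pow_right i
  have hwn : X wn - wn = (P ^ n) v' - v' := by
    have h1 : X wn = (∑ i ∈ Finset.range n, P ^ i) (X w') := LinearMap.congr_fun hcomm w'
    have h2 := LinearMap.congr_fun (geom_sum_mul P n) v'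
    rw [h1, ← map_sub, h']
    simpa using h2
  have hv0 : restrict b U ((P ^ n) v') = 0 := restrict_eq_zero b fun g ⟨i, hi⟩ => by
    obtain ⟨g, rfl⟩ := (τ ^ n).surjective g
    refine repr_pow_apply_eq_zero b hP ?_ n
    by_contra hg
    exact hn g (Finsupp.mem_support_iff.2 hg) i hi
  have hv1 : restrict b U v' = v' := restrict_eq_self b fun g hg => by
    by_contra hg'
    exact hg ⟨0, Finsupp.mem_support_iff.2 hg'⟩
  have hm1 : X (-restrict b U wn) - -restrict b U wn = v' := by
    have := congrArg (restrict b U) hwn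
    rw [map_sub, map_sub, hv0, hv1, restrict_comm b hX hU, zero_sub] at this
    rw [map_neg, neg_sub_neg, ← neg_sub, this, neg_neg]
  have hm2 : restrict b S (-restrict b U wn) = -restrict b U wn := by
    refine restrict_eq_self b fun g hg => ?_
    rw [map_neg, Finsupp.neg_apply, repr_restrict, if_neg fun h => hg (hUS g h), neg_zero]
  refine ⟨-restrict b U wn, hm2, hm1, ?_⟩
  set m := -restrict b U wn
  have hfix : X (P m - m - w') = P m - m - w' := by
    rw [← sub_eq_zero]
    have e : X (P m - m - w') - (P m - m - w') = P (X m - m) - (X m - m) - (X w' - w') := by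
      simp only [map_sub, hXP']
      abel
    rw [e, hm1, h', sub_self]
  rw [← sub_eq_zero]
  refine b.ext_elem fun g => ?_
  rw [map_zero, Finsupp.zero_apply]
  by_cases hg : g ∈ S
  · exact repr_eq_zero_of_fixed b hX hχ hfix (IsFree.injective hg)
  · have e : restrict b S (P m - m - w') = P m - m - w' := by
      rw [map_sub, map_sub, restrict_comm b hP hτS, hm2, hw',
        restrict_eq_self b (m := restrict b S w) fun g hg => by rw [repr_restrict, if_neg hg]]
    rw [← e, repr_restrict, if_neg hg]

/-- If all indices but one either have trivial stabilizer or are fixed, with a nontrivial character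
of `ℤ²`, then a cocycle is a coboundary up to components along the remaining basis vector. -/
theorem exists_repr_sub_eq (hX : ∀ g, X (b g) = χ g • b (σ g))
    (hP : ∀ g, P (b g) = ψ g • b (τ g)) (hχ : ∀ g, χ g ≠ 0)
    (hστ : Commute σ τ) (hXP : Commute X P) {o : Λ}
    (hfree : ∀ g, g ≠ o → IsFree σ τ g ∨ (σ g = g ∧ τ g = g ∧ (χ g ≠ 1 ∨ ψ g ≠ 1)))
    {v w : M} (h : X w - w = P v - v) :
    ∃ m, ∀ g, g ≠ o → b.repr (X m - m) g = b.repr v g ∧ b.repr (P m - m) g = b.repr w g := by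
  classical
  obtain ⟨m₁, hm₁, hv, hw⟩ := exists_eq_restrict_free b hX hP hχ hστ hXP h
  let f : Λ → k := fun g => if IsFree σ τ g then 0 else
    if χ g = 1 then b.repr w g / (ψ g - 1) else b.repr v g / (χ g - 1)
  let m₂ : M := b.repr.symm (Finsupp.onFinset ((b.repr v).support ∪ (b.repr w).support) f
    fun g hg => by
      by_contra hn
      simp only [Finset.mem_union, Finsupp.mem_support_iff, not_or, not_not] at hn
      simp [f, hn.1, hn.2] at hg)
  have hm₂ : ∀ g, b.repr m₂ g = f g := fun g => by simp [m₂]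
  have hS : ∀ g, IsFree σ τ g → ∀ m, (∀ g, IsFree σ τ g → b.repr m g = 0) →
      b.repr (X m) g = 0 ∧ b.repr (P m) g = 0 := fun g hg m hm => by
    constructor
    · obtain ⟨g, rfl⟩ := σ.surjective g
      rw [repr_apply b hX, hm g ((IsFree.of_commute (Commute.refl σ) hστ).1 hg), mul_zero]
    · obtain ⟨g, rfl⟩ := τ.surjective g
      rw [repr_apply b hP, hm g ((IsFree.of_commute hστ.symm (Commute.refl τ)).1 hg), mul_zero]
  have hf0 : ∀ g, IsFree σ τ g → b.repr m₂ g = 0 := fun g hg => by rw [hm₂]; exact if_pos hg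
  refine ⟨m₁ + m₂, fun g hgo => ?_⟩
  have e1 : X (m₁ + m₂) - (m₁ + m₂) = (X m₁ - m₁) + (X m₂ - m₂) := by rw [map_add]; abel
  have e2 : P (m₁ + m₂) - (m₁ + m₂) = (P m₁ - m₁) + (P m₂ - m₂) := by rw [map_add]; abel
  rw [e1, e2, hv, hw]
  simp only [map_add, map_sub, Finsupp.add_apply, Finsupp.sub_apply, repr_restrict]
  by_cases hg : IsFree σ τ g
  · rw [if_pos (show g ∈ {g | IsFree σ τ g} from hg), if_pos (show g ∈ {g | IsFree σ τ g} from hg),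
      (hS g hg m₂ hf0).1, (hS g hg m₂ hf0).2, hf0 g hg]
    simp
  · rw [if_neg (show g ∉ {g | IsFree σ τ g} from hg), if_neg (show g ∉ {g | IsFree σ τ g} from hg)]
    obtain ⟨hσ, hτ, hne⟩ := (hfree g hgo).resolve_left hg
    have hX' : ∀ m, b.repr (X m) g = χ g * b.repr m g := fun m => by
      have := repr_apply b hX m g
      rwa [hσ] at this
    have hP' : ∀ m, b.repr (P m) g = ψ g * b.repr m g := fun m => by
      have := repr_apply b hP m g
      rwa [hτ] at this
    have hrel : χ g * b.repr w g - b.repr w g = ψ g * b.repr v g - b.repr v g := by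
      rw [← hX', ← hP', ← Finsupp.sub_apply, ← map_sub, h, map_sub, Finsupp.sub_apply]
    rw [hX', hP', hm₂, zero_add, zero_add]
    simp only [f, if_neg hg]
    by_cases h1 : χ g = 1
    · have h2 : ψ g - 1 ≠ 0 := sub_ne_zero.2 (hne.resolve_left (not_not.2 h1))
      have h3 : (ψ g - 1) * b.repr v g = 0 := by
        rw [h1, one_mul, sub_self] at hrel
        rw [sub_mul, one_mul, ← hrel]
      have h4 := (mul_eq_zero.1 h3).resolve_left h2
      rw [if_pos h1, h1, h4]
      constructor
      · ring
      · field_simp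
    · have h2 : χ g - 1 ≠ 0 := sub_ne_zero.2 h1
      rw [if_neg h1]
      constructor
      · field_simp
      · field_simp
        linear_combination -hrel

end MonomialOperator

end

noncomputable section

/-! ### Twisted group algebras: the center, torsion of the conjugation action, derivations -/

section conjugation

variable (k : Type*) {A : Type*} [Field k] [Ring A] [Algebra k A]

/-- Nonzero scalars as units of an algebra. -/
abbrev scalarUnit (A : Type*) [Ring A] [Algebra k A] : kˣ →* Aˣ :=
  Units.map (algebraMap k A : k →* A)

variable {k} in
theorem scalarUnit_mul_eq_smul (c : kˣ) (a : A) : (scalarUnit k A c : A) * a = (c : k) • a :=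
  (Algebra.smul_def _ _).symm

variable {k} in
theorem mul_scalarUnit (v : Aˣ) (c : kˣ) : v * scalarUnit k A c = scalarUnit k A c * v :=
  Units.ext (Algebra.commutes (c : k) (v : A)).symm

/-- Conjugation `a ↦ v a v⁻¹` by the units of an algebra. -/
def conjugation : Aˣ →* Module.End k A where
  toFun v := LinearMap.mulLeft k (v : A) ∘ₗ LinearMap.mulRight k ((v⁻¹ : Aˣ) : A)
  map_one' := LinearMap.ext fun a => by simp
  map_mul' v w := LinearMap.ext fun a => by simp [mul_assoc]

variable {k} in
theorem conjugation_apply (v : Aˣ) (a : A) : conjugation k v a = v * a * (v⁻¹ : Aˣ) :=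
  (mul_assoc _ _ _).symm

variable {k} in
theorem conjugation_scalarUnit (c : kˣ) : conjugation k (scalarUnit k A c) = 1 :=
  LinearMap.ext fun a => by
    rw [conjugation_apply, ← map_inv, mul_assoc, Units.coe_map (algebraMap k A : k →* A) c⁻¹,
      MonoidHom.coe_coe, ← Algebra.commutes, ← MonoidHom.coe_coe (algebraMap k A), ← Units.coe_map,
      ← mul_assoc, ← Units.val_mul, ← map_mul, mul_inv_cancel, map_one, Units.val_one, one_mul]
    rfl

end conjugation

/-- The units `u g` form a basis of the algebra `A` indexed by a group, and they multiply as in the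
group up to powers of the scalar `q`. -/
structure TwistedBasis {k A G : Type*} [Field k] [Ring A] [Algebra k A] [Group G] (q : kˣ)
    (u : G → Aˣ) where
  /-- The basis consisting of the units `u g`. -/
  basis : Module.Basis G k A
  basis_apply : ∀ g, basis g = u g
  exists_mul : ∀ g h, ∃ n : ℤ, u g * u h = scalarUnit k A (q ^ n) * u (g * h)

namespace TwistedBasis

open Module MulOpposite

variable {k A G : Type*} [Field k] [Ring A] [Algebra k A] [Group G] {q : kˣ} {u : G → Aˣ}
  (hu : TwistedBasis q u)
include hu

theorem exists_one : ∃ n : ℤ, u 1 = scalarUnit k A (q ^ n) := by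
  obtain ⟨n, hn⟩ := hu.exists_mul 1 1
  rw [mul_one] at hn
  exact ⟨n, mul_right_cancel hn⟩

theorem exists_inv_mul (g h : G) :
    ∃ n : ℤ, (u g)⁻¹ * u h = scalarUnit k A (q ^ n) * u (g⁻¹ * h) := by
  obtain ⟨n, hn⟩ := hu.exists_mul g (g⁻¹ * h)
  refine ⟨-n, ?_⟩
  rw [mul_inv_cancel_left] at hn
  rw [inv_mul_eq_iff_eq_mul, ← mul_assoc, mul_scalarUnit, mul_assoc, hn, ← mul_assoc, ← map_mul,
    ← zpow_add, neg_add_cancel, zpow_zero, map_one, one_mul]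

theorem exists_conj (h g : G) :
    ∃ n : ℤ, u h * u g * (u h)⁻¹ = scalarUnit k A (q ^ n) * u (h * g * h⁻¹) := by
  obtain ⟨n, hn⟩ := hu.exists_mul h g
  obtain ⟨n', hn'⟩ := hu.exists_mul (h * g * h⁻¹) h
  refine ⟨n - n', ?_⟩
  rw [inv_mul_cancel_right] at hn'
  rw [mul_inv_eq_iff_eq_mul, mul_assoc, hn', hn, ← mul_assoc, ← map_mul, ← zpow_add,
    sub_add_cancel]

theorem eq_of_scalarUnit_mul_eq {c c' : kˣ} {g h : G}
    (e : scalarUnit k A c * u g = scalarUnit k A c' * u h) : g = h := by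
  have e' : (c : k) • hu.basis g = (c' : k) • hu.basis h := by
    rw [hu.basis_apply, hu.basis_apply, ← scalarUnit_mul_eq_smul, ← scalarUnit_mul_eq_smul]
    exact congrArg Units.val e
  by_contra hgh
  have e2 := congrArg (fun a => hu.basis.repr a g) e'
  simp [Finsupp.single_eq_of_ne hgh] at e2

/-- The permutation of the group by which conjugation by `u h` acts on the basis. -/
theorem exists_conjugation_basis (h : G) : ∃ χ : G → k, (∀ g, χ g ≠ 0) ∧ ∀ g,
    conjugation k (u h) (hu.basis g) =
      χ g • hu.basis (MulAut.toPerm G (MulAut.conj h) g) := by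
  choose n hn using hu.exists_conj h
  refine ⟨fun g => ((q ^ n g : kˣ) : k), fun g => Units.ne_zero _, fun g => ?_⟩
  rw [conjugation_apply, hu.basis_apply, hu.basis_apply, ← scalarUnit_mul_eq_smul]
  exact congrArg Units.val (hn g)

theorem commute_conjugation {x y : G} (hxy : Commute x y) :
    Commute (conjugation k (u x)) (conjugation k (u y)) := by
  obtain ⟨n, hn⟩ := hu.exists_mul x y
  obtain ⟨n', hn'⟩ := hu.exists_mul y x
  rw [Commute, SemiconjBy, ← map_mul, ← map_mul, hn, hn', map_mul, map_mul,
    conjugation_scalarUnit, conjugation_scalarUnit, hxy.eq]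

end TwistedBasis

/-- The commuting elements `x` and `y` generate a normal subgroup which acts by conjugation on each
`g` either freely, or trivially but, for `g ≠ 1`, with a nontrivial scalar on `u g`. -/
structure IsSeparatingPair {A G : Type*} [Ring A] [Group G] (u : G → Aˣ) (x y : G) : Prop where
  commute : Commute x y
  normal : (Subgroup.closure {x, y}).Normal
  free_or : ∀ g, g ≠ 1 →
    (∀ i j : ℤ, x ^ i * y ^ j * g * (x ^ i * y ^ j)⁻¹ = g → i = 0 ∧ j = 0) ∨
      (x * g * x⁻¹ = g ∧ y * g * y⁻¹ = g ∧
        (u x * u g * (u x)⁻¹ ≠ u g ∨ u y * u g * (u y)⁻¹ ≠ u g))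

namespace IsSeparatingPair

open Module MulOpposite

variable {k A G : Type*} [Field k] [Ring A] [Algebra k A] [Group G] {q : kˣ} {u : G → Aˣ}
  (hu : TwistedBasis q u) {x y : G} (hxy : IsSeparatingPair u x y)
include hu hxy

theorem free_or_fixed {χ ψ : G → k}
    (hχ : ∀ g, conjugation k (u x) (hu.basis g) =
      χ g • hu.basis (MulAut.toPerm G (MulAut.conj x) g))
    (hψ : ∀ g, conjugation k (u y) (hu.basis g) =
      ψ g • hu.basis (MulAut.toPerm G (MulAut.conj y) g)) (g : G) (hg : g ≠ 1) :
    MonomialOperator.IsFree (MulAut.toPerm G (MulAut.conj x)) (MulAut.toPerm G (MulAut.conj y)) g ∨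
      (MulAut.toPerm G (MulAut.conj x) g = g ∧ MulAut.toPerm G (MulAut.conj y) g = g ∧
        (χ g ≠ 1 ∨ ψ g ≠ 1)) := by
  obtain h | h := hxy.free_or g hg
  · refine Or.inl fun i j e => h i j ?_
    rw [← map_zpow, ← map_zpow, ← map_zpow, ← map_zpow, ← map_mul, ← map_mul] at e
    exact e
  · have h1 : ∀ (h : G) (c : k), conjugation k (u h) (hu.basis g) = c • hu.basis g → c = 1 →
        u h * u g * (u h)⁻¹ = u g := fun h c e ec => Units.ext <| by
      rw [ec, one_smul, conjugation_apply, hu.basis_apply] at e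
      exact e
    refine Or.inr ⟨h.1, h.2.1,
      h.2.2.imp (fun h' e => h' (h1 x _ ?_ e)) fun h' e => h' (h1 y _ ?_ e)⟩
    · rw [hχ]
      congr 2
      exact h.1
    · rw [hψ]
      congr 2
      exact h.2.1

omit hxy in
theorem repr_one_conjugation (h : G) (a : A) :
    hu.basis.repr (conjugation k (u h) a) 1 = hu.basis.repr a 1 := by
  obtain ⟨χ, -, hχ⟩ := hu.exists_conjugation_basis h
  have e := MonomialOperator.repr_apply hu.basis hχ a 1
  have h1 : MulAut.toPerm G (MulAut.conj h) 1 = 1 := by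
    change h * 1 * h⁻¹ = 1
    rw [mul_one, mul_inv_cancel]
  obtain ⟨n, hn⟩ := hu.exists_one
  have e' := hχ 1
  rw [h1] at e e'
  rw [hu.basis_apply, hn, conjugation_apply] at e'
  have e2 : χ 1 = 1 := by
    have e3 : ((scalarUnit k A (q ^ n) : Aˣ) : A) = χ 1 • ((scalarUnit k A (q ^ n) : Aˣ) : A) := by
      rw [← e', ← Units.val_mul, ← Units.val_mul, mul_scalarUnit, mul_inv_cancel_right]
    rw [← hn, ← hu.basis_apply] at e3
    have := congrArg (fun a => hu.basis.repr a 1) e3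
    simpa using this.symm
  rw [e, e2, one_mul]

omit hxy in
theorem repr_algebraMap (c : k) (h : hu.basis.repr (algebraMap k A c) 1 = 0) : c = 0 := by
  obtain ⟨n, hn⟩ := hu.exists_one
  have e : algebraMap k A c = (c * ((q ^ (-n) : kˣ) : k)) • hu.basis 1 := by
    rw [hu.basis_apply, hn, ← smul_smul, ← scalarUnit_mul_eq_smul (q ^ (-n)), ← Units.val_mul,
      ← map_mul, ← zpow_add, neg_add_cancel, zpow_zero, map_one, Units.val_one,
      Algebra.algebraMap_eq_smul_one]
  rw [e, map_smul, Basis.repr_self, Finsupp.smul_apply, Finsupp.single_eq_same, smul_eq_mul,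
    mul_one] at h
  exact (mul_eq_zero.1 h).resolve_right (Units.ne_zero _)

/-- An element that is fixed up to adding scalars by the conjugations by `u x` and `u y` is a
scalar. -/
theorem exists_eq_algebraMap {a : A} {α β : k}
    (hx : conjugation k (u x) a - a = algebraMap k A α)
    (hy : conjugation k (u y) a - a = algebraMap k A β) : ∃ c, a = algebraMap k A c := by
  have h0 : ∀ (h : G) (c : k), conjugation k (u h) a - a = algebraMap k A c →
      conjugation k (u h) a = a := fun h c e => by
    have hc : c = 0 := repr_algebraMap hu c (by
      rw [← e, map_sub, Finsupp.sub_apply, repr_one_conjugation hu, sub_self])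
    rwa [hc, map_zero, sub_eq_zero] at e
  replace hx := h0 x α hx
  replace hy := h0 y β hy
  obtain ⟨χ, hχ0, hχ⟩ := hu.exists_conjugation_basis x
  obtain ⟨ψ, hψ0, hψ⟩ := hu.exists_conjugation_basis y
  have h1 : a = hu.basis.repr a 1 • hu.basis 1 := by
    refine hu.basis.ext_elem fun g => ?_
    rw [map_smul, Basis.repr_self, Finsupp.smul_apply]
    by_cases hg : g = 1
    · rw [hg, Finsupp.single_eq_same, smul_eq_mul, mul_one]
    rw [Finsupp.single_eq_of_ne hg, smul_zero]
    obtain hf | ⟨h1, h2, hne⟩ := free_or_fixed hu hxy hχ hψ g hg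
    · exact MonomialOperator.repr_eq_zero_of_fixed hu.basis hχ hχ0 hx hf.injective
    · have e1 := MonomialOperator.repr_apply hu.basis hχ a g
      have e2 := MonomialOperator.repr_apply hu.basis hψ a g
      rw [h1, hx] at e1
      rw [h2, hy] at e2
      obtain h | h := hne
      · exact (mul_eq_zero.1 (by linear_combination e1 :
          (1 - χ g) * hu.basis.repr a g = 0)).resolve_left (sub_ne_zero.2 h.symm)
      · exact (mul_eq_zero.1 (by linear_combination e2 :
          (1 - ψ g) * hu.basis.repr a g = 0)).resolve_left (sub_ne_zero.2 h.symm)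
  obtain ⟨n, hn⟩ := hu.exists_one
  refine ⟨hu.basis.repr a 1 * ((q ^ n : kˣ) : k), ?_⟩
  rw [map_mul, ← Algebra.smul_def]
  conv_lhs => rw [h1, hu.basis_apply, hn]
  rfl

/-- The center consists of the scalars. -/
theorem nonempty_center_equiv : Nonempty (Subalgebra.center k A ≃ₗ[k] k) := by
  have : Nontrivial A := ⟨(u 1 : A), 0, fun h => hu.basis.ne_zero 1 (by rw [hu.basis_apply, h])⟩
  have h : Subalgebra.center k A = ⊥ := by
    refine le_antisymm (fun a ha => ?_) bot_le
    have e : ∀ h, conjugation k (u h) a - a = algebraMap k A 0 := fun h => by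
      rw [conjugation_apply, Subalgebra.mem_center_iff.1 ha, Units.mul_inv_cancel_right, sub_self,
        map_zero]
    obtain ⟨c, rfl⟩ := exists_eq_algebraMap hu hxy (e x) (e y)
    exact Subalgebra.algebraMap_mem _ c
  rw [h]
  exact ⟨(Algebra.botEquiv k A).toLinearEquiv⟩

end IsSeparatingPair

end

noncomputable section

namespace TwistedBasis

open Module MulOpposite Hochschild

universe w

variable {k A : Type w} {G : Type*} [Field k] [Ring A] [Algebra k A] [Group G] {q : kˣ}
  {u : G → Aˣ} (hu : TwistedBasis q u)
include hu

/-- If `x` has infinite order then right multiplication by `u x ⊗ (u x)⁻¹` moves the basis of the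
enveloping algebra along infinite orbits, and therefore fixes no nonzero element. -/
theorem eq_zero_of_mul_conj_eq {x : G} (hx : Function.Injective fun n : ℕ => x ^ n)
    {ι : Type*} {T : ι → Aˣ} (hxT : u x ∈ Subgroup.closure (Set.range T)) (z : Env k A)
    (hz : ∀ i, z * conj k (T i) = z) : z = 0 := by
  have hz' : z * conj k (u x) = z := by
    refine Subgroup.closure_induction (p := fun v _ => z * conj k v = z) ?_ ?_ ?_ ?_ hxT
    · rintro _ ⟨i, rfl⟩
      exact hz i
    · rw [map_one, mul_one]
    · intro v w _ _ hv hw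
      rw [map_mul, ← mul_assoc, hv, hw]
    · intro v _ hv
      conv_lhs => rw [← hv]
      rw [mul_assoc, conj_mul_conj_inv, mul_one]
  let b := hu.basis.tensorProduct (hu.basis.map (opLinearEquiv k))
  let σ : Equiv.Perm (G × G) := (Equiv.mulRight x).prodCongr (Equiv.mulLeft x⁻¹)
  choose n hn using fun g => hu.exists_mul g x
  choose n' hn' using hu.exists_inv_mul x
  let χ : G × G → k := fun g => ((q ^ n g.1 : kˣ) : k) * ((q ^ n' g.2 : kˣ) : k)
  have hχ : ∀ g, LinearMap.mulRight k (conj k (u x)) (b g) = χ g • b (σ g) := by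
    rintro ⟨g, h⟩
    have e1 : (u g : A) * u x = ((q ^ n g : kˣ) : k) • (u (g * x) : A) := by
      rw [← scalarUnit_mul_eq_smul]
      exact congrArg Units.val (hn g)
    have e2 : ((u x)⁻¹ : Aˣ) * (u h : A) = ((q ^ n' h : kˣ) : k) • (u (x⁻¹ * h) : A) := by
      rw [← scalarUnit_mul_eq_smul]
      exact congrArg Units.val (hn' h)
    have hb : ∀ g h, b (g, h) = (u g : A) ⊗ₜ[k] op (u h : A) := fun g h => by
      rw [← hu.basis_apply, ← hu.basis_apply]
      exact Basis.tensorProduct_apply _ _ _ _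
    change b (g, h) * conj k (u x) = _ • b (g * x, x⁻¹ * h)
    rw [hb, hb, conj_apply, Algebra.TensorProduct.tmul_mul_tmul, ← op_mul, e1, e2, op_smul,
      TensorProduct.tmul_smul, ← TensorProduct.smul_tmul', smul_smul, mul_comm]
  refine b.ext_elem fun g => ?_
  rw [map_zero, Finsupp.zero_apply]
  refine MonomialOperator.repr_eq_zero_of_fixed b hχ
    (fun g => mul_ne_zero (Units.ne_zero _) (Units.ne_zero _)) hz' fun i j e => hx ?_
  have hfst : ∀ n : ℕ, ((σ ^ n) g).1 = g.1 * x ^ n := fun n => by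
    induction n with
    | zero => simp
    | succ n ih =>
      rw [pow_succ', Equiv.Perm.mul_apply, pow_succ, ← mul_assoc, ← ih]
      rfl
  have := congrArg Prod.fst e
  simp only [hfst] at this
  exact mul_left_cancel this

end TwistedBasis

section eigenunits

variable {k A : Type*} [Field k] [Ring A] [Algebra k A] (D : A →ₗ[k] A)
  (hD : ∀ a b, D (a * b) = a * D b + D a * b)
include hD

theorem derivation_one : D 1 = 0 := by
  have h := hD 1 1
  rw [one_mul, one_mul, mul_one] at h
  exact left_eq_add.1 h

/-- The units that are eigenvectors of a derivation. -/
def eigenunits : Subgroup Aˣ where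
  carrier := {v | ∃ c : k, D v = c • (v : A)}
  one_mem' := ⟨0, by rw [Units.val_one, derivation_one D hD, zero_smul]⟩
  mul_mem' := by
    rintro v w ⟨c, hc⟩ ⟨c', hc'⟩
    refine ⟨c + c', ?_⟩
    rw [Units.val_mul, hD, hc, hc', mul_smul_comm, smul_mul_assoc, add_smul, add_comm]
  inv_mem' := by
    rintro v ⟨c, hc⟩
    refine ⟨-c, ?_⟩
    have h := hD v (v⁻¹ : Aˣ)
    rw [Units.mul_inv, derivation_one D hD, hc, smul_mul_assoc, Units.mul_inv] at h
    rw [← v.inv_mul_cancel_left (D (v⁻¹ : Aˣ)), eq_neg_of_add_eq_zero_left h.symm, mul_neg,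
      mul_smul_comm, mul_one, neg_smul]

theorem scalarUnit_mem_eigenunits (c : kˣ) : scalarUnit k A c ∈ eigenunits D hD :=
  ⟨0, by
    rw [Units.coe_map, MonoidHom.coe_coe, Algebra.algebraMap_eq_smul_one, map_smul,
      derivation_one D hD, smul_zero, zero_smul]⟩

/-- A derivation kills the eigenvectors that are units of finite order. -/
theorem eq_zero_of_mem_eigenunits [CharZero k] {v : Aˣ} (hv : v ∈ eigenunits D hD) {n : ℕ}
    (hn : n ≠ 0) (h : v ^ n = 1) : D v = 0 := by
  obtain ⟨c, hc⟩ := hv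
  have hpow : ∀ n : ℕ, D ((v : A) ^ n) = (n * c : k) • (v : A) ^ n := fun n => by
    induction n with
    | zero => simp [derivation_one D hD]
    | succ n ih =>
      rw [pow_succ, hD, ih, hc, mul_smul_comm, smul_mul_assoc, ← add_smul]
      push_cast
      ring_nf
  have e := hpow n
  rw [← Units.val_pow_eq_pow_val, h, Units.val_one, derivation_one D hD] at e
  rw [hc]
  obtain h0 | h0 := smul_eq_zero.1 e.symm
  · rw [(mul_eq_zero.1 h0).resolve_left (Nat.cast_ne_zero.2 hn), zero_smul]
  · rw [← mul_one (v : A), h0, mul_zero, smul_zero]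

end eigenunits

namespace IsSeparatingPair

open Module

variable {k A G : Type*} [Field k] [Ring A] [Algebra k A] [Group G] {q : kˣ} {u : G → Aˣ}
  (hu : TwistedBasis q u) {x y : G} (hxy : IsSeparatingPair u x y) (D : A →ₗ[k] A)
  (hD : ∀ a b, D (a * b) = a * D b + D a * b)
include hu hxy

include hD in
/-- After subtracting an inner derivation, `u x` and `u y` become eigenvectors. -/
theorem exists_sub_commutator : ∃ m : A,
    (∃ c : k, D (u x) = u x * m - m * u x + c • (u x : A)) ∧
    ∃ c : k, D (u y) = u y * m - m * u y + c • (u y : A) := by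
  obtain ⟨χ, hχ0, hχ⟩ := hu.exists_conjugation_basis x
  obtain ⟨ψ, hψ0, hψ⟩ := hu.exists_conjugation_basis y
  -- The logarithmic derivative is a cocycle for the action by conjugation.
  let δ : Aˣ → A := fun v => D v * (v⁻¹ : Aˣ)
  have δ_mul : ∀ v w, δ (v * w) = conjugation k v (δ w) + δ v := fun v w => by
    simp only [δ, Units.val_mul, hD, mul_inv_rev, conjugation_apply, add_mul, mul_assoc,
      Units.mul_inv_cancel_left]
  have δ_scalar : ∀ (c : kˣ) v, δ (scalarUnit k A c * v) = δ v := fun c v => by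
    have h0 : δ (scalarUnit k A c) = 0 := by
      have : D (scalarUnit k A c : Aˣ) = 0 := by
        rw [Units.coe_map, MonoidHom.coe_coe, Algebra.algebraMap_eq_smul_one, map_smul,
          derivation_one D hD, smul_zero]
      simp only [δ, this, zero_mul]
    rw [δ_mul, h0, add_zero, conjugation_scalarUnit]
    rfl
  have hrel : conjugation k (u x) (δ (u y)) - δ (u y) = conjugation k (u y) (δ (u x)) - δ (u x) := by
    obtain ⟨n, hn⟩ := hu.exists_mul x y
    obtain ⟨n', hn'⟩ := hu.exists_mul y x
    have e : δ (u x * u y) = δ (u y * u x) := by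
      rw [hn, hn', δ_scalar, δ_scalar, hxy.commute.eq]
    rw [δ_mul, δ_mul] at e
    rw [sub_eq_sub_iff_add_eq_add, e]
  have hστ : Commute (MulAut.toPerm G (MulAut.conj x)) (MulAut.toPerm G (MulAut.conj y)) :=
    (hxy.commute.map MulAut.conj).map (MulAut.toPerm G)
  obtain ⟨m, hm⟩ := MonomialOperator.exists_repr_sub_eq hu.basis hχ hψ hχ0 hστ
    (hu.commute_conjugation hxy.commute) (free_or_fixed hu hxy hχ hψ) hrel
  obtain ⟨n, hn⟩ := hu.exists_one
  have key : ∀ z v, (∀ g, g ≠ 1 → hu.basis.repr (conjugation k (u z) m - m) g =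
      hu.basis.repr (δ v) g) → u z = v →
      ∃ c : k, D (u z) = u z * m - m * u z + c • (u z : A) := by
    rintro z _ h rfl
    let c := hu.basis.repr (δ (u z) - (conjugation k (u z) m - m)) 1
    have e : δ (u z) - (conjugation k (u z) m - m) = c • hu.basis 1 := by
      refine hu.basis.ext_elem fun g => ?_
      rw [map_smul, Basis.repr_self, Finsupp.smul_apply]
      by_cases hg : g = 1
      · rw [hg, Finsupp.single_eq_same, smul_eq_mul, mul_one]
      · rw [Finsupp.single_eq_of_ne hg, smul_zero, map_sub, Finsupp.sub_apply, h g hg, sub_self]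
    refine ⟨c * ((q ^ n : kˣ) : k), ?_⟩
    rw [sub_eq_iff_eq_add', hu.basis_apply, hn] at e
    have e2 : D (u z) = δ (u z) * u z := (Units.inv_mul_cancel_right _ _).symm
    rw [e2, e, add_mul, sub_mul, conjugation_apply, Units.inv_mul_cancel_right, smul_mul_assoc,
      scalarUnit_mul_eq_smul, smul_smul]
  exact ⟨m, key x _ (fun g hg => (hm g hg).1) rfl, key y _ (fun g hg => (hm g hg).2) rfl⟩

/-- If `u x` and `u y` are eigenvectors of a derivation, then so are all `u g`. -/
theorem mem_eigenunits (hx : u x ∈ eigenunits D hD) (hy : u y ∈ eigenunits D hD) (g : G) :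
    u g ∈ eigenunits D hD := by
  have hs := scalarUnit_mem_eigenunits D hD
  have hcl : ∀ w ∈ Subgroup.closure {x, y}, u w ∈ eigenunits D hD := fun w hw => by
    refine Subgroup.closure_induction (p := fun w _ => u w ∈ eigenunits D hD) ?_ ?_ ?_ ?_ hw
    · rintro w (rfl | rfl)
      exacts [hx, hy]
    · obtain ⟨n, hn⟩ := hu.exists_one
      rw [hn]
      exact hs _
    · intro v w _ _ hv hw
      obtain ⟨n, hn⟩ := hu.exists_mul v w
      rw [← Subgroup.mul_mem_cancel_left _ (hs (q ^ n)), ← hn]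
      exact mul_mem hv hw
    · intro v _ hv
      obtain ⟨n, hn⟩ := hu.exists_inv_mul v 1
      obtain ⟨n', hn'⟩ := hu.exists_one
      rw [mul_one] at hn
      rw [← Subgroup.mul_mem_cancel_left _ (hs (q ^ n)), ← hn, hn']
      exact mul_mem (inv_mem hv) (hs _)
  obtain ⟨a, ha⟩ : ∃ a, D (u g) = u g * a := ⟨_, (Units.mul_inv_cancel_left _ _).symm⟩
  have key : ∀ z ∈ Subgroup.closure {x, y}, ∃ c : k,
      conjugation k (u z) a - a = algebraMap k A c := fun z hz => by
    obtain ⟨n, hn⟩ := hu.exists_conj g z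
    obtain ⟨α, hα⟩ := hcl z hz
    have hv : u g * u z * (u g)⁻¹ ∈ eigenunits D hD := by
      rw [hn]
      exact mul_mem (hs _) (hcl _ (hxy.normal.conj_mem z hz g))
    obtain ⟨α', hα'⟩ := hv
    refine ⟨α - α', ?_⟩
    have e1 := hD (u g) (u z)
    have e2 := hD (u g * u z * (u g)⁻¹ : Aˣ) (u g)
    rw [← Units.val_mul, inv_mul_cancel_right, Units.val_mul, e1, hα', ha, hα, mul_smul_comm,
      smul_mul_assoc, ← Units.val_mul _ (u g), inv_mul_cancel_right, ← mul_assoc,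
      ← Units.val_mul _ (u g), inv_mul_cancel_right] at e2
    have e3 : (u z : A) * a - a * u z = (α - α') • (u z : A) := by
      refine (u g).isUnit.mul_left_cancel ?_
      rw [mul_sub, mul_smul_comm, sub_smul, ← mul_assoc, ← mul_assoc, ← Units.val_mul]
      rw [← Units.val_mul] at e2
      rw [sub_eq_sub_iff_add_eq_add, ← e2, add_comm]
    have e4 := congrArg (· * ((u z)⁻¹ : Aˣ).val) e3
    simp only [sub_mul, smul_mul_assoc, Units.mul_inv, Units.mul_inv_cancel_right] at e4
    rw [conjugation_apply, e4, Algebra.algebraMap_eq_smul_one]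
  obtain ⟨α, hα⟩ := key x (Subgroup.subset_closure (Set.mem_insert _ _))
  obtain ⟨β, hβ⟩ := key y (Subgroup.subset_closure (Set.mem_insert_of_mem _ rfl))
  obtain ⟨c, hc⟩ := exists_eq_algebraMap hu hxy hα hβ
  refine ⟨c, ?_⟩
  rw [ha, hc, Algebra.algebraMap_eq_smul_one, mul_smul_comm,
    mul_one]

include hD in
/-- All derivations are inner when the algebra is generated by units `T i` of finite order that are
multiples of basis elements. -/
theorem exists_eq_commutator [CharZero k] {ι : Type*} {T : ι → Aˣ} {d : ι → ℕ}
    (hd : ∀ i, d i ≠ 0) (hTd : ∀ i, T i ^ d i = 1)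
    (hTu : ∀ i, ∃ (n : ℤ) (g : G), T i = scalarUnit k A (q ^ n) * u g)
    (hT : Algebra.adjoin k (Set.range fun i => (T i : A)) = ⊤) :
    ∃ m, ∀ a, D a = a * m - m * a := by
  obtain ⟨m, ⟨α, hα⟩, ⟨β, hβ⟩⟩ := exists_sub_commutator hu hxy D hD
  let D' : A →ₗ[k] A := D - (LinearMap.mulRight k m - LinearMap.mulLeft k m)
  have hD'a : ∀ a, D' a = D a - (a * m - m * a) := fun _ => rfl
  have hD' : ∀ a b, D' (a * b) = a * D' b + D' a * b := fun a b => by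
    simp only [hD'a, hD]
    noncomm_ring
  have hg := mem_eigenunits hu hxy D' hD' ⟨α, by rw [hD'a, hα, add_sub_cancel_left]⟩
    ⟨β, by rw [hD'a, hβ, add_sub_cancel_left]⟩
  have h0 : ∀ i, D' (T i) = 0 := fun i => by
    obtain ⟨n, g, hn⟩ := hTu i
    refine eq_zero_of_mem_eigenunits D' hD' ?_ (hd i) (hTd i)
    rw [hn]
    exact mul_mem (scalarUnit_mem_eigenunits D' hD' _) (hg g)
  refine ⟨m, fun a => sub_eq_zero.1 ((hD'a a).symm.trans ?_)⟩
  have ha : a ∈ Algebra.adjoin k (Set.range fun i => (T i : A)) := hT ▸ Algebra.mem_top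
  induction ha using Algebra.adjoin_induction with
  | mem x hx =>
    obtain ⟨i, rfl⟩ := hx
    exact h0 i
  | algebraMap r =>
    rw [Algebra.algebraMap_eq_smul_one, map_smul, derivation_one D' hD', smul_zero]
  | add a b _ _ ha hb => rw [map_add, ha, hb, add_zero]
  | mul a b _ _ ha hb => rw [hD', ha, hb, mul_zero, zero_mul, add_zero]

end IsSeparatingPair

end

noncomputable section

/-! ### Twisted group algebras: traces and the quotient by commutators -/

theorem TwistedBasis.conj_conj {k A G : Type*} [Field k] [Ring A] [Algebra k A] [Group G] {q : kˣ}
    {u : G → Aˣ} (hu : TwistedBasis q u) (g w : G) (v : Aˣ) :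
    u g * (u w * v * (u w)⁻¹) * (u g)⁻¹ = u (g * w) * v * (u (g * w))⁻¹ := by
  obtain ⟨m, hm⟩ := hu.exists_mul g w
  calc u g * (u w * v * (u w)⁻¹) * (u g)⁻¹ = (u g * u w) * v * (u g * u w)⁻¹ := by group
    _ = scalarUnit k A (q ^ m) * ((u (g * w) * v * (u (g * w))⁻¹) *
          (scalarUnit k A (q ^ m))⁻¹) := by rw [hm]; group
    _ = _ := by rw [← map_inv, mul_scalarUnit, map_inv, mul_inv_cancel_left]

section conjCoeff

variable {k A G : Type*} [Field k] [Ring A] [Algebra k A] [Group G] {q : kˣ} {u : G → Aˣ}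

open Classical in
/-- The power of `q` by which a unit differs from a conjugate of `t`; zero if there is none. -/
def conjCoeff (q : kˣ) (u : G → Aˣ) (t v : Aˣ) : k :=
  if h : ∃ n : ℤ, ∃ w, v = scalarUnit k A (q ^ n) * (u w * t * (u w)⁻¹) then
    ((q ^ h.choose : kˣ) : k) else 0

variable (hq : ∀ n : ℕ, 0 < n → q ^ n ≠ 1) {t : Aˣ} (ht : IsOfFinOrder t)
include hq ht

omit [Group G] in
/-- Since `t` has finite order and `q` is not a root of unity, the power of `q` is unique. -/
theorem conjCoeff_scalarUnit_mul_conj [Nontrivial A] (n : ℤ) (w : G) :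
    conjCoeff q u t (scalarUnit k A (q ^ n) * (u w * t * (u w)⁻¹)) = (q ^ n : kˣ) := by
  have h : ∃ n' : ℤ, ∃ w', scalarUnit k A (q ^ n) * (u w * t * (u w)⁻¹) =
      scalarUnit k A (q ^ n') * (u w' * t * (u w')⁻¹) := ⟨n, w, rfl⟩
  rw [conjCoeff, dif_pos h]
  congr 2
  obtain ⟨w', hw'⟩ := h.choose_spec
  obtain ⟨d, hd, htd⟩ := ht.exists_pow_eq_one
  generalize h.choose = n' at hw' ⊢
  have hpow : ∀ (n : ℤ) w, (scalarUnit k A (q ^ n) * (u w * t * (u w)⁻¹)) ^ d =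
      scalarUnit k A (q ^ (n * d)) := fun n w => by
    rw [Commute.mul_pow (mul_scalarUnit _ _).symm, conj_pow, htd, mul_one, mul_inv_cancel, mul_one,
      ← map_pow, zpow_mul, zpow_natCast]
  have e := congrArg (· ^ d) hw'
  simp only [hpow] at e
  have e2 : q ^ (n * d) = q ^ (n' * d) :=
    Units.map_injective (f := (algebraMap k A : k →* A)) (algebraMap k A).injective e
  have hinj : Function.Injective fun n : ℤ => q ^ n := by
    refine injective_zpow_iff_not_isOfFinOrder.2 fun h => ?_
    obtain ⟨n, hn, h⟩ := h.exists_pow_eq_one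
    exact hq n hn h
  have e3 := hinj e2
  exact (mul_right_cancel₀ (by omega) e3).symm

theorem conjCoeff_self [Nontrivial A] (hu : TwistedBasis q u) : conjCoeff q u t t = 1 := by
  obtain ⟨n, hn⟩ := hu.exists_one
  have h := conjCoeff_scalarUnit_mul_conj (u := u) hq ht 0 1
  rwa [hn, zpow_zero, map_one, one_mul, ← mul_scalarUnit, mul_inv_cancel_right, Units.val_one] at h

omit [Group G] in
theorem conjCoeff_scalarUnit_mul [Nontrivial A] (n : ℤ) (v : Aˣ) :
    conjCoeff q u t (scalarUnit k A (q ^ n) * v) = (q ^ n : kˣ) * conjCoeff q u t v := by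
  by_cases h : ∃ n' : ℤ, ∃ w, v = scalarUnit k A (q ^ n') * (u w * t * (u w)⁻¹)
  · obtain ⟨n', w, rfl⟩ := h
    rw [← mul_assoc, ← map_mul, ← zpow_add, conjCoeff_scalarUnit_mul_conj hq ht,
      conjCoeff_scalarUnit_mul_conj hq ht, zpow_add, Units.val_mul]
  · have h' : ¬∃ n' : ℤ, ∃ w, scalarUnit k A (q ^ n) * v =
        scalarUnit k A (q ^ n') * (u w * t * (u w)⁻¹) := by
      rintro ⟨n', w, e⟩
      refine h ⟨-n + n', w, ?_⟩
      rw [zpow_add, map_mul, mul_assoc, ← e, ← mul_assoc, ← map_mul, ← zpow_add, neg_add_cancel,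
        zpow_zero, map_one, one_mul]
    rw [conjCoeff, dif_neg h', conjCoeff, dif_neg h, mul_zero]

theorem conjCoeff_conj [Nontrivial A] (hu : TwistedBasis q u) (g : G) (v : Aˣ) :
    conjCoeff q u t (u g * v * (u g)⁻¹) = conjCoeff q u t v := by
  have key : ∀ (n : ℤ) (g w : G), conjCoeff q u t (u g *
      (scalarUnit k A (q ^ n) * (u w * t * (u w)⁻¹)) * (u g)⁻¹) = (q ^ n : kˣ) := by
    intro n g w
    rw [← mul_assoc, mul_scalarUnit, mul_assoc (scalarUnit k A (q ^ n)),
      mul_assoc (scalarUnit k A (q ^ n)), hu.conj_conj, conjCoeff_scalarUnit_mul_conj hq ht]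
  by_cases h : ∃ n' : ℤ, ∃ w, v = scalarUnit k A (q ^ n') * (u w * t * (u w)⁻¹)
  · obtain ⟨n', w, rfl⟩ := h
    rw [key, conjCoeff_scalarUnit_mul_conj hq ht]
  · have h' : ¬∃ n' : ℤ, ∃ w, u g * v * (u g)⁻¹ =
        scalarUnit k A (q ^ n') * (u w * t * (u w)⁻¹) := by
      rintro ⟨n', w, e⟩
      refine h ⟨n', g⁻¹ * w, ?_⟩
      have e2 := hu.conj_conj g (g⁻¹ * w) t
      rw [mul_inv_cancel_left] at e2
      rw [← e2, ← mul_assoc, ← mul_assoc, ← mul_scalarUnit] at e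
      have e3 := mul_left_cancel ((mul_right_cancel e).trans (mul_assoc _ _ _))
      rw [e3]
    rw [conjCoeff, dif_neg h', conjCoeff, dif_neg h]

end conjCoeff

namespace TwistedBasis

open Module Hochschild

universe w

variable {k A : Type w} {G : Type*} [Field k] [Ring A] [Algebra k A] [Group G] {q : kˣ}
  {u : G → Aˣ} (hu : TwistedBasis q u)
include hu

/-- The trace that counts conjugates of `t`. -/
theorem exists_trace (hq : ∀ n : ℕ, 0 < n → q ^ n ≠ 1) {t : Aˣ} (ht : IsOfFinOrder t) :
    ∃ f : A →ₗ[k] k, (∀ a ∈ commutatorSpace k A, f a = 0) ∧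
      ∀ (n : ℤ) g, f (scalarUnit k A (q ^ n) * u g : Aˣ) =
        conjCoeff q u t (scalarUnit k A (q ^ n) * u g) := by
  have : Nontrivial A := ⟨(u 1 : A), 0, fun h => hu.basis.ne_zero 1 (by rw [hu.basis_apply, h])⟩
  let f : A →ₗ[k] k := hu.basis.constr k fun g => conjCoeff q u t (u g)
  have hf : ∀ (n : ℤ) g, f (scalarUnit k A (q ^ n) * u g : Aˣ) =
      conjCoeff q u t (scalarUnit k A (q ^ n) * u g) := fun n g => by
    rw [conjCoeff_scalarUnit_mul hq ht, Units.val_mul, scalarUnit_mul_eq_smul, map_smul,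
      ← hu.basis_apply, Basis.constr_basis, smul_eq_mul]
  have hmul : ∀ g h, f (u g * u h) = conjCoeff q u t (u g * u h) := fun g h => by
    obtain ⟨n, hn⟩ := hu.exists_mul g h
    rw [← Units.val_mul, hn, hf]
  have hcomm : f ∘ₗ LinearMap.mul' k A = f ∘ₗ LinearMap.mul' k A ∘ₗ (TensorProduct.comm k A A) := by
    refine (hu.basis.tensorProduct hu.basis).ext fun ⟨g, h⟩ => ?_
    simp only [Basis.tensorProduct_apply, LinearMap.comp_apply, LinearEquiv.coe_coe,
      TensorProduct.comm_tmul, LinearMap.mul'_apply, hu.basis_apply, hmul]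
    rw [← conjCoeff_conj hq ht hu h (u g * u h)]
    congr 1
    group
  refine ⟨f, fun a ha => ?_, hf⟩
  have hle : commutatorSpace k A ≤ LinearMap.ker f := Submodule.span_le.2 <| by
    rintro _ ⟨a, b, rfl⟩
    rw [SetLike.mem_coe, LinearMap.mem_ker, map_sub, sub_eq_zero]
    exact LinearMap.congr_fun hcomm (a ⊗ₜ[k] b)
  exact hle ha

/-- If every `g` is either conjugate to one of the pairwise non-conjugate elements `ν i`, which
underlie units `t i` of finite order, or commutes with some `h` for which `u g` and `u h` do not
commute, then the `t i` form a basis modulo commutators. -/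
theorem nonempty_quotient_commutatorSpace_equiv (hq : ∀ n : ℕ, 0 < n → q ^ n ≠ 1)
    {ι : Type*} [Finite ι] {ν : ι → G} {t : ι → Aˣ}
    (htν : ∀ i, ∃ n : ℤ, t i = scalarUnit k A (q ^ n) * u (ν i)) (ht : ∀ i, IsOfFinOrder (t i))
    (hν : ∀ i j, IsConj (ν i) (ν j) → i = j)
    (hcover : ∀ g, (∃ i, IsConj (ν i) g) ∨ ∃ h, h * g * h⁻¹ = g ∧ u h * u g * (u h)⁻¹ ≠ u g) :
    Nonempty ((A ⧸ commutatorSpace k A) ≃ₗ[k] (ι → k)) := by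
  classical
  have : Fintype ι := Fintype.ofFinite ι
  have : Nontrivial A := ⟨(u 1 : A), 0, fun h => hu.basis.ne_zero 1 (by rw [hu.basis_apply, h])⟩
  choose f hf0 hf using fun i => hu.exists_trace hq (ht i)
  have hft : ∀ i j, f i (t j) = if i = j then 1 else 0 := fun i j => by
    obtain ⟨n, hn⟩ := htν j
    have e := hf i n (ν j)
    rw [← hn] at e
    rw [e]
    split_ifs with hij
    · rw [hij, conjCoeff_self hq (ht j) hu]
    · rw [conjCoeff, dif_neg]
      rintro ⟨n', w, h⟩
      obtain ⟨n₁, h₁⟩ := htν i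
      obtain ⟨n₂, h₂⟩ := hu.exists_conj w (ν i)
      rw [hn, h₁, ← mul_assoc (u w), mul_scalarUnit, mul_assoc (scalarUnit k A _) (u w),
        mul_assoc (scalarUnit k A _) (u w * _), h₂, ← mul_assoc, ← map_mul, ← mul_assoc,
        ← map_mul] at h
      exact hij (hν i j (isConj_iff.2 ⟨w, (hu.eq_of_scalarUnit_mul_eq h).symm⟩))
  let Φ : A →ₗ[k] (ι → k) := LinearMap.pi f
  have hΦt : ∀ c : ι → k, Φ (∑ j, c j • (t j : A)) = c := fun c => funext fun i => by
    simp [Φ, hft]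
  have hΦ : Function.Surjective Φ := fun c => ⟨_, hΦt c⟩
  have hspan : ∀ a, a ∈ commutatorSpace k A ⊔ Submodule.span k (Set.range fun i => (t i : A)) := by
    intro a
    rw [← hu.basis.linearCombination_repr a, Finsupp.linearCombination_apply]
    refine Submodule.sum_mem _ fun g _ => Submodule.smul_mem _ _ ?_
    rw [hu.basis_apply]
    obtain ⟨i, hi⟩ | ⟨h, hh, hne⟩ := hcover g
    · obtain ⟨w, hw⟩ := isConj_iff.1 hi
      obtain ⟨n₁, h₁⟩ := htν i
      obtain ⟨n₂, h₂⟩ := hu.exists_conj w (ν i)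
      rw [hw] at h₂
      have e1 : ((q ^ n₂ : kˣ) : k) • (u g : A) - u (ν i) ∈ commutatorSpace k A := by
        rw [← scalarUnit_mul_eq_smul, ← Units.val_mul, ← h₂, Units.val_mul, Units.val_mul]
        exact conj_sub_mem_commutatorSpace _ _
      have e2 : (u (ν i) : A) ∈ Submodule.span k (Set.range fun i => (t i : A)) := by
        have e3 : (t i : A) = ((q ^ n₁ : kˣ) : k) • (u (ν i) : A) := by
          rw [← scalarUnit_mul_eq_smul]
          exact congrArg Units.val h₁
        rw [← Submodule.smul_mem_iff _ (Units.ne_zero (q ^ n₁)), ← e3]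
        exact Submodule.subset_span ⟨i, rfl⟩
      rw [← Submodule.smul_mem_iff _ (Units.ne_zero (q ^ n₂))]
      have := add_mem (Submodule.mem_sup_left (T := Submodule.span k (Set.range fun i => (t i : A)))
        e1) (Submodule.mem_sup_right e2)
      rwa [sub_add_cancel] at this
    · refine Submodule.mem_sup_left ?_
      obtain ⟨n, hn⟩ := hu.exists_conj h g
      rw [hh] at hn
      have e1 : (((q ^ n : kˣ) : k) - 1) • (u g : A) ∈ commutatorSpace k A := by
        rw [sub_smul, one_smul, ← scalarUnit_mul_eq_smul, ← Units.val_mul, ← hn, Units.val_mul,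
          Units.val_mul]
        exact conj_sub_mem_commutatorSpace _ _
      refine (Submodule.smul_mem_iff _ (sub_ne_zero.2 fun e => hne ?_)).1 e1
      rw [hn, Units.val_eq_one.1 e, map_one, one_mul]
  have hker : LinearMap.ker Φ = commutatorSpace k A := by
    refine le_antisymm (fun a ha => ?_) fun a ha => ?_
    · obtain ⟨c, hc, s, hs, rfl⟩ := Submodule.mem_sup.1 (hspan a)
      obtain ⟨r, rfl⟩ := (Submodule.mem_span_range_iff_exists_fun k).1 hs
      have h0 : Φ c = 0 := funext fun i => hf0 i c hc
      rw [LinearMap.mem_ker, map_add, h0, zero_add, hΦt] at ha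
      rw [ha]
      simpa using hc
    · exact funext fun i => hf0 i a ha
  exact ⟨(Submodule.quotEquivOfEq _ _ hker.symm).trans (Φ.quotKerEquivOfSurjective hΦ)⟩

end TwistedBasis

end

noncomputable section

/-! ### The group of monomials -/

section zmodHom

variable {n : ℕ} {G : Type*} [Group G]

/-- The homomorphism from `ℤ/n` that sends the generator to an element with trivial `n`-th power. -/
def zmodHom (g : G) (hg : g ^ n = 1) : Multiplicative (ZMod n) →* G :=
  AddMonoidHom.toMultiplicativeLeft (ZMod.lift n ⟨zmultiplesHom _ (Additive.ofMul g), by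
    rw [zmultiplesHom_apply, natCast_zsmul, ← ofMul_pow, hg, ofMul_one]⟩)

theorem ofAdd_eq_generator_pow [NeZero n] (a : Multiplicative (ZMod n)) :
    a = Multiplicative.ofAdd (1 : ZMod n) ^ (Multiplicative.toAdd a).val := by
  rw [← ofAdd_nsmul, nsmul_one, ZMod.natCast_zmod_val, ofAdd_toAdd]

theorem zmodHom_generator (g : G) (hg : g ^ n = 1) :
    zmodHom g hg (Multiplicative.ofAdd 1) = g := by
  have h := ZMod.lift_coe n (A := Additive G) ⟨zmultiplesHom _ (Additive.ofMul g), by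
    rw [zmultiplesHom_apply, natCast_zsmul, ← ofMul_pow, hg, ofMul_one]⟩ 1
  rw [Int.cast_one] at h
  refine Eq.trans (congrArg Additive.toMul h) ?_
  simp

end zmodHom

instance (D : StarDiagram) : NeZero D.ell := ⟨QWeyl.ell_ne_zero D⟩

/-- The exponents of `x ^ i p ^ j` up to scalars, under conjugation by `s`. -/
def latticeTurn : StarDiagram → ℤ × ℤ → ℤ × ℤ
  | .D4, v => (-v.1, -v.2)
  | .E6, v => (-v.2, v.1 - v.2)
  | .E7, v => (-v.2, v.1)
  | .E8, v => (-v.2, v.1 + v.2)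

theorem latticeTurn_add (D : StarDiagram) (v w : ℤ × ℤ) :
    latticeTurn D (v + w) = latticeTurn D v + latticeTurn D w := by
  cases D <;> ext <;> simp [latticeTurn] <;> lia

theorem latticeTurn_iterate_ell (D : StarDiagram) (v : ℤ × ℤ) :
    (latticeTurn D)^[D.ell] v = v := by
  cases D <;> ext <;> (simp [latticeTurn, StarDiagram.ell]; try lia)

/-- The action of `s` on the group of monomials `x ^ i p ^ j` up to scalars. -/
def latticeRot (D : StarDiagram) : MulAut (Multiplicative (ℤ × ℤ)) :=
  AddEquiv.toMultiplicative
    { toFun := latticeTurn D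
      invFun := (latticeTurn D)^[D.ell - 1]
      left_inv := fun v => by
        rw [← Function.iterate_succ_apply, Nat.succ_eq_add_one,
          Nat.sub_add_cancel (Nat.one_le_iff_ne_zero.2 (QWeyl.ell_ne_zero D)),
          latticeTurn_iterate_ell]
      right_inv := fun v => by
        rw [← Function.iterate_succ_apply' (latticeTurn D), Nat.succ_eq_add_one,
          Nat.sub_add_cancel (Nat.one_le_iff_ne_zero.2 (QWeyl.ell_ne_zero D)),
          latticeTurn_iterate_ell]
      map_add' := latticeTurn_add D }

theorem latticeRot_pow_apply (D : StarDiagram) (n : ℕ) (v : Multiplicative (ℤ × ℤ)) :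
    (latticeRot D ^ n) v = Multiplicative.ofAdd ((latticeTurn D)^[n] v.toAdd) := by
  induction n with
  | zero => rfl
  | succ n ih =>
    rw [pow_succ', MulAut.mul_apply, ih, Function.iterate_succ_apply']
    rfl

theorem latticeRot_pow_ell (D : StarDiagram) : latticeRot D ^ D.ell = 1 :=
  MulEquiv.ext fun v => by
    rw [latticeRot_pow_apply, latticeTurn_iterate_ell]
    rfl

/-- The action of `ℤ/ℓ` on the group of monomials `x ^ i p ^ j` up to scalars. -/
def latticeAction (D : StarDiagram) :
    Multiplicative (ZMod D.ell) →* MulAut (Multiplicative (ℤ × ℤ)) :=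
  zmodHom (latticeRot D) (latticeRot_pow_ell D)

theorem latticeAction_apply (D : StarDiagram) (a : Multiplicative (ZMod D.ell))
    (v : Multiplicative (ℤ × ℤ)) : latticeAction D a v =
      Multiplicative.ofAdd ((latticeTurn D)^[(Multiplicative.toAdd a).val] v.toAdd) := by
  conv_lhs => rw [ofAdd_eq_generator_pow a, map_pow, latticeAction, zmodHom_generator,
    latticeRot_pow_apply]

/-- The group of monomials `x ^ i p ^ j s ^ k` up to scalars: the group generated by a lattice in
the plane and by the rotations of the plane of order `ℓ` that preserve it. -/
abbrev MonomialGroup (D : StarDiagram) : Type :=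
  Multiplicative (ℤ × ℤ) ⋊[latticeAction D] Multiplicative (ZMod D.ell)

namespace MonomialGroup

open Multiplicative

variable {D : StarDiagram}

/-- The monomial `x ^ i p ^ j`. -/
def lattice (v : ℤ × ℤ) : MonomialGroup D := SemidirectProduct.inl (ofAdd v)

variable (D) in
/-- The monomial `s`. -/
def rotation : MonomialGroup D := SemidirectProduct.inr (ofAdd 1)

/-- The exponents of `x` and `p`. -/
def exponent (g : MonomialGroup D) : ℤ × ℤ := toAdd g.left

/-- The exponent of `s`, as a number smaller than `ℓ`. -/
def angle (g : MonomialGroup D) : ℕ := (toAdd g.right).val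

theorem angle_lt (g : MonomialGroup D) : angle g < D.ell := ZMod.val_lt _

@[ext]
theorem ext' {g h : MonomialGroup D} (h1 : exponent g = exponent h) (h2 : angle g = angle h) :
    g = h :=
  SemidirectProduct.ext h1 (ZMod.val_injective _ h2)

theorem exponent_mul (g h : MonomialGroup D) :
    exponent (g * h) = exponent g + (latticeTurn D)^[angle g] (exponent h) := by
  rw [exponent, SemidirectProduct.mul_left, latticeAction_apply]
  rfl

theorem angle_mul (g h : MonomialGroup D) : angle (g * h) = (angle g + angle h) % D.ell :=
  ZMod.val_add _ _

theorem exponent_lattice (v : ℤ × ℤ) : exponent (lattice v : MonomialGroup D) = v := rfl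

theorem angle_lattice (v : ℤ × ℤ) : angle (lattice v : MonomialGroup D) = 0 := ZMod.val_zero

theorem exponent_rotation : exponent (rotation D) = 0 := rfl

theorem angle_rotation : angle (rotation D) = 1 := by cases D <;> rfl

theorem exponent_one : exponent (1 : MonomialGroup D) = 0 := rfl

theorem angle_one : angle (1 : MonomialGroup D) = 0 := ZMod.val_zero

theorem lattice_add (v w : ℤ × ℤ) :
    (lattice (v + w) : MonomialGroup D) = lattice v * lattice w := by
  rw [lattice, ofAdd_add, map_mul]
  rfl

theorem lattice_zpow_mul_zpow (i j : ℤ) :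
    (lattice (1, 0) : MonomialGroup D) ^ i * lattice (0, 1) ^ j = lattice (i, j) := by
  rw [lattice, lattice, ← map_zpow SemidirectProduct.inl, ← map_zpow SemidirectProduct.inl,
    ← map_mul, ← ofAdd_zsmul, ← ofAdd_zsmul, ← ofAdd_add, lattice]
  simp

theorem exponent_lattice_mul (v : ℤ × ℤ) (g : MonomialGroup D) :
    exponent (lattice v * g) = v + exponent g := by
  rw [exponent_mul, angle_lattice]
  rfl

theorem angle_lattice_mul (v : ℤ × ℤ) (g : MonomialGroup D) :
    angle (lattice v * g) = angle g := by
  rw [angle_mul, angle_lattice, zero_add, Nat.mod_eq_of_lt (angle_lt g)]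

theorem exponent_mul_lattice (v : ℤ × ℤ) (g : MonomialGroup D) :
    exponent (g * lattice v) = exponent g + (latticeTurn D)^[angle g] v := exponent_mul _ _

theorem angle_mul_lattice (v : ℤ × ℤ) (g : MonomialGroup D) :
    angle (g * lattice v) = angle g := by
  rw [angle_mul, angle_lattice, add_zero, Nat.mod_eq_of_lt (angle_lt g)]

theorem eq_lattice_mul_rotation_pow (g : MonomialGroup D) :
    g = lattice (exponent g) * rotation D ^ angle g := by
  conv_lhs => rw [← SemidirectProduct.inl_left_mul_inr_right g]
  rw [ofAdd_eq_generator_pow g.right, map_pow]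
  rfl

theorem conj_lattice_eq_iff (v : ℤ × ℤ) (g h : MonomialGroup D) :
    lattice v * g * (lattice v)⁻¹ = h ↔
      angle g = angle h ∧ v + exponent g = exponent h + (latticeTurn D)^[angle h] v := by
  rw [mul_inv_eq_iff_eq_mul, MonomialGroup.ext'_iff, exponent_lattice_mul, exponent_mul_lattice,
    angle_lattice_mul, angle_mul_lattice, and_comm]

/-- Nontrivial rotations fix no nonzero lattice vector. -/
theorem eq_zero_of_iterate_latticeTurn_eq {n : ℕ} (h0 : n ≠ 0) (h1 : n < D.ell) {v : ℤ × ℤ}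
    (h : (latticeTurn D)^[n] v = v) : v = 0 := by
  obtain ⟨a, b⟩ := v
  cases D <;> simp only [StarDiagram.ell] at h1 <;> interval_cases n <;>
    simp only [ne_eq, not_true_eq_false, latticeTurn, Function.iterate_succ_apply,
      Function.iterate_zero_apply, Prod.mk.injEq, Prod.mk_eq_zero] at h h0 ⊢ <;> omega

theorem closure_normal :
    (Subgroup.closure {lattice (1, 0), (lattice (0, 1) : MonomialGroup D)}).Normal := by
  let K : Subgroup (MonomialGroup D) := Subgroup.closure {lattice (1, 0), lattice (0, 1)}
  have hK : ∀ i j, lattice (i, j) ∈ K := fun i j => by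
    rw [← lattice_zpow_mul_zpow]
    refine K.mul_mem (K.zpow_mem ?_ _) (K.zpow_mem ?_ _)
    · exact Subgroup.subset_closure (Set.mem_insert _ _)
    · exact Subgroup.subset_closure (Set.mem_insert_of_mem _ (Set.mem_singleton _))
  have h : K = (SemidirectProduct.inl : _ →* MonomialGroup D).range := by
    refine le_antisymm ((Subgroup.closure_le _).2 ?_) ?_
    · rintro _ (rfl | rfl)
      exacts [⟨ofAdd (1, 0), rfl⟩, ⟨ofAdd (0, 1), rfl⟩]
    · rintro _ ⟨v, rfl⟩
      exact hK (toAdd v).1 (toAdd v).2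
  change K.Normal
  rw [h, SemidirectProduct.range_inl_eq_ker_rightHom]
  infer_instance

/-- Complete invariants of conjugation for monomials with a given nonzero exponent of `s`. -/
def classInvariant : StarDiagram → ℕ → ℤ × ℤ → ℤ
  | .D4, _, v => 2 * (v.1 % 2) + v.2 % 2
  | .E6, _, v => (v.1 + v.2) % 3
  | .E7, 2, v => v.1 % 2 + v.2 % 2
  | .E7, _, v => (v.1 + v.2) % 2
  | .E8, 3, v => if v.1 % 2 = 0 ∧ v.2 % 2 = 0 then 0 else 1
  | .E8, 2, v => if (v.1 - v.2) % 3 = 0 then 0 else 1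
  | .E8, 4, v => if (v.1 - v.2) % 3 = 0 then 0 else 1
  | .E8, _, _ => 0

theorem classInvariant_latticeTurn (n : ℕ) (v : ℤ × ℤ) :
    classInvariant D n (latticeTurn D v) = classInvariant D n v := by
  obtain ⟨a, b⟩ := v
  unfold classInvariant
  split <;> simp only [latticeTurn] <;> (try split_ifs) <;> lia

theorem classInvariant_iterate_latticeTurn (n m : ℕ) (v : ℤ × ℤ) :
    classInvariant D n ((latticeTurn D)^[m] v) = classInvariant D n v := by
  induction m with
  | zero => rfl
  | succ m ih => rw [Function.iterate_succ_apply', classInvariant_latticeTurn, ih]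

theorem classInvariant_eq {n : ℕ} (h0 : n ≠ 0) (h1 : n < D.ell) {v v' w : ℤ × ℤ}
    (h : w + v = v' + (latticeTurn D)^[n] w) : classInvariant D n v = classInvariant D n v' := by
  obtain ⟨a, b⟩ := v
  obtain ⟨a', b'⟩ := v'
  obtain ⟨c, d⟩ := w
  cases D <;> simp only [StarDiagram.ell] at h1 <;> interval_cases n <;>
    simp only [ne_eq, not_true_eq_false, latticeTurn, Function.iterate_succ_apply,
      Function.iterate_zero_apply, Prod.mk_add_mk, Prod.mk.injEq] at h h0 <;>
    simp only [classInvariant] <;> (try split_ifs) <;> lia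

theorem exists_of_classInvariant_eq {n : ℕ} (h0 : n ≠ 0) (h1 : n < D.ell) {v v' : ℤ × ℤ}
    (h : classInvariant D n v = classInvariant D n v') :
    ∃ m w, w + (latticeTurn D)^[m] v = v' + (latticeTurn D)^[n] w := by
  obtain ⟨a, b⟩ := v
  obtain ⟨a', b'⟩ := v'
  -- In each case `w` solves a linear system whose determinant is `4 sin² (π n / ℓ)`.
  suffices hs : ∃ m c d, c + ((latticeTurn D)^[m] (a, b)).1 = a' + ((latticeTurn D)^[n] (c, d)).1 ∧
      d + ((latticeTurn D)^[m] (a, b)).2 = b' + ((latticeTurn D)^[n] (c, d)).2 by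
    obtain ⟨m, c, d, e1, e2⟩ := hs
    exact ⟨m, (c, d), Prod.ext e1 e2⟩
  cases D <;> simp only [StarDiagram.ell] at h1 <;> interval_cases n <;>
    simp only [ne_eq, not_true_eq_false, classInvariant] at h h0
  · refine ⟨0, (a' - a) / 2, (b' - b) / 2, ?_⟩
    simp only [latticeTurn, Function.iterate_succ_apply, Function.iterate_zero_apply]
    lia
  · refine ⟨0, a' - a - (a' - a + (b' - b)) / 3, (a' - a + (b' - b)) / 3, ?_⟩
    simp only [latticeTurn, Function.iterate_succ_apply, Function.iterate_zero_apply]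
    lia
  · refine ⟨0, (a' - a + (b' - b)) / 3, b' - b - (a' - a + (b' - b)) / 3, ?_⟩
    simp only [latticeTurn, Function.iterate_succ_apply, Function.iterate_zero_apply]
    lia
  · refine ⟨0, a' - a - (a' - a + (b' - b)) / 2, (a' - a + (b' - b)) / 2, ?_⟩
    simp only [latticeTurn, Function.iterate_succ_apply, Function.iterate_zero_apply]
    lia
  · by_cases e : a % 2 = a' % 2
    · refine ⟨0, (a' - a) / 2, (b' - b) / 2, ?_⟩
      simp only [latticeTurn, Function.iterate_succ_apply, Function.iterate_zero_apply]
      lia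
    · refine ⟨1, (a' + b) / 2, (b' - a) / 2, ?_⟩
      simp only [latticeTurn, Function.iterate_succ_apply, Function.iterate_zero_apply]
      lia
  · refine ⟨0, (a' - a + (b' - b)) / 2, b' - b - (a' - a + (b' - b)) / 2, ?_⟩
    simp only [latticeTurn, Function.iterate_succ_apply, Function.iterate_zero_apply]
    lia
  · refine ⟨0, b - b', a' - a + (b' - b), ?_⟩
    simp only [latticeTurn, Function.iterate_succ_apply, Function.iterate_zero_apply]
    lia
  · by_cases e : (a - b) % 3 = (a' - b') % 3
    · refine ⟨0, (a' - a - (b' - b)) / 3, b' - b + (a' - a - (b' - b)) / 3, ?_⟩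
      simp only [latticeTurn, Function.iterate_succ_apply, Function.iterate_zero_apply]
      lia
    · refine ⟨1, (a' + b - (b' - (a + b))) / 3, b' - (a + b) + (a' + b - (b' - (a + b))) / 3, ?_⟩
      simp only [latticeTurn, Function.iterate_succ_apply, Function.iterate_zero_apply]
      lia
  · by_cases e : a % 2 = a' % 2 ∧ b % 2 = b' % 2
    · refine ⟨0, (a' - a) / 2, (b' - b) / 2, ?_⟩
      simp only [latticeTurn, Function.iterate_succ_apply, Function.iterate_zero_apply]
      lia
    · by_cases e' : b % 2 = a' % 2 ∧ (a + b) % 2 = b' % 2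
      · refine ⟨1, (a' + b) / 2, (b' - (a + b)) / 2, ?_⟩
        simp only [latticeTurn, Function.iterate_succ_apply, Function.iterate_zero_apply]
        lia
      · refine ⟨2, (a' + a + b) / 2, (b' - a) / 2, ?_⟩
        simp only [latticeTurn, Function.iterate_succ_apply, Function.iterate_zero_apply]
        lia
  · by_cases e : (a - b) % 3 = (a' - b') % 3
    · refine ⟨0, a' - a + (b' - b - (a' - a)) / 3, (b' - b - (a' - a)) / 3, ?_⟩
      simp only [latticeTurn, Function.iterate_succ_apply, Function.iterate_zero_apply]
      lia
    · refine ⟨1, a' + b + (b' - (a + b) - (a' + b)) / 3, (b' - (a + b) - (a' + b)) / 3, ?_⟩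
      simp only [latticeTurn, Function.iterate_succ_apply, Function.iterate_zero_apply]
      lia
  · refine ⟨0, a' - a + (b' - b), a - a', ?_⟩
    simp only [latticeTurn, Function.iterate_succ_apply, Function.iterate_zero_apply]
    lia

theorem latticeTurn_iterate_zero (n : ℕ) : (latticeTurn D)^[n] 0 = 0 := by
  refine Function.iterate_fixed ?_ n
  cases D <;> rfl

theorem exponent_rotation_mul (g : MonomialGroup D) :
    exponent (rotation D * g) = latticeTurn D (exponent g) := by
  rw [exponent_mul, exponent_rotation, angle_rotation, zero_add, Function.iterate_one]

theorem exponent_mul_rotation (g : MonomialGroup D) :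
    exponent (g * rotation D) = exponent g := by
  rw [exponent_mul, exponent_rotation, latticeTurn_iterate_zero, add_zero]

theorem angle_mul_comm (g h : MonomialGroup D) : angle (g * h) = angle (h * g) := by
  rw [angle_mul, angle_mul, add_comm]

theorem angle_conj (c g : MonomialGroup D) : angle (c * g * c⁻¹) = angle g := by
  rw [angle_mul_comm, inv_mul_cancel_left]

theorem exponent_conj_rotation (g : MonomialGroup D) :
    exponent (rotation D * g * (rotation D)⁻¹) = latticeTurn D (exponent g) := by
  rw [← exponent_mul_rotation, inv_mul_cancel_right, exponent_rotation_mul]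

theorem exponent_conj_rotation_pow (g : MonomialGroup D) (n : ℕ) :
    exponent (rotation D ^ n * g * (rotation D ^ n)⁻¹) = (latticeTurn D)^[n] (exponent g) := by
  induction n with
  | zero => simp
  | succ n ih =>
    rw [Function.iterate_succ_apply', ← ih, ← exponent_conj_rotation, pow_succ', mul_inv_rev]
    congr 1
    group

theorem isConj_of_classInvariant_eq {g h : MonomialGroup D} (h0 : angle g ≠ 0)
    (h1 : angle g = angle h)
    (h2 : classInvariant D (angle g) (exponent g) = classInvariant D (angle g) (exponent h)) :
    IsConj g h := by
  obtain ⟨m, w, e⟩ := exists_of_classInvariant_eq h0 (angle_lt g) h2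
  refine isConj_iff.2 ⟨lattice w * rotation D ^ m, ?_⟩
  have e2 := (conj_lattice_eq_iff w (rotation D ^ m * g * (rotation D ^ m)⁻¹) h).2
    ⟨by rw [angle_conj, h1], by rw [exponent_conj_rotation_pow, e, h1]⟩
  rw [← e2]
  group

theorem classInvariant_eq_of_isConj {g h : MonomialGroup D} (hgh : IsConj g h) :
    angle g = angle h ∧ (angle g ≠ 0 →
      classInvariant D (angle g) (exponent g) = classInvariant D (angle g) (exponent h)) := by
  obtain ⟨c, rfl⟩ := isConj_iff.1 hgh
  refine ⟨(angle_conj c g).symm, fun h0 => ?_⟩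
  rw [eq_lattice_mul_rotation_pow c]
  generalize exponent c = w
  generalize angle c = m
  have e1 : lattice w * rotation D ^ m * g * (lattice w * rotation D ^ m)⁻¹ =
      lattice w * (rotation D ^ m * g * (rotation D ^ m)⁻¹) * (lattice w)⁻¹ := by group
  have e2 := ((conj_lattice_eq_iff w (rotation D ^ m * g * (rotation D ^ m)⁻¹) _).1 e1.symm).2
  rw [angle_conj] at e2
  rw [← classInvariant_eq h0 (angle_lt g) e2, exponent_conj_rotation_pow,
    classInvariant_iterate_latticeTurn]

/-- The exponents of `s` and of `x`, `p` in `T i`, which is `s ^ n x ^ i p ^ j` up to a scalar. -/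
def generatorData : (D : StarDiagram) → Fin D.legs → ℕ × (ℤ × ℤ)
  | .D4 => ![(1, (0, 0)), (1, (1, 0)), (1, (1, 1)), (1, (0, 1))]
  | .E6 => ![(1, (0, 0)), (1, (1, 0)), (1, (1, 1))]
  | .E7 => ![(2, (0, -1)), (1, (1, 0)), (1, (0, 0))]
  | .E8 => ![(3, (1, 0)), (2, (0, 1)), (1, (0, 0))]

/-- The class of `T i` modulo scalars. -/
def generator (D : StarDiagram) (i : Fin D.legs) : MonomialGroup D :=
  rotation D ^ (generatorData D i).1 * lattice (generatorData D i).2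

/-- The product of monomials, in terms of pairs of an exponent and an angle. -/
def pairMul (D : StarDiagram) (g h : (ℤ × ℤ) × ℕ) : (ℤ × ℤ) × ℕ :=
  (g.1 + (latticeTurn D)^[g.2] h.1, (g.2 + h.2) % D.ell)

/-- The pairs of an exponent and an angle that describe the generators. -/
def generatorPair (D : StarDiagram) (i : Fin D.legs) : (ℤ × ℤ) × ℕ :=
  ((latticeTurn D)^[(generatorData D i).1] (generatorData D i).2, (generatorData D i).1 % D.ell)

theorem pair_mul (g h : MonomialGroup D) : (exponent (g * h), angle (g * h)) =
    pairMul D (exponent g, angle g) (exponent h, angle h) := by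
  rw [exponent_mul, angle_mul]
  rfl

theorem pair_pow (g : MonomialGroup D) (n : ℕ) : (exponent (g ^ n), angle (g ^ n)) =
    (pairMul D (exponent g, angle g))^[n] (0, 0) := by
  induction n with
  | zero => rw [pow_zero, exponent_one, angle_one]; rfl
  | succ n ih => rw [pow_succ', pair_mul, ih, Function.iterate_succ_apply']

theorem exponent_rotation_pow (n : ℕ) : exponent (rotation D ^ n) = 0 := by
  induction n with
  | zero => rfl
  | succ n ih => rw [pow_succ, exponent_mul_rotation, ih]

theorem angle_rotation_pow (n : ℕ) : angle (rotation D ^ n) = n % D.ell := by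
  induction n with
  | zero => rw [pow_zero, angle_one, Nat.zero_mod]
  | succ n ih => rw [pow_succ, angle_mul, ih, angle_rotation, Nat.mod_add_mod]

theorem iterate_latticeTurn_mod (n : ℕ) (v : ℤ × ℤ) :
    (latticeTurn D)^[n % D.ell] v = (latticeTurn D)^[n] v :=
  Function.IsPeriodicPt.iterate_mod_apply (latticeTurn_iterate_ell D v) n

theorem pair_generator (D : StarDiagram) (i : Fin D.legs) :
    (exponent (generator D i), angle (generator D i)) = generatorPair D i := by
  rw [generator, angle_mul_lattice, exponent_mul_lattice, exponent_rotation_pow, zero_add,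
    angle_rotation_pow, iterate_latticeTurn_mod, generatorPair]

/-- The conjugacy classes of finite order: the trivial one and, for each `i`, those of the powers
`T i ^ (j + 1)` with `j + 1 < d_i`. -/
abbrev ClassIndex (D : StarDiagram) : Type :=
  Option (Σ i : Fin D.legs, Fin (D.legOrder i - 1))

/-- Representatives of the conjugacy classes of finite order. -/
def representative (D : StarDiagram) : ClassIndex D → MonomialGroup D
  | none => 1
  | some ⟨i, j⟩ => generator D i ^ ((j : ℕ) + 1)

/-- The angle and the invariant of a representative. -/
def indexInvariant (D : StarDiagram) : ClassIndex D → ℕ × ℤ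
  | none => (0, 0)
  | some ⟨i, j⟩ =>
    let g := (pairMul D (generatorPair D i))^[(j : ℕ) + 1] (0, 0)
    (g.2, classInvariant D g.2 g.1)

theorem indexInvariant_eq (a : ClassIndex D) : indexInvariant D a =
    (angle (representative D a), classInvariant D (angle (representative D a))
      (exponent (representative D a))) := by
  match a with
  | none =>
    rw [representative, angle_one, exponent_one, indexInvariant]
    cases D <;> rfl
  | some ⟨i, j⟩ =>
    rw [representative, indexInvariant, ← pair_generator, ← pair_pow]

theorem indexInvariant_injective : Function.Injective (indexInvariant D) := by
  cases D <;> decide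

theorem eq_none_of_indexInvariant : ∀ a : ClassIndex D, (indexInvariant D a).1 = 0 → a = none := by
  cases D <;> decide

/-- The number of values of the class invariant for a given angle. -/
def classCount : StarDiagram → ℕ → ℕ
  | .D4, _ => 4
  | .E6, _ => 3
  | .E7, 2 => 3
  | .E7, _ => 2
  | .E8, 1 => 1
  | .E8, 5 => 1
  | .E8, _ => 2

theorem exists_indexInvariant_eq : ∀ n < D.ell, n ≠ 0 → ∀ c < classCount D n,
    ∃ a, indexInvariant D a = (n, (c : ℤ)) := by
  cases D <;> decide

theorem classInvariant_mem {n : ℕ} (h0 : n ≠ 0) (h1 : n < D.ell) (v : ℤ × ℤ) :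
    0 ≤ classInvariant D n v ∧ classInvariant D n v < classCount D n := by
  cases D <;> simp only [StarDiagram.ell] at h1 <;> interval_cases n <;>
    simp only [classInvariant, classCount] <;> (try split_ifs) <;> lia

theorem card_classIndex : Fintype.card (ClassIndex D) = D.rank + 1 := by
  cases D <;> decide

theorem eq_of_isConj_representative {a b : ClassIndex D}
    (h : IsConj (representative D a) (representative D b)) : a = b := by
  obtain ⟨h1, h2⟩ := classInvariant_eq_of_isConj h
  by_cases h0 : angle (representative D a) = 0
  · rw [eq_none_of_indexInvariant a (by rw [indexInvariant_eq, h0]),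
      eq_none_of_indexInvariant b (by rw [indexInvariant_eq, ← h1, h0])]
  · refine indexInvariant_injective ?_
    rw [indexInvariant_eq, indexInvariant_eq, ← h1, h2 h0]

theorem exists_isConj_representative {g : MonomialGroup D} (h0 : angle g ≠ 0) :
    ∃ a, IsConj (representative D a) g := by
  obtain ⟨h1, h2⟩ := classInvariant_mem h0 (angle_lt g) (exponent g)
  obtain ⟨a, ha⟩ := exists_indexInvariant_eq (D := D) _ (angle_lt g) h0
    (classInvariant D (angle g) (exponent g)).toNat (by lia)
  rw [indexInvariant_eq, Int.toNat_of_nonneg h1, Prod.mk.injEq] at ha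
  refine ⟨a, isConj_of_classInvariant_eq (by rwa [ha.1]) ha.1 ?_⟩
  rw [ha.2, ha.1]

end MonomialGroup

end

noncomputable section

/-! ### Algebras with a basis of monomials -/

open QWeyl

theorem zpow_mul_zpow_of_rel {G : Type*} [Group G] {c : ℂˣ →* G} {x p : G} {Q : ℂˣ}
    (hc : ∀ u a, u * c a = c a * u) (h : p * x = c Q * (x * p)) (i j : ℤ) :
    p ^ j * x ^ i = c (Q ^ (j * i)) * (x ^ i * p ^ j) := by
  have hcomm : ∀ a u, Commute (c a) u := fun a u => (hc u a).symm
  have e : ∀ j : ℤ, p * x ^ j = c (Q ^ j) * (x ^ j * p) := fun j => by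
    have e1 : p * x * p⁻¹ = c Q * x := by rw [h, ← mul_assoc, mul_inv_cancel_right]
    rw [← mul_assoc, ← mul_inv_eq_iff_eq_mul, ← conj_zpow, e1, (hcomm _ _).mul_zpow, map_zpow]
  have e2 : x ^ (-i) * p * (x ^ (-i))⁻¹ = c (Q ^ i) * p := by
    rw [zpow_neg, inv_inv, mul_assoc, e, inv_mul_eq_iff_eq_mul, ← mul_assoc, ← mul_assoc, hc]
  have e3 := conj_zpow (a := x ^ (-i)) (b := p) (i := j)
  rw [e2, (hcomm _ _).mul_zpow, ← map_zpow, ← zpow_mul, mul_comm i j, zpow_neg, inv_inv, mul_assoc,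
    eq_inv_mul_iff_mul_eq, ← mul_assoc, hc, mul_assoc] at e3
  exact e3.symm

/-- The right-hand sides of the relations for `s⁻¹ x s` and `s⁻¹ p s`, for any elements `x` and `p`
of a group and any homomorphism `c` from the nonzero scalars. -/
def rotWord {G : Type*} [Group G] (D : StarDiagram) (c : ℂˣ →* G) (q : ℂˣ) (x p : G) : G × G :=
  match D with
  | .D4 => (x⁻¹, p⁻¹)
  | .E6 => (c q⁻¹ * (p⁻¹ * x⁻¹), c (q ^ 2) * x)
  | .E7 => (c (q ^ 2)⁻¹ * p⁻¹, c (q ^ 2) * x)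
  | .E8 => (c (q ^ 2)⁻¹ * (x * p⁻¹), c q * x)

theorem map_rotWord {G H : Type*} [Group G] [Group H] (D : StarDiagram) (c : ℂˣ →* G) (q : ℂˣ)
    (x p : G) (f : G →* H) : Prod.map f f (rotWord D c q x p) =
      rotWord D (f.comp c) q (f x) (f p) := by
  cases D <;> simp [rotWord]

theorem rotWord_eq (D : StarDiagram) (q : ℂˣ) :
    rotWord D (scalar (QWeyl (q ^ D.ell))) q (X _) (P _) = (rotX D q, rotP D q) := by
  cases D <;> rfl

/-- The elements `x`, `p`, `s` of a group satisfy the relations of the semidirect product. -/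
structure IsWeylTriple {G : Type*} [Group G] (D : StarDiagram) (c : ℂˣ →* G) (q : ℂˣ)
    (x p s : G) : Prop where
  p_mul_x : p * x = c (q ^ D.ell) * (x * p)
  pow_eq_one : s ^ D.ell = 1
  conj_eq : (s⁻¹ * x * s, s⁻¹ * p * s) = rotWord D c q x p

theorem IsWeylTriple.map {G H : Type*} [Group G] [Group H] {D : StarDiagram} {c : ℂˣ →* G}
    {q : ℂˣ} {x p s : G} (h : IsWeylTriple D c q x p s) (f : G →* H) :
    IsWeylTriple D (f.comp c) q (f x) (f p) (f s) where
  p_mul_x := by rw [← map_mul, h.p_mul_x, map_mul, map_mul]; rfl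
  pow_eq_one := by rw [← map_pow, h.pow_eq_one, map_one]
  conj_eq := by
    rw [← map_rotWord, ← h.conj_eq]
    simp

section monomial

open MonomialGroup Multiplicative

variable {G : Type*} [Group G] {D : StarDiagram} {q : ℂˣ} {x p s : G}

/-- The element `x ^ i p ^ j s ^ k`. -/
def monomial (x p s : G) (g : MonomialGroup D) : G :=
  x ^ (exponent g).1 * p ^ (exponent g).2 * s ^ angle g

theorem map_monomial {H : Type*} [Group H] (f : G →* H) (g : MonomialGroup D) :
    f (monomial x p s g) = monomial (f x) (f p) (f s) g := by
  simp [monomial]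

theorem monomial_lattice (v : ℤ × ℤ) :
    monomial x p s (lattice v : MonomialGroup D) = x ^ v.1 * p ^ v.2 := by
  rw [monomial, angle_lattice, exponent_lattice, pow_zero, mul_one]

/-- The homomorphism `(i, j) ↦ x ^ i p ^ j`. -/
def latticeHom (h : Commute x p) : Multiplicative (ℤ × ℤ) →* G :=
  MonoidHom.mk' (fun v => x ^ (toAdd v).1 * p ^ (toAdd v).2) fun v w => by
    simp only [toAdd_mul, Prod.fst_add, Prod.snd_add, zpow_add]
    rw [mul_assoc, mul_assoc, ← mul_assoc (x ^ (toAdd w).1), (h.zpow_zpow _ _).eq]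
    group

variable (h : IsWeylTriple D (1 : ℂˣ →* G) q x p s)
include h

theorem commute_of_isWeylTriple : Commute x p := by
  have := h.p_mul_x
  rw [MonoidHom.one_apply, one_mul] at this
  exact this.symm

theorem conj_latticeHom_eq (v : ℤ × ℤ) :
    s * latticeHom (commute_of_isWeylTriple h) (ofAdd v) * s⁻¹ =
      latticeHom (commute_of_isWeylTriple h) (ofAdd (latticeTurn D v)) := by
  have hxp := commute_of_isWeylTriple h
  have hv : ∀ v : ℤ × ℤ, latticeHom hxp (ofAdd v) = x ^ v.1 * p ^ v.2 := fun _ => rfl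
  have hconj : ∀ v : ℤ × ℤ, s * (x ^ v.1 * p ^ v.2) * s⁻¹ =
      (s * x * s⁻¹) ^ v.1 * (s * p * s⁻¹) ^ v.2 := fun v => by
    rw [conj_zpow, conj_zpow]
    group
  have e := h.conj_eq
  rw [Prod.ext_iff] at e
  obtain ⟨e1, e2⟩ := e
  have e1' : x = s * (rotWord D (1 : ℂˣ →* G) q x p).1 * s⁻¹ := by rw [← e1]; group
  have e2' : p = s * (rotWord D (1 : ℂˣ →* G) q x p).2 * s⁻¹ := by rw [← e2]; group
  have hinv : ∀ u, s * u⁻¹ * s⁻¹ = (s * u * s⁻¹)⁻¹ := fun _ => conj_inv.symm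
  rw [hv, hv, hconj]
  cases D <;> simp only [rotWord, MonoidHom.one_apply, one_mul] at e1' e2' <;>
    simp only [latticeTurn]
  · rw [hinv] at e1' e2'
    rw [← inv_inv (s * x * s⁻¹), ← inv_inv (s * p * s⁻¹), ← e1', ← e2', inv_zpow', inv_zpow']
  · have e3 : s * p * s⁻¹ = p⁻¹ * x⁻¹ := by
      have e4 : x = (s * p * s⁻¹)⁻¹ * (s * x * s⁻¹)⁻¹ := by
        conv_lhs => rw [e1']
        group
      rw [← e2'] at e4
      rw [← mul_inv_rev, ← mul_inv_eq_iff_eq_mul.1 e4.symm, inv_inv]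
    rw [← e2', e3, Commute.mul_zpow hxp.inv_inv.symm, ← mul_assoc, inv_zpow', inv_zpow',
      ← zpow_add, ← sub_eq_add_neg, (hxp.zpow_zpow _ _).eq]
  · have e3 : s * p * s⁻¹ = x⁻¹ := by rw [hinv] at e1'; rw [e1', inv_inv]
    rw [← e2', e3, inv_zpow', (hxp.zpow_zpow _ _).eq]
  · have e3 : s * p * s⁻¹ = x⁻¹ * p := by
      have e4 : x = s * x * s⁻¹ * (s * p * s⁻¹)⁻¹ := by
        conv_lhs => rw [e1']
        group
      rw [← e2'] at e4
      rw [eq_inv_mul_iff_mul_eq, ← mul_inv_eq_iff_eq_mul.1 e4.symm]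
    rw [← e2', e3, Commute.mul_zpow hxp.inv_left, ← mul_assoc, inv_zpow',
      ← (hxp.zpow_zpow _ _).eq, mul_assoc, ← zpow_add]

/-- When the scalars are trivial, the relations are those of the group of monomials. -/
def monomialHom : MonomialGroup D →* G :=
  SemidirectProduct.lift (latticeHom (commute_of_isWeylTriple h)) (zmodHom s h.pow_eq_one)
    fun a => by
      refine MonoidHom.ext fun v => ?_
      rw [ofAdd_eq_generator_pow a, map_pow, map_pow, map_pow, zmodHom_generator]
      change latticeHom (commute_of_isWeylTriple h) ((latticeAction D (ofAdd 1) ^ _) v) = (MulAut.conj s ^ _) _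
      rw [latticeAction, zmodHom_generator, latticeRot_pow_apply]
      induction (toAdd a).val with
      | zero => rfl
      | succ n ih =>
        rw [pow_succ', MulAut.mul_apply, ← ih, Function.iterate_succ_apply', MulAut.conj_apply,
          conj_latticeHom_eq h]

theorem monomialHom_apply (g : MonomialGroup D) : monomialHom h g = monomial x p s g := by
  conv_lhs => rw [← SemidirectProduct.inl_left_mul_inr_right g]
  rw [map_mul, monomialHom, SemidirectProduct.lift_inl, SemidirectProduct.lift_inr,
    ofAdd_eq_generator_pow g.right, map_pow, zmodHom_generator]
  rfl

end monomial

section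

open MonomialGroup

variable {B : Type*} [Ring B] [Algebra ℂ B] {D : StarDiagram} {q : ℂˣ} {x p s : Bˣ}
  (h : IsWeylTriple D (scalar B) q x p s)

omit h in
instance zpowers_scalar_normal (q : ℂˣ) : (Subgroup.zpowers (scalar B q)).Normal where
  conj_mem u hu v := by
    obtain ⟨n, rfl⟩ := hu
    refine ⟨n, ?_⟩
    simp only [← map_zpow]
    rw [mul_scalar, mul_inv_cancel_right]

include h

theorem isWeylTriple_mk : IsWeylTriple D (1 : ℂˣ →* Bˣ ⧸ Subgroup.zpowers (scalar B q)) q x p s := by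
  have h1 := h.map (QuotientGroup.mk' (Subgroup.zpowers (scalar B q)))
  have hq : ∀ n : ℤ, QuotientGroup.mk' (Subgroup.zpowers (scalar B q)) (scalar B (q ^ n)) = 1 :=
    fun n => (QuotientGroup.eq_one_iff _).2 ⟨n, (map_zpow _ _ _).symm⟩
  have hn : ∀ n : ℕ, QuotientGroup.mk' (Subgroup.zpowers (scalar B q)) (scalar B (q ^ n)) = 1 :=
    fun n => hq n
  refine ⟨?_, h1.pow_eq_one, ?_⟩
  · have := h1.p_mul_x
    rwa [MonoidHom.comp_apply, hn] at this
  · refine h1.conj_eq.trans ?_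
    have h0 : ((scalar B q : Bˣ) : Bˣ ⧸ Subgroup.zpowers (scalar B q)) = 1 :=
      (QuotientGroup.eq_one_iff _).2 (Subgroup.mem_zpowers _)
    cases D <;> simp [rotWord, h0]

theorem mk_monomial (g : MonomialGroup D) :
    ((monomial x p s g : Bˣ) : Bˣ ⧸ Subgroup.zpowers (scalar B q)) =
      monomialHom (isWeylTriple_mk h) g := by
  rw [monomialHom_apply]
  exact map_monomial (QuotientGroup.mk' _) g

theorem exists_eq_scalar_mul_monomial {u : Bˣ} {g : MonomialGroup D}
    (hu : (u : Bˣ ⧸ Subgroup.zpowers (scalar B q)) = monomialHom (isWeylTriple_mk h) g) :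
    ∃ n : ℤ, u = scalar B (q ^ n) * monomial x p s g := by
  rw [← mk_monomial h, eq_comm, QuotientGroup.eq] at hu
  obtain ⟨n, hn⟩ := hu
  refine ⟨n, ?_⟩
  rw [map_zpow, ← mul_inv_cancel_left (monomial x p s g) u, ← hn]
  simp only [← map_zpow]
  rw [mul_scalar]

/-- An algebra with a basis of monomials in elements satisfying the relations of the semidirect
product is a twisted group algebra of the group of monomials. -/
def twistedBasis (b : Module.Basis (MonomialGroup D) ℂ B)
    (hb : ∀ g, b g = (monomial x p s g : Bˣ)) :
    TwistedBasis q (monomial x p s : MonomialGroup D → Bˣ) where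
  basis := b
  basis_apply := hb
  exists_mul g h' := exists_eq_scalar_mul_monomial h (by
    rw [QuotientGroup.mk_mul, mk_monomial h, mk_monomial h, map_mul])

/-- The elements `x` and `p` separate the monomials, unless `q` is a root of unity. -/
theorem isSeparatingPair [Nontrivial B] (hq : ∀ n : ℕ, 0 < n → q ^ n ≠ 1) :
    IsSeparatingPair (monomial x p s : MonomialGroup D → Bˣ) (lattice (1, 0)) (lattice (0, 1)) where
  commute := by rw [Commute, SemiconjBy, ← lattice_add, ← lattice_add, add_comm]
  normal := closure_normal
  free_or g hg := by
    by_cases h0 : angle g = 0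
    · right
      have hgl : g = lattice (exponent g) := by
        conv_lhs => rw [eq_lattice_mul_rotation_pow g, h0, pow_zero, mul_one]
      have hcomm : ∀ v, lattice v * g * (lattice v)⁻¹ = g := fun v => by
        rw [hgl, ← lattice_add, add_comm, lattice_add, mul_inv_cancel_right]
      refine ⟨hcomm _, hcomm _, ?_⟩
      have hinj : ∀ j : ℤ, scalar B ((q ^ D.ell) ^ j) = 1 → j = 0 := fun j hj => by
        have e : (q ^ D.ell) ^ j = 1 :=
          Units.map_injective (f := (algebraMap ℂ B : ℂ →* B)) (algebraMap ℂ B).injective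
            (hj.trans (map_one _).symm)
        rw [← zpow_natCast, ← zpow_mul] at e
        have hz : Function.Injective fun n : ℤ => q ^ n :=
          injective_zpow_iff_not_isOfFinOrder.2 fun h => by
            obtain ⟨n, hn, h⟩ := h.exists_pow_eq_one
            exact hq n hn h
        have := hz (e.trans (zpow_zero q).symm)
        exact (mul_eq_zero.1 this).resolve_left (Nat.cast_ne_zero.2 (ell_ne_zero D))
      rw [hgl]
      simp only [monomial_lattice, zpow_one, zpow_zero, mul_one, one_mul]
      by_contra! hc
      obtain ⟨e1, e2⟩ := hc
      have hj : (exponent g).2 = 0 := hinj _ (by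
        have e3 := zpow_mul_zpow_of_rel mul_scalar h.p_mul_x 1 (exponent g).2
        rw [zpow_one, mul_one] at e3
        have e4 : p ^ (exponent g).2 * x = x * p ^ (exponent g).2 := by
          refine mul_left_cancel (a := x ^ (exponent g).1) ?_
          rw [mul_inv_eq_iff_eq_mul] at e1
          rw [← mul_assoc, ← e1, ← mul_assoc, ← mul_assoc, (Commute.self_zpow x _).eq]
        rw [e4] at e3
        exact mul_eq_right.1 e3.symm)
      have hi : (exponent g).1 = 0 := hinj _ (by
        have e3 := zpow_mul_zpow_of_rel mul_scalar h.p_mul_x (exponent g).1 1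
        rw [zpow_one, one_mul] at e3
        have e4 : p * x ^ (exponent g).1 = x ^ (exponent g).1 * p := by
          refine mul_right_cancel (b := p ^ (exponent g).2) ?_
          rw [mul_inv_eq_iff_eq_mul] at e2
          rw [mul_assoc, e2, mul_assoc, mul_assoc, (Commute.self_zpow p _).eq]
        rw [e4] at e3
        exact mul_eq_right.1 e3.symm)
      exact hg (ext' (Prod.ext hi hj) (h0.trans angle_one.symm))
    · left
      intro i j e
      rw [lattice_zpow_mul_zpow, conj_lattice_eq_iff, add_comm] at e
      have := eq_zero_of_iterate_latticeTurn_eq h0 (angle_lt g) (add_left_cancel e.2).symm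
      exact Prod.mk_eq_zero.1 this

end

end

noncomputable section

/-! ### The basis of the quantum torus -/

open QWeyl

namespace QWeyl

variable (Q : ℂˣ)

/-- The operator `e_v ↦ c_v e_(v + w)` on the space with basis `e_v`, `v ∈ ℤ²`. The units are those
of the monoid underlying the ring of operators, as in `QWeyl.lift`. -/
def shift (w : ℤ × ℤ) (c : ℤ × ℤ → ℂˣ) :
    @Units (Module.End ℂ (ℤ × ℤ →₀ ℂ)) (Ring.toSemiring.toMonoid) where
  val := Finsupp.linearCombination ℂ fun v => Finsupp.single (v + w) (c v : ℂ)
  inv := Finsupp.linearCombination ℂ fun v => Finsupp.single (v - w) ((c (v - w))⁻¹ : ℂˣ).val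
  val_inv := by
    ext v : 2
    simp
  inv_val := by
    ext v : 2
    simp

theorem shift_single (w : ℤ × ℤ) (c : ℤ × ℤ → ℂˣ) (v : ℤ × ℤ) :
    (shift w c).val (Finsupp.single v 1) = (c v : ℂ) • Finsupp.single (v + w) 1 := by
  simp [shift]

theorem shift_inv_single (w : ℤ × ℤ) (c : ℤ × ℤ → ℂˣ) (v : ℤ × ℤ) :
    (shift w c)⁻¹.val (Finsupp.single v 1) =
      ((c (v - w))⁻¹ : ℂˣ).val • Finsupp.single (v - w) 1 := by
  change (shift w c).inv _ = _
  simp [shift]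

/-- Along an orbit on which the scalars `c` are trivial, a shift operator only moves the basis
vectors. -/
theorem shift_zpow_single (w : ℤ × ℤ) (c : ℤ × ℤ → ℂˣ) (v : ℤ × ℤ)
    (hc : ∀ n : ℤ, c (v + n • w) = 1) (n : ℤ) :
    (shift w c ^ n).val (Finsupp.single v 1) = Finsupp.single (v + n • w) 1 := by
  induction n with
  | zero => simp
  | succ n ih =>
    rw [add_comm, zpow_one_add, Units.val_mul, Module.End.mul_apply, ih, shift_single, hc]
    simp [add_smul]; abel_nf
  | pred n ih =>
    have h := hc (-n - 1)
    rw [sub_smul, one_smul, ← add_sub_assoc] at h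
    rw [sub_eq_neg_add, zpow_add, zpow_neg_one, Units.val_mul, Module.End.mul_apply, ih,
      shift_inv_single, h, inv_one, Units.val_one, one_smul, neg_add_eq_sub, sub_smul, one_smul,
      add_sub_assoc]

/-- The action of `A_Q` on the space with basis `e_v`, in which `X ^ i P ^ j` maps `e_0` to
`e_(i, j)`. -/
def representation : QWeyl Q →ₐ[ℂ] Module.End ℂ (ℤ × ℤ →₀ ℂ) :=
  lift (shift (1, 0) 1) (shift (0, 1) fun v : ℤ × ℤ => Q ^ v.1) <| by
    refine Units.ext ?_
    rw [Units.val_mul, Units.val_mul, scalar, Units.coe_map, MonoidHom.coe_coe, ← Algebra.smul_def,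
      Units.val_mul]
    refine Finsupp.lhom_ext' fun v => LinearMap.ext_ring ?_
    simp only [LinearMap.comp_apply, Finsupp.lsingle_apply, Module.End.mul_apply,
      LinearMap.smul_apply, shift_single, map_smul]
    simp [zpow_add, mul_comm, add_right_comm]

/-- Evaluation at `e_0` separates the monomials `X ^ i P ^ j`. -/
theorem representation_apply (v : ℤ × ℤ) :
    representation Q ((X Q ^ v.1 * P Q ^ v.2 : (QWeyl Q)ˣ) : QWeyl Q) (Finsupp.single 0 1) =
      Finsupp.single v 1 := by
  have hX : Units.map (representation Q : QWeyl Q →* _) (X Q) = shift (1, 0) 1 := lift_X _ _ _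
  have hP : Units.map (representation Q : QWeyl Q →* _) (P Q) =
    shift (0, 1) fun v : ℤ × ℤ => Q ^ v.1 := lift_P _ _ _
  have e : representation Q ((X Q ^ v.1 * P Q ^ v.2 : (QWeyl Q)ˣ) : QWeyl Q) =
      (shift (1, 0) 1 ^ v.1 * shift (0, 1) (fun v : ℤ × ℤ => Q ^ v.1) ^ v.2).val := by
    rw [← hX, ← hP, ← map_zpow, ← map_zpow, ← map_mul]
    rfl
  rw [e, Units.val_mul, Module.End.mul_apply, shift_zpow_single _ _ _ (by simp),
    shift_zpow_single _ _ _ fun _ => rfl]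
  simp

theorem eq_top_of_generators_mem (S : Subalgebra ℂ (QWeyl Q)) (hX : (X Q : QWeyl Q) ∈ S)
    (hX' : ((X Q)⁻¹ : (QWeyl Q)ˣ).val ∈ S) (hP : (P Q : QWeyl Q) ∈ S)
    (hP' : ((P Q)⁻¹ : (QWeyl Q)ˣ).val ∈ S) : S = ⊤ := by
  refine Algebra.eq_top_iff.2 fun a => ?_
  obtain ⟨w, rfl⟩ : ∃ w, mk Q w = a := RingQuot.mkAlgHom_surjective ℂ (Rel Q) a
  induction w using FreeAlgebra.induction with
  | grade0 r => rw [AlgHom.commutes]; exact S.algebraMap_mem r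
  | grade1 g => cases g; exacts [hX, hX', hP, hP']
  | mul a b ha hb => rw [map_mul]; exact S.mul_mem ha hb
  | add a b ha hb => rw [map_add]; exact S.add_mem ha hb

theorem scalar_smul {B : Type*} [Ring B] [Algebra ℂ B] (a : ℂˣ) (u : Bˣ) :
    ((scalar B a * u : Bˣ) : B) = (a : ℂ) • (u : B) := (Algebra.smul_def _ _).symm

/-- The monomials `X ^ i P ^ j` form a basis of `A_Q`. -/
theorem exists_basis : ∃ b : Module.Basis (ℤ × ℤ) ℂ (QWeyl Q),
    ∀ v, b v = ((X Q ^ v.1 * P Q ^ v.2 : (QWeyl Q)ˣ) : QWeyl Q) := by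
  let f : ℤ × ℤ → QWeyl Q := fun v => ((X Q ^ v.1 * P Q ^ v.2 : (QWeyl Q)ˣ) : QWeyl Q)
  have hli : LinearIndependent ℂ f := by
    refine LinearIndependent.of_comp
      ((LinearMap.applyₗ (Finsupp.single 0 1)) ∘ₗ (representation Q).toLinearMap) ?_
    have e : ((LinearMap.applyₗ (Finsupp.single 0 1)) ∘ₗ (representation Q).toLinearMap) ∘ f =
        Finsupp.basisSingleOne (R := ℂ) := funext fun v => by
      rw [Finsupp.coe_basisSingleOne]
      exact representation_apply Q v
    rw [e]
    exact Finsupp.basisSingleOne.linearIndependent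
  -- The span of the monomials contains `1` and is stable under multiplication by the generators.
  have hstable : ∀ u : (QWeyl Q)ˣ, (∀ v : ℤ × ℤ, ∃ (a : ℂˣ) (w : ℤ × ℤ),
      u * (X Q ^ v.1 * P Q ^ v.2) = scalar _ a * (X Q ^ w.1 * P Q ^ w.2)) →
      ∀ a ∈ Submodule.span ℂ (Set.range f), (u : QWeyl Q) * a ∈ Submodule.span ℂ (Set.range f) := by
    intro u hu
    refine fun a ha => Submodule.span_le (p := (Submodule.span ℂ (Set.range f)).comap
      (LinearMap.mulLeft ℂ (u : QWeyl Q))) |>.2 ?_ ha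
    rintro _ ⟨v, rfl⟩
    obtain ⟨a, w, h⟩ := hu v
    have e : (u : QWeyl Q) * f v = (a : ℂ) • f w :=
      (congrArg Units.val h).trans (scalar_smul _ _)
    rw [SetLike.mem_coe, Submodule.mem_comap, LinearMap.mulLeft_apply, e]
    exact Submodule.smul_mem _ _ (Submodule.subset_span ⟨w, rfl⟩)
  have hPX : ∀ i : ℤ, P Q * X Q ^ i = scalar _ (Q ^ i) * (X Q ^ i * P Q) := fun i => by
    simpa using zpow_mul_zpow_of_rel mul_scalar (P_mul_X (Q := Q)) i 1
  have hsp : ⊤ ≤ Submodule.span ℂ (Set.range f) := by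
    let S : Subalgebra ℂ (QWeyl Q) :=
      { carrier := {b | ∀ a ∈ Submodule.span ℂ (Set.range f),
          b * a ∈ Submodule.span ℂ (Set.range f)}
        mul_mem' := fun hb hc a ha => by rw [mul_assoc]; exact hb _ (hc a ha)
        add_mem' := fun hb hc a ha => by rw [add_mul]; exact add_mem (hb a ha) (hc a ha)
        algebraMap_mem' := fun r a ha => by
          rw [← Algebra.smul_def]; exact Submodule.smul_mem _ _ ha }
    have hS : S = ⊤ := by
      refine eq_top_of_generators_mem Q S (hstable _ fun v => ⟨1, (1 + v.1, v.2), ?_⟩)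
        (hstable _ fun v => ⟨1, (-1 + v.1, v.2), ?_⟩)
        (hstable _ fun v => ⟨Q ^ v.1, (v.1, 1 + v.2), ?_⟩)
        (hstable _ fun v => ⟨(Q ^ v.1)⁻¹, (v.1, -1 + v.2), ?_⟩)
      · rw [map_one, one_mul, zpow_one_add, mul_assoc]
      · rw [map_one, one_mul, zpow_add, zpow_neg_one, mul_assoc]
      · rw [← mul_assoc, hPX, zpow_one_add, mul_assoc, mul_assoc]
      · rw [inv_mul_eq_iff_eq_mul, ← mul_assoc, mul_scalar, mul_assoc, ← mul_assoc (P Q),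
          hPX, map_inv, mul_assoc, inv_mul_cancel_left, zpow_add, zpow_neg_one,
          mul_assoc, mul_inv_cancel_left]
    intro a _
    have h : a ∈ S := hS ▸ Algebra.mem_top
    have h1 : (1 : QWeyl Q) ∈ Submodule.span ℂ (Set.range f) :=
      Submodule.subset_span ⟨0, by simp [f]⟩
    simpa using h 1 h1
  exact ⟨Module.Basis.mk hli hsp, fun v => Module.Basis.mk_apply hli hsp v⟩

end QWeyl

end

noncomputable section

/-! ### The basis and the universal property of the semidirect product -/

open QWeyl Multiplicative

namespace SemidirectWeyl

variable (D : StarDiagram) (q : ℂˣ)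

/-- The inclusion of `A_{q^ℓ}` in the semidirect product. -/
def ofWeyl : QWeyl (q ^ D.ell) →ₐ[ℂ] SemidirectWeyl D q :=
  let f : RotWeyl D q →ₐ[ℂ] SemidirectWeyl D q :=
    { SkewMonoidAlgebra.singleOneRingHom with commutes' := fun _ => rfl }
  f

/-- The element `X` of the semidirect product. -/
def X : (SemidirectWeyl D q)ˣ :=
  Units.map (ofWeyl D q : QWeyl (q ^ D.ell) →* SemidirectWeyl D q) (QWeyl.X _)

/-- The element `P` of the semidirect product. -/
def P : (SemidirectWeyl D q)ˣ :=
  Units.map (ofWeyl D q : QWeyl (q ^ D.ell) →* SemidirectWeyl D q) (QWeyl.P _)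

/-- The elements of `ℤ/ℓ` as invertible elements of the semidirect product. -/
def ofCyclic : Multiplicative (ZMod D.ell) →* (SemidirectWeyl D q)ˣ :=
  (Units.map (SkewMonoidAlgebra.of (RotWeyl D q) (Multiplicative (ZMod D.ell)))).comp
    toUnits.toMonoidHom

/-- The element `s` of the semidirect product. -/
def S : (SemidirectWeyl D q)ˣ := ofCyclic D q (ofAdd 1)

/-- In the semidirect product, the automorphism `rot` of `A_{q^ℓ}` is conjugation by `s⁻¹`. -/
theorem conj_ofWeyl (u : (QWeyl (q ^ D.ell))ˣ) :
    (S D q)⁻¹ * Units.map (ofWeyl D q : QWeyl (q ^ D.ell) →* SemidirectWeyl D q) u * S D q =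
      Units.map (ofWeyl D q : QWeyl (q ^ D.ell) →* SemidirectWeyl D q)
        (Units.map (rot D q : QWeyl (q ^ D.ell) →* QWeyl (q ^ D.ell)) u) := by
  rw [mul_assoc, inv_mul_eq_iff_eq_mul]
  refine Units.ext ?_
  have h1 : ∀ w : RotWeyl D q, SkewMonoidAlgebra.single 1 w *
      SkewMonoidAlgebra.single (ofAdd (1 : ZMod D.ell)) (1 : RotWeyl D q) =
        SkewMonoidAlgebra.single (ofAdd (1 : ZMod D.ell)) w := fun w => by
    rw [SkewMonoidAlgebra.single_mul_single, one_mul, smul_one, mul_one]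
  have h2 : ∀ w : RotWeyl D q, SkewMonoidAlgebra.single (ofAdd (1 : ZMod D.ell)) (1 : RotWeyl D q) *
      SkewMonoidAlgebra.single 1 w =
        SkewMonoidAlgebra.single (ofAdd (1 : ZMod D.ell)) (ofAdd (1 : ZMod D.ell) • w) := fun w => by
    rw [SkewMonoidAlgebra.single_mul_single, one_mul, mul_one]
  refine (h1 _).trans (Eq.trans ?_ (h2 _).symm)
  have h3 : ∀ w : QWeyl (q ^ D.ell), action D q (ofAdd 1) (rot D q w) = w := fun w => by
    rw [action_generator]
    exact AlgEquiv.symm_apply_apply (rotEquiv D q) w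
  exact congrArg (SkewMonoidAlgebra.single (k := RotWeyl D q) (ofAdd (1 : ZMod D.ell))) (h3 u).symm

theorem isWeylTriple : IsWeylTriple D (scalar (SemidirectWeyl D q)) q (X D q) (P D q) (S D q) where
  p_mul_x := by
    rw [X, P, ← map_mul, P_mul_X, map_mul, map_scalar, map_mul]
  pow_eq_one := by
    rw [S, ← map_pow, ← ofAdd_nsmul, nsmul_one, ZMod.natCast_self, ofAdd_zero, map_one]
  conj_eq := by
    have h := map_rotWord D (scalar (QWeyl (q ^ D.ell))) q (QWeyl.X _) (QWeyl.P _)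
      (Units.map (ofWeyl D q : QWeyl (q ^ D.ell) →* SemidirectWeyl D q))
    have hc : (Units.map (ofWeyl D q : QWeyl (q ^ D.ell) →* SemidirectWeyl D q)).comp
        (scalar (QWeyl (q ^ D.ell))) = scalar (SemidirectWeyl D q) :=
      MonoidHom.ext fun a => map_scalar _ a
    rw [hc] at h
    rw [X, P, conj_ofWeyl, conj_ofWeyl, ← h, rotWord_eq, map_rot_X, map_rot_P]
    rfl

/-- The monomials `X ^ i P ^ j s ^ k` form a basis of the semidirect product. -/
theorem exists_basis : ∃ b : Module.Basis (MonomialGroup D) ℂ (SemidirectWeyl D q),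
    ∀ g, b g = (monomial (X D q) (P D q) (S D q) g : (SemidirectWeyl D q)ˣ) := by
  obtain ⟨b₀, hb₀⟩ := QWeyl.exists_basis (q ^ D.ell)
  let b₁ : Module.Basis (ℤ × ℤ) ℂ (RotWeyl D q) := b₀
  let b := ((Finsupp.basis fun _ : Multiplicative (ZMod D.ell) => b₁).map
    (SkewMonoidAlgebra.coeffLinearEquiv (S := ℂ)).symm).reindex
      ((Equiv.sigmaEquivProd _ _).trans ((Equiv.prodComm _ _).trans
        SemidirectProduct.equivProd.symm : _ ≃ MonomialGroup D))
  refine ⟨b, fun g => ?_⟩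
  have h1 : b g = SkewMonoidAlgebra.single g.right (b₁ (toAdd g.left)) := by
    simp only [b, Module.Basis.reindex_apply, Module.Basis.map_apply, Finsupp.coe_basis]
    rfl
  have h2 : ∀ w : RotWeyl D q, SkewMonoidAlgebra.single 1 w *
      SkewMonoidAlgebra.single g.right (1 : RotWeyl D q) =
        SkewMonoidAlgebra.single g.right w := fun w => by
    rw [SkewMonoidAlgebra.single_mul_single, one_mul, smul_one, mul_one]
  have h3 : S D q ^ MonomialGroup.angle g = ofCyclic D q g.right := by
    rw [S, ← map_pow, MonomialGroup.angle, ← ofAdd_eq_generator_pow]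
  rw [h1, monomial, h3, X, P, ← map_zpow, ← map_zpow, ← map_mul]
  exact (congrArg (SkewMonoidAlgebra.single g.right) (hb₀ _)).trans (h2 _).symm

end SemidirectWeyl

/-- Conjugation `a ↦ v a v⁻¹` as a homomorphism of algebras. -/
def conjAlgHom {B : Type*} [Ring B] [Algebra ℂ B] (v : Bˣ) : B →ₐ[ℂ] B :=
  AlgHom.ofLinearMap (conjugation ℂ v)
    (by rw [conjugation_apply, mul_one, ← Units.val_mul, mul_inv_cancel, Units.val_one])
    fun a b => by
      simp only [conjugation_apply, mul_assoc, Units.inv_mul_cancel_left]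

namespace SemidirectWeyl

section lift

variable {D : StarDiagram} {q : ℂˣ} {B : Type*} [Ring B] [Algebra ℂ B] {x p s : Bˣ}
  (h : IsWeylTriple D (scalar B) q x p s)

include h in
theorem lift_rot (u : QWeyl (q ^ D.ell)) :
    QWeyl.lift x p h.p_mul_x (rot D q u) =
      ((s⁻¹ : Bˣ) : B) * QWeyl.lift x p h.p_mul_x u * s := by
  have hx := lift_X x p h.p_mul_x
  have hp := lift_P x p h.p_mul_x
  have h1 := map_rotWord D (scalar (QWeyl (q ^ D.ell))) q (QWeyl.X _) (QWeyl.P _)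
    (Units.map (QWeyl.lift x p h.p_mul_x : QWeyl (q ^ D.ell) →* B))
  have hc : (Units.map (QWeyl.lift x p h.p_mul_x : QWeyl (q ^ D.ell) →* B)).comp
      (scalar (QWeyl (q ^ D.ell))) = scalar B := MonoidHom.ext fun a => map_scalar _ a
  rw [hc, hx, hp, ← h.conj_eq, rotWord_eq, Prod.ext_iff] at h1
  obtain ⟨e1, e2⟩ := h1
  have hconj : ∀ v w : Bˣ, Units.map (conjAlgHom v : B →* B) w = v * w * v⁻¹ := fun v w =>
    Units.ext (conjugation_apply v (w : B))
  have e : (QWeyl.lift x p h.p_mul_x).comp (rot D q) =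
      (conjAlgHom s⁻¹).comp (QWeyl.lift x p h.p_mul_x) := by
    refine algHom_ext ?_ ?_
    · refine Eq.trans (congrArg (Units.map (QWeyl.lift x p h.p_mul_x : _ →* B))
        (map_rot_X D q)) (e1.trans ?_)
      refine Eq.trans ?_ (congrArg (Units.map (conjAlgHom s⁻¹ : B →* B)) hx).symm
      rw [hconj, inv_inv]
    · refine Eq.trans (congrArg (Units.map (QWeyl.lift x p h.p_mul_x : _ →* B))
        (map_rot_P D q)) (e2.trans ?_)
      refine Eq.trans ?_ (congrArg (Units.map (conjAlgHom s⁻¹ : B →* B)) hp).symm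
      rw [hconj, inv_inv]
  refine (AlgHom.congr_fun e u).trans ((conjugation_apply _ _).trans ?_)
  rw [inv_inv]
  rfl

include h in
/-- The homomorphism from the semidirect product given by elements that satisfy its relations. -/
theorem exists_lift : ∃ f : SemidirectWeyl D q →ₐ[ℂ] B,
    Units.map (f : SemidirectWeyl D q →* B) (X D q) = x ∧
    Units.map (f : SemidirectWeyl D q →* B) (P D q) = p ∧
    Units.map (f : SemidirectWeyl D q →* B) (S D q) = s := by
  let F : RotWeyl D q →ₐ[ℂ] B := QWeyl.lift x p h.p_mul_x
  let g : Multiplicative (ZMod D.ell) →* B := (Units.coeHom B).comp (zmodHom s h.pow_eq_one)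
  have hg : g (ofAdd 1) = s := congrArg Units.val (zmodHom_generator s h.pow_eq_one)
  -- The generator acts on `A_{q^ℓ}` by the inverse of the automorphism `u ↦ s⁻¹ u s`.
  have h1 : ∀ u : RotWeyl D q, F (ofAdd (1 : ZMod D.ell) • u) * s = s * F u := fun u => by
    have e := lift_rot h (action D q (ofAdd 1) (u : QWeyl (q ^ D.ell)))
    rw [action_generator] at e
    have e' : rot D q ((rotEquiv D q)⁻¹ u) = u := AlgEquiv.apply_symm_apply (rotEquiv D q) u
    rw [e'] at e
    have e2 : F u = ((s⁻¹ : Bˣ) : B) * F (ofAdd (1 : ZMod D.ell) • u) * s := by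
      rw [RotWeyl.smul_def, action_generator]
      exact e
    rw [e2, mul_assoc, Units.mul_inv_cancel_left]
  have hcomm : ∀ {u : RotWeyl D q} {a : Multiplicative (ZMod D.ell)},
      F (a • u) * g a = g a * F u := by
    intro u a
    rw [ofAdd_eq_generator_pow a]
    induction (toAdd a).val generalizing u with
    | zero => simp
    | succ n ih => rw [pow_succ, mul_smul, map_mul, ← mul_assoc, ih, mul_assoc, hg, h1, mul_assoc]
  have hf : ∀ a u, SkewMonoidAlgebra.liftNCAlgHom F g hcomm (SkewMonoidAlgebra.single a u) =
      F u * g a := fun a u => SkewMonoidAlgebra.liftNC_single _ _ _ _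
  refine ⟨SkewMonoidAlgebra.liftNCAlgHom F g hcomm, ?_, ?_, ?_⟩
  · refine Eq.trans (Units.ext ?_) (lift_X x p h.p_mul_x)
    refine (hf _ _).trans ?_
    rw [map_one, mul_one]
    rfl
  · refine Eq.trans (Units.ext ?_) (lift_P x p h.p_mul_x)
    refine (hf _ _).trans ?_
    rw [map_one, mul_one]
    rfl
  · refine Units.ext ((hf _ _).trans ?_)
    rw [map_one, one_mul]
    exact hg

/-- A homomorphism from the semidirect product is determined by the images of the generators. -/
theorem algHom_ext {f g : SemidirectWeyl D q →ₐ[ℂ] B}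
    (hX : Units.map (f : SemidirectWeyl D q →* B) (X D q) =
      Units.map (g : SemidirectWeyl D q →* B) (X D q))
    (hP : Units.map (f : SemidirectWeyl D q →* B) (P D q) =
      Units.map (g : SemidirectWeyl D q →* B) (P D q))
    (hS : Units.map (f : SemidirectWeyl D q →* B) (S D q) =
      Units.map (g : SemidirectWeyl D q →* B) (S D q)) : f = g := by
  obtain ⟨b, hb⟩ := exists_basis D q
  refine AlgHom.toLinearMap_injective (b.ext fun a => ?_)
  rw [hb]
  have e : Units.map (f : SemidirectWeyl D q →* B) (monomial (X D q) (P D q) (S D q) a) =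
      Units.map (g : SemidirectWeyl D q →* B) (monomial (X D q) (P D q) (S D q) a) := by
    rw [map_monomial, map_monomial, hX, hP, hS]
  exact congrArg Units.val e

end lift

end SemidirectWeyl

end

noncomputable section

/-! ### The two sets of generators -/

open QWeyl

section normalForm

variable {G : Type*} [Group G]

variable {c : ℂˣ →* G} {q : ℂˣ} {x p : G}

/-- The words in `x`, `p` and powers of `q` have normal forms `w n i j = q ^ n x ^ i p ^ j`, which
are multiplied and inverted by calculations with the exponents. -/
theorem exists_weylWord (hc : ∀ u a, u * c a = c a * u) {l : ℕ} (h : p * x = c (q ^ l) * (x * p)) :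
    ∃ w : ℤ → ℤ → ℤ → G, x = w 0 1 0 ∧ p = w 0 0 1 ∧ (∀ n : ℤ, c (q ^ n) = w n 0 0) ∧
      (∀ n i j n' i' j', w n i j * w n' i' j' = w (n + n' + l * (j * i')) (i + i') (j + j')) ∧
      (∀ n i j, (w n i j)⁻¹ = w (-n + l * (i * j)) (-i) (-j)) ∧ w 0 0 0 = 1 := by
  have hmul : ∀ n i j n' i' j' : ℤ, c (q ^ n) * (x ^ i * p ^ j) * (c (q ^ n') * (x ^ i' * p ^ j')) =
      c (q ^ (n + n' + l * (j * i'))) * (x ^ (i + i') * p ^ (j + j')) := by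
    intro n i j n' i' j'
    rw [mul_assoc, ← mul_assoc _ (c (q ^ n')), hc, mul_assoc (c _), ← mul_assoc (c _), ← map_mul,
      ← zpow_add, mul_assoc (x ^ i), ← mul_assoc (p ^ j), zpow_mul_zpow_of_rel hc h, ← zpow_natCast,
      ← zpow_mul, mul_assoc (c _), ← mul_assoc (x ^ i), hc, mul_assoc (c _), ← mul_assoc (c _),
      ← map_mul, ← zpow_add, zpow_add x, zpow_add p]
    simp only [mul_assoc]
  refine ⟨fun n i j => c (q ^ n) * (x ^ i * p ^ j), by simp, by simp, by simp, hmul, ?_, by simp⟩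
  intro n i j
  rw [inv_eq_iff_mul_eq_one, hmul, add_neg_cancel, add_neg_cancel,
    show n + (-n + l * (i * j)) + l * (j * -i) = (0 : ℤ) by ring]
  simp

/-- Rules that move `s` to the left. -/
theorem swap_of_conj {s u v : G} (h : s⁻¹ * u * s = v) : u * s = s * v ∧ u⁻¹ * s = s * v⁻¹ ∧
    (∀ t, u * (s * t) = s * (v * t)) ∧ ∀ t, u⁻¹ * (s * t) = s * (v⁻¹ * t) := by
  subst h
  refine ⟨by group, by group, fun t => by group, fun t => by group⟩

end normalForm

section

variable {G : Type*} [Group G] {c : ℂˣ →* G} {q : ℂˣ} {x p s : G}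

/-- The generators `T i` in terms of the generators `x`, `p`, `s` of the semidirect product. -/
def legGenerator {G : Type*} [Group G] (D : StarDiagram) (c : ℂˣ →* G) (q : ℂˣ) (x p s : G) :
    Fin D.legs → G :=
  match D with
  | .D4 => ![s, s * x, c q * (s * (x * p)), s * p]
  | .E6 => ![s, c q * (s * x), c q * (s * (x * p))]
  | .E7 => ![s ^ 2 * p⁻¹, c (q ^ 3) * (s * x), s]
  | .E8 => ![s ^ 3 * x, s ^ 2 * p, s]

/-- The generators `x`, `p`, `s` of the semidirect product in terms of the generators `t i`. -/
def weylTriple {G : Type*} [Group G] (D : StarDiagram) (c : ℂˣ →* G) (q : ℂˣ)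
    (t : Fin D.legs → G) : G × G × G :=
  match D, t with
  | .D4, t => ((t (0 : Fin 4))⁻¹ * t (1 : Fin 4), (t (0 : Fin 4))⁻¹ * t (3 : Fin 4), t (0 : Fin 4))
  | .E6, t => (c q⁻¹ * ((t (0 : Fin 3))⁻¹ * t (1 : Fin 3)), (t (1 : Fin 3))⁻¹ * t (2 : Fin 3),
      t (0 : Fin 3))
  | .E7, t => (c (q ^ 3)⁻¹ * ((t (2 : Fin 3))⁻¹ * t (1 : Fin 3)),
      (t (0 : Fin 3))⁻¹ * t (2 : Fin 3) ^ 2, t (2 : Fin 3))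
  | .E8, t => ((t (2 : Fin 3) ^ 3)⁻¹ * t (0 : Fin 3), (t (2 : Fin 3) ^ 2)⁻¹ * t (1 : Fin 3),
      t (2 : Fin 3))

/-- The elements `t i` of a group satisfy the relations of `B(q)`. -/
structure IsLegTuple {G : Type*} [Group G] (D : StarDiagram) (c : ℂˣ →* G) (q : ℂˣ)
    (t : Fin D.legs → G) : Prop where
  pow_eq_one : ∀ i, t i ^ D.legOrder i = 1
  prod_eq : Fin.partialProd t (Fin.last D.legs) = c q

theorem partialProd_three (t : Fin 3 → G) : Fin.partialProd t (Fin.last 3) = t 0 * t 1 * t 2 := by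
  simp [Fin.partialProd, List.ofFn_succ, mul_assoc]

theorem partialProd_four (t : Fin 4 → G) :
    Fin.partialProd t (Fin.last 4) = t 0 * t 1 * t 2 * t 3 := by
  simp [Fin.partialProd, List.ofFn_succ, mul_assoc]

theorem forall_fin_three {p : Fin 3 → Prop} : (∀ i, p i) ↔ p 0 ∧ p 1 ∧ p 2 := by
  simp [Fin.forall_fin_succ]

theorem forall_fin_four {p : Fin 4 → Prop} : (∀ i, p i) ↔ p 0 ∧ p 1 ∧ p 2 ∧ p 3 := by
  simp [Fin.forall_fin_succ]

theorem isLegTuple_D4_iff {t : Fin 4 → G} : IsLegTuple .D4 c q t ↔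
    (t 0 ^ 2 = 1 ∧ t 1 ^ 2 = 1 ∧ t 2 ^ 2 = 1 ∧ t 3 ^ 2 = 1) ∧ t 0 * t 1 * t 2 * t 3 = c q := by
  refine Iff.trans ⟨fun h => ⟨h.1, h.2⟩, fun h => ⟨h.1, h.2⟩⟩
    (and_congr forall_fin_four (by rw [← partialProd_four]; rfl))

theorem isLegTuple_E6_iff {t : Fin 3 → G} : IsLegTuple .E6 c q t ↔
    (t 0 ^ 3 = 1 ∧ t 1 ^ 3 = 1 ∧ t 2 ^ 3 = 1) ∧ t 0 * t 1 * t 2 = c q := by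
  refine Iff.trans ⟨fun h => ⟨h.1, h.2⟩, fun h => ⟨h.1, h.2⟩⟩
    (and_congr forall_fin_three (by rw [← partialProd_three]; rfl))

theorem isLegTuple_E7_iff {t : Fin 3 → G} : IsLegTuple .E7 c q t ↔
    (t 0 ^ 2 = 1 ∧ t 1 ^ 4 = 1 ∧ t 2 ^ 4 = 1) ∧ t 0 * t 1 * t 2 = c q := by
  refine Iff.trans ⟨fun h => ⟨h.1, h.2⟩, fun h => ⟨h.1, h.2⟩⟩
    (and_congr forall_fin_three (by rw [← partialProd_three]; rfl))

theorem isLegTuple_E8_iff {t : Fin 3 → G} : IsLegTuple .E8 c q t ↔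
    (t 0 ^ 2 = 1 ∧ t 1 ^ 3 = 1 ∧ t 2 ^ 6 = 1) ∧ t 0 * t 1 * t 2 = c q := by
  refine Iff.trans ⟨fun h => ⟨h.1, h.2⟩, fun h => ⟨h.1, h.2⟩⟩
    (and_congr forall_fin_three (by rw [← partialProd_three]; rfl))

/-- No relations are needed for this composition. -/
theorem weylTriple_legGenerator (D : StarDiagram) (c : ℂˣ →* G) (hc : ∀ u a, u * c a = c a * u) :
    weylTriple D c q (legGenerator D c q x p s) = (x, p, s) := by
  match D with
  | .D4 => simp [weylTriple, legGenerator]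
  | .E6 =>
    have e : (c q)⁻¹ * (s⁻¹ * (c q * (s * x))) = x := by
      rw [← mul_assoc s⁻¹, hc, mul_assoc, inv_mul_cancel_left, inv_mul_cancel_left]
    simp [weylTriple, legGenerator, e]
  | .E7 =>
    have e : (c q ^ 3)⁻¹ * (s⁻¹ * (c q ^ 3 * (s * x))) = x := by
      rw [← map_pow, ← mul_assoc s⁻¹, hc, mul_assoc, inv_mul_cancel_left, inv_mul_cancel_left]
    simp [weylTriple, legGenerator, e]
  | .E8 => simp [weylTriple, legGenerator]

set_option linter.unusedSimpArgs false in
/-- The relations of the semidirect product imply those of `B(q)`. Moving all factors `s` to the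
left leaves a word in `x`, `p` and `q`, which is evaluated in normal form. -/
theorem isLegTuple_legGenerator {D : StarDiagram} (hc : ∀ u a, u * c a = c a * u)
    (h : IsWeylTriple D c q x p s) : IsLegTuple D c q (legGenerator D c q x p s) := by
  obtain ⟨h1, hs, h2⟩ := h
  -- From here on, `x` and `p` are written `w 0 1 0` and `w 0 0 1`.
  obtain ⟨w, rfl, rfl, ec, m, i, e1⟩ := exists_weylWord hc h1
  have ecn : ∀ n : ℕ, c (q ^ n) = w n 0 0 := fun n => ec n
  have ecni : ∀ n : ℕ, c (q ^ n)⁻¹ = w (-n) 0 0 := fun n => by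
    rw [← ec, zpow_neg, zpow_natCast]
  have hpow : ∀ (u : G) (n : ℕ), u ^ (n + 1) = u ^ n * u := pow_succ
  have ec1 : c q = w 1 0 0 := (congrArg c (zpow_one q).symm).trans (ec 1)
  have eci : c q⁻¹ = w (-1) 0 0 := (congrArg c (zpow_neg_one q).symm).trans (ec (-1))
  have hcs : ∀ a, c a * s = s * c a := fun a => (hc s a).symm
  have hcs' : ∀ a t, c a * (s * t) = s * (c a * t) := fun a t => by
    rw [← mul_assoc, hcs, mul_assoc]
  have hcis' : ∀ a t, (c a)⁻¹ * (s * t) = s * ((c a)⁻¹ * t) := fun a t => by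
    rw [← map_inv, hcs']
  obtain ⟨hx, hp⟩ := Prod.mk.inj h2
  obtain ⟨x1, x2, x3, x4⟩ := swap_of_conj hx
  obtain ⟨p1, p2, p3, p4⟩ := swap_of_conj hp
  match D with
  | .D4 =>
    simp only [rotWord, StarDiagram.ell] at hs m i x1 x2 x3 x4 p1 p2 p3 p4
    have hs' : ∀ v, s * (s * v) = v := fun v => by rw [← mul_assoc, ← sq, hs, one_mul]
    refine isLegTuple_D4_iff.2 ⟨⟨hs, ?_, ?_, ?_⟩, ?_⟩ <;>
      simp only [legGenerator, Matrix.cons_val, hpow, pow_zero, one_mul, mul_assoc, x1, x2, x3,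
        x4, p1, p2, p3, p4, hcs, hcs', hcis', hs', mul_inv_rev, inv_inv] <;>
      simp only [ec1, eci, ecn, ← e1, m, i] <;> norm_num
  | .E6 =>
    simp only [rotWord, StarDiagram.ell] at hs m i x1 x2 x3 x4 p1 p2 p3 p4
    have hs' : ∀ v, s * (s * (s * v)) = v := fun v => by
      simpa [pow_succ, mul_assoc] using congrArg (· * v) hs
    refine isLegTuple_E6_iff.2 ⟨⟨hs, ?_, ?_⟩, ?_⟩ <;>
      simp only [legGenerator, Matrix.cons_val, hpow, pow_zero, one_mul, mul_assoc, x1, x2, x3,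
        x4, p1, p2, p3, p4, hcs, hcs', hcis', hs', mul_inv_rev, inv_inv] <;>
      simp only [ec1, eci, ecn, ← e1, m, i, ← mul_assoc] <;> norm_num
  | .E7 =>
    simp only [rotWord, StarDiagram.ell] at hs m i x1 x2 x3 x4 p1 p2 p3 p4
    have hs' : ∀ v, s * (s * (s * (s * v))) = v := fun v => by
      simpa [pow_succ, mul_assoc] using congrArg (· * v) hs
    refine isLegTuple_E7_iff.2 ⟨⟨?_, ?_, hs⟩, ?_⟩ <;>
      simp only [legGenerator, Matrix.cons_val, hpow, pow_zero, one_mul, mul_assoc, x1, x2, x3,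
        x4, p1, p2, p3, p4, hcs, hcs', hcis', hs', mul_inv_rev, inv_inv] <;>
      simp only [ec1, eci, ecn, ecni, ← e1, m, i, ← mul_assoc] <;> norm_num
  | .E8 =>
    simp only [rotWord, StarDiagram.ell] at hs m i x1 x2 x3 x4 p1 p2 p3 p4
    have hs' : ∀ v, s * (s * (s * (s * (s * (s * v))))) = v := fun v => by
      simpa [pow_succ, mul_assoc] using congrArg (· * v) hs
    refine isLegTuple_E8_iff.2 ⟨⟨?_, ?_, hs⟩, ?_⟩ <;>
      simp only [legGenerator, Matrix.cons_val, hpow, pow_zero, one_mul, mul_assoc, x1, x2, x3,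
        x4, p1, p2, p3, p4, hcs, hcs', hcis', hs', mul_inv_rev, inv_inv] <;>
      simp only [ec1, eci, ecn, ecni, ← e1, m, i, ← mul_assoc] <;> norm_num

end

end

noncomputable section

open QWeyl

section

variable {G : Type*} [Group G] {c : ℂˣ →* G} {q : ℂˣ} {x p s : G}

theorem eq_of_scalar_mul_commutator (hc : ∀ u a, u * c a = c a * u) {a : ℂˣ}
    (h : c a * (x⁻¹ * (p⁻¹ * (x * p))) = 1) : p * x = c a * (x * p) := by
  rw [← mul_assoc x⁻¹, ← mul_inv_rev, ← mul_assoc, ← hc, mul_assoc, inv_mul_eq_one] at h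
  exact h

set_option linter.unusedSimpArgs false in
/-- The relations of `B(q)` imply those of the semidirect product. The product relation
and all but one of the relations `T i ^ d_i = 1` give the conjugates `s⁻¹ x s` and `s⁻¹ p s`; moving
all factors `s` to the left then turns the remaining relation into `p x = q ^ ℓ x p`. -/
theorem isWeylTriple_of_isLegTuple {D : StarDiagram} (hc : ∀ u a, u * c a = c a * u)
    (h : IsLegTuple D c q (legGenerator D c q x p s)) : IsWeylTriple D c q x p s := by
  have hpow : ∀ (u : G) (n : ℕ), u ^ (n + 1) = u ^ n * u := pow_succ
  have hl : ∀ u a t, u * (c a * t) = c a * (u * t) := fun u a t => by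
    rw [← mul_assoc, hc, mul_assoc]
  have hcc : ∀ a b t, c a * (c b * t) = c (a * b) * t := fun a b t => by rw [map_mul, mul_assoc]
  have hinv : ∀ a, (c a)⁻¹ = c a⁻¹ := fun a => (map_inv c a).symm
  have hs : ∀ a, s * c a = c a * s := hc s
  have hs' := hl s
  have hx := hc x
  have hx' := hl x
  have hxi := hc x⁻¹
  have hxi' := hl x⁻¹
  have hp := hc p
  have hp' := hl p
  have hpi := hc p⁻¹
  have hpi' := hl p⁻¹
  match D with
  | .D4 =>
    obtain ⟨⟨h0, h1, h2, h3⟩, h4⟩ := isLegTuple_D4_iff.1 h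
    simp only [legGenerator, Matrix.cons_val] at h0 h1 h2 h3 h4
    have e : s⁻¹ = s := inv_eq_of_mul_eq_one_left (by rw [← sq, h0])
    have hss : ∀ t, s * (s * t) = t := fun t => by rw [← mul_assoc, ← sq, h0, one_mul]
    have rx : s⁻¹ * x * s = x⁻¹ := eq_inv_of_mul_eq_one_left (by rw [e, ← h1, sq]; group)
    have rp : s⁻¹ * p * s = p⁻¹ := eq_inv_of_mul_eq_one_left (by rw [e, ← h3, sq]; group)
    obtain ⟨x1, x2, x3, x4⟩ := swap_of_conj rx
    obtain ⟨p1, p2, p3, p4⟩ := swap_of_conj rp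
    refine ⟨eq_of_scalar_mul_commutator hc ?_, h0, Prod.ext rx rp⟩
    simp only [hpow, pow_zero, one_mul, mul_assoc, hs', hx', hp', hxi', hpi', x3, p3, hss] at h2
    rw [← h2, StarDiagram.ell, map_pow, sq, mul_assoc]
  | .E6 =>
    obtain ⟨⟨h0, h1, h2⟩, h3⟩ := isLegTuple_E6_iff.1 h
    simp only [legGenerator, Matrix.cons_val] at h0 h1 h2 h3
    have e : s⁻¹ = s * s := inv_eq_of_mul_eq_one_left (by rw [← h0, pow_three'])
    have hss : ∀ t, s * (s * (s * t)) = t := fun t => by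
      simpa [pow_succ, mul_assoc] using congrArg (· * t) h0
    have rx : s⁻¹ * x * s = c q⁻¹ * (p⁻¹ * x⁻¹) := by
      simp only [mul_assoc, hs', hx'] at h3
      rw [mul_eq_left] at h3
      rw [map_inv, ← mul_inv_rev, eq_inv_mul_iff_mul_eq, eq_inv_iff_mul_eq_one, e, ← h3]
      simp only [mul_assoc]
    obtain ⟨x1, x2, x3, x4⟩ := swap_of_conj rx
    have rp : s⁻¹ * p * s = c (q ^ 2) * x := by
      simp only [hpow, pow_zero, one_mul, mul_assoc, hs', hx'] at h1
      rw [x3 (x * (s * x))] at h1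
      simp only [mul_assoc, inv_mul_cancel_left, hs'] at h1
      have e2 : s⁻¹ * p⁻¹ * s * (c (q ^ 2) * x) = 1 := by
        rw [hl, ← h1, e]
        simp only [hcc, mul_assoc]
        congr 2
        refine Units.ext ?_
        push_cast
        field_simp
      rw [← inv_mul_eq_one, ← e2]
      group
    obtain ⟨p1, p2, p3, p4⟩ := swap_of_conj rp
    refine ⟨eq_of_scalar_mul_commutator hc ?_, h0, Prod.ext rx rp⟩
    simp only [hpow, pow_zero, one_mul, mul_assoc, hs', hx', hp', hxi', hpi', x3, p3, x4, p4, hss,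
      inv_mul_cancel_left, mul_inv_rev, inv_inv, hinv, hcc, hs, hx, hp, hxi, hpi,
      inv_mul_cancel, mul_one] at h2
    rw [← h2, StarDiagram.ell]
    congr 2
    refine Units.ext ?_
    push_cast
    field_simp
  | .E7 =>
    obtain ⟨⟨h0, h1, h2⟩, h3⟩ := isLegTuple_E7_iff.1 h
    simp only [legGenerator, Matrix.cons_val] at h0 h1 h2 h3
    have hss : ∀ t, s * (s * (s * (s * t))) = t := fun t => by
      simpa [pow_succ, mul_assoc] using congrArg (· * t) h2
    have e0 : (s ^ 2 * p⁻¹)⁻¹ = s ^ 2 * p⁻¹ := inv_eq_of_mul_eq_one_left (by rw [← sq, h0])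
    have rx : s⁻¹ * x * s = c (q ^ 2)⁻¹ * p⁻¹ := by
      -- The first generator is an involution: this turns `s ^ 2 p⁻¹ s x s` into `p s⁻¹ x s`.
      rw [← e0] at h3
      have e1 : c (q ^ 3) * (p * (s⁻¹ * x * s)) = c q := by
        rw [← h3, hl, mul_assoc (c _)]
        group
      rw [← eq_inv_mul_iff_mul_eq, ← map_inv, ← map_mul, ← eq_inv_mul_iff_mul_eq, hpi] at e1
      rw [e1]
      congr 2
      group
    obtain ⟨x1, x2, x3, x4⟩ := swap_of_conj rx
    have rp : s⁻¹ * p * s = c (q ^ 2) * x := by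
      -- Both sides have the conjugate `p⁻¹` under `s`.
      have e3 : s ^ 2 = (s ^ 2)⁻¹ := eq_inv_of_mul_eq_one_left (by rw [← pow_add, h2])
      have e2 : s⁻¹ * (s⁻¹ * p * s) * s = p⁻¹ := calc
        _ = (s ^ 2)⁻¹ * p * s ^ 2 := by rw [sq, mul_inv_rev]; simp only [mul_assoc]
        _ = (s ^ 2)⁻¹ * p * (s ^ 2)⁻¹ := congrArg ((s ^ 2)⁻¹ * p * ·) e3
        _ = (s ^ 2)⁻¹ * (s ^ 2 * p⁻¹)⁻¹ := by group
        _ = p⁻¹ := by rw [e0, inv_mul_cancel_left]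
      refine mul_left_cancel (a := s⁻¹) (mul_right_cancel (b := s) ?_)
      rw [e2, hl, mul_assoc (c _), rx, ← mul_assoc, ← map_mul, mul_inv_cancel, map_one, one_mul]
    obtain ⟨p1, p2, p3, p4⟩ := swap_of_conj rp
    refine ⟨?_, h2, Prod.ext rx rp⟩
    simp only [hpow, pow_zero, one_mul, mul_assoc, hs', hx', hp', hxi', hpi', x3, p3, x4, p4, hss,
      inv_mul_cancel_left, mul_inv_rev, inv_inv, hinv, hcc, hs, hx, hp, hxi, hpi,
      inv_mul_cancel, mul_one] at h1
    rw [← hp', mul_eq_one_iff_inv_eq, eq_comm, ← hxi', inv_mul_eq_iff_eq_mul, ← hpi',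
      inv_mul_eq_iff_eq_mul, ← mul_assoc p, eq_mul_inv_iff_mul_eq] at h1
    rw [← h1, StarDiagram.ell, mul_assoc (c _)]
    congr 2
    refine Units.ext ?_
    push_cast
    field_simp
  | .E8 =>
    obtain ⟨⟨h0, h1, h2⟩, h3⟩ := isLegTuple_E8_iff.1 h
    simp only [legGenerator, Matrix.cons_val] at h0 h1 h2 h3
    have hss : ∀ t, s * (s * (s * (s * (s * (s * t))))) = t := fun t => by
      simpa [pow_succ, mul_assoc] using congrArg (· * t) h2
    have e0 : (s ^ 3 * x)⁻¹ = s ^ 3 * x := inv_eq_of_mul_eq_one_left (by rw [← sq, h0])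
    have rp : s⁻¹ * p * s = c q * x := by
      -- The first generator is an involution: this turns `s ^ 3 x s ^ 2 p s` into `x⁻¹ s⁻¹ p s`.
      rw [← e0] at h3
      have e1 : x⁻¹ * (s⁻¹ * p * s) = c q := by
        rw [← h3]
        group
      rwa [inv_mul_eq_iff_eq_mul, hx] at e1
    obtain ⟨p1, p2, p3, p4⟩ := swap_of_conj rp
    have rx : s⁻¹ * x * s = c (q ^ 2)⁻¹ * (x * p⁻¹) := by
      have e3 : (s ^ 3)⁻¹ = s ^ 3 := inv_eq_of_mul_eq_one_left (by rw [← pow_add, h2])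
      have e4 : (s ^ 3)⁻¹ * x * s ^ 3 = x⁻¹ := calc
        _ = s ^ 3 * x * s ^ 3 := by rw [e3]
        _ = (s ^ 3 * x)⁻¹ * s ^ 3 := by rw [e0]
        _ = x⁻¹ := by group
      -- The second generator has order three, and the conjugates of `p` in its cube are known up to
      -- the unknown `s⁻¹ x s`.
      have e5 : (s ^ 2 * p) ^ 3 = s ^ 6 * ((s ^ 3)⁻¹ * (s⁻¹ * p * s) * s ^ 3) *
        (s⁻¹ * (s⁻¹ * p * s) * s) * p := by
          simp only [hpow, pow_zero, one_mul, mul_inv_rev, mul_assoc, mul_inv_cancel_left]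
      rw [h1, h2, one_mul, rp, hl, hl, mul_assoc (c q) _ (s ^ 3), e4, mul_assoc (c q) _ s] at e5
      simp only [mul_assoc, hxi'] at e5
      have e6 : c (q ^ 2) * (x⁻¹ * (s⁻¹ * x * s * p)) = 1 := by
        rw [e5, hcc, sq]
        simp only [mul_assoc]
      rw [← hxi', inv_mul_eq_one, ← mul_assoc, ← mul_inv_eq_iff_eq_mul] at e6
      rw [e6, ← mul_assoc, ← map_mul, inv_mul_cancel, map_one, one_mul]
    obtain ⟨x1, x2, x3, x4⟩ := swap_of_conj rx
    refine ⟨?_, h2, Prod.ext rx rp⟩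
    simp only [hpow, pow_zero, one_mul, mul_assoc, hs', hx', hp', hxi', hpi', x3, p3, x4, p4, hss,
      inv_mul_cancel_left, mul_inv_rev, inv_inv, hinv, hcc, hs, hx, hp, hxi, hpi,
      inv_mul_cancel, mul_one] at h0
    rw [← hx', mul_eq_one_iff_inv_eq, eq_comm, ← hpi', inv_mul_eq_iff_eq_mul, ← hxi',
      inv_mul_eq_iff_eq_mul, ← mul_assoc x, eq_mul_inv_iff_mul_eq, mul_assoc, ← eq_inv_mul_iff_mul_eq,
      hinv] at h0
    rw [h0, StarDiagram.ell]
    congr 2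
    refine Units.ext ?_
    push_cast
    field_simp

/-- In type `D4` the product relation is used to recover the third generator from the others. -/
theorem legGenerator_weylTriple {D : StarDiagram} {t : Fin D.legs → G}
    (hc : ∀ u a, u * c a = c a * u) (ht : IsLegTuple D c q t) :
    legGenerator D c q (weylTriple D c q t).1 (weylTriple D c q t).2.1 (weylTriple D c q t).2.2 =
      t := by
  have hcu : ∀ a u v, c a * (u * (c a⁻¹ * v)) = u * v := fun a u v => by
    rw [← mul_assoc u, hc u, mul_assoc, ← mul_assoc, ← map_mul, mul_inv_cancel, map_one, one_mul]
  match D, t, ht with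
  | .D4, t, ht =>
    obtain ⟨⟨h0, h1, h2, h3⟩, h4⟩ := isLegTuple_D4_iff.1 ht
    refine funext (forall_fin_four.2 ⟨rfl, ?_, ?_, ?_⟩) <;>
      simp only [legGenerator, weylTriple, Matrix.cons_val, mul_inv_cancel_left]
    have e1 : (t (1 : Fin 4))⁻¹ = t (1 : Fin 4) := inv_eq_of_mul_eq_one_left (by rw [← sq, h1])
    have e3 : (t (3 : Fin 4))⁻¹ = t (3 : Fin 4) := inv_eq_of_mul_eq_one_left (by rw [← sq, h3])
    rw [mul_assoc, mul_inv_cancel_left, ← e1, ← e3, ← mul_assoc (t (1 : Fin 4))⁻¹, ← mul_assoc,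
      ← hc, ← h4]
    group
  | .E6, t, ht =>
    refine funext (forall_fin_three.2 ⟨rfl, ?_, ?_⟩) <;>
      simp only [legGenerator, weylTriple, Matrix.cons_val, mul_assoc, hcu, mul_inv_cancel_left]
  | .E7, t, ht =>
    refine funext (forall_fin_three.2 ⟨?_, ?_, rfl⟩) <;>
      simp only [legGenerator, weylTriple, Matrix.cons_val, hcu, mul_inv_rev, inv_inv,
        mul_inv_cancel_left]
  | .E8, t, ht =>
    refine funext (forall_fin_three.2 ⟨?_, ?_, rfl⟩) <;>
      simp only [legGenerator, weylTriple, Matrix.cons_val, mul_inv_cancel_left]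

end

end

noncomputable section

/-! ### Presentations of the two algebras and the isomorphism between them -/

open QWeyl Hochschild

theorem partialProd_last {M : Type*} [Monoid M] {m : ℕ} (t : Fin m → M) :
    Fin.partialProd t (Fin.last m) = (List.ofFn t).prod := by
  rw [Fin.partialProd, Fin.val_last, List.take_of_length_le (by simp)]

theorem legOrder_ne_zero (D : StarDiagram) (i : Fin D.legs) : D.legOrder i ≠ 0 := by
  revert i
  cases D <;> decide

namespace BAlgebra

variable (D : StarDiagram) (q : ℂˣ)

/-- The generators of `B(q)`, as invertible elements. -/
def generator (i : Fin D.legs) : (BAlgebra D q)ˣ :=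
  Units.ofPowEqOne (RingQuot.mkAlgHom ℂ (Rel D q) (FreeAlgebra.ι ℂ i) : BAlgebra D q)
    (D.legOrder i)
    (by
      have h := RingQuot.mkAlgHom_rel ℂ (Rel.pow (D := D) (q := q) i)
      rw [map_pow, map_one] at h
      exact h)
    (legOrder_ne_zero D i)

theorem generator_pow (i : Fin D.legs) : generator D q i ^ D.legOrder i = 1 :=
  Units.pow_ofPowEqOne _ _

theorem isPresentation : IsPresentation (generator D q) D.legOrder q where
  d_ne_zero := legOrder_ne_zero D
  pow_eq_one := generator_pow D q
  prod_eq := by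
    rw [partialProd_last]
    refine Units.ext ?_
    have h := RingQuot.mkAlgHom_rel ℂ (Rel.prod (D := D) (q := q))
    rw [AlgHom.commutes, map_list_prod, List.map_ofFn] at h
    refine Eq.trans ?_ h
    rw [← Units.coeHom_apply, map_list_prod, List.map_ofFn]
    rfl
  adjoin_eq_top := by
    have h : Set.range (fun i => (generator D q i : BAlgebra D q)) =
        (RingQuot.mkAlgHom ℂ (Rel D q)) '' Set.range (FreeAlgebra.ι ℂ) :=
      Set.range_comp (RingQuot.mkAlgHom ℂ (Rel D q)) (FreeAlgebra.ι ℂ)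
    rw [h]
    refine (AlgHom.map_adjoin (RingQuot.mkAlgHom ℂ (Rel D q)) _).symm.trans ?_
    rw [FreeAlgebra.adjoin_range_ι, Algebra.map_top]
    exact (AlgHom.range_eq_top _).2 (RingQuot.mkAlgHom_surjective ℂ (Rel D q))
  exists_algHom := by
    intro C _ _ t ht hprod
    refine ⟨RingQuot.liftAlgHom ℂ ⟨FreeAlgebra.lift ℂ fun i => (t i : C), ?_⟩, fun i => ?_⟩
    · intro a b hab
      cases hab with
      | pow i =>
        rw [map_pow, map_one, FreeAlgebra.lift_ι_apply, ← Units.val_pow_eq_pow_val, ht,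
          Units.val_one]
      | prod =>
        rw [partialProd_last] at hprod
        have h := congrArg (Units.coeHom C) hprod
        rw [map_list_prod, List.map_ofFn] at h
        rw [AlgHom.commutes, map_list_prod, List.map_ofFn]
        refine Eq.trans ?_ h
        congr 2
        funext i
        exact FreeAlgebra.lift_ι_apply _ _
    · refine (RingQuot.liftAlgHom_mkAlgHom_apply ℂ _ _ _).trans ?_
      exact FreeAlgebra.lift_ι_apply _ _

theorem isLegTuple : IsLegTuple D (scalar (BAlgebra D q)) q (generator D q) :=
  ⟨(isPresentation D q).pow_eq_one, (isPresentation D q).prod_eq⟩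

end BAlgebra

/-- A presentation is carried over by an isomorphism of algebras. -/
theorem Hochschild.IsPresentation.map {k A B : Type} [Field k] [Ring A] [Algebra k A] [Ring B]
    [Algebra k B] {m : ℕ} {T : Fin m → Aˣ} {d : Fin m → ℕ} {c : kˣ} (hT : IsPresentation T d c)
    (e : A ≃ₐ[k] B) : IsPresentation (fun i => Units.map (e : A →* B) (T i)) d c where
  d_ne_zero := hT.d_ne_zero
  pow_eq_one i := by rw [← map_pow, hT.pow_eq_one, map_one]
  prod_eq := by
    rw [partialProd_last]
    have h := congrArg (Units.map (e : A →* B)) hT.prod_eq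
    rw [partialProd_last, map_list_prod, List.map_ofFn] at h
    exact h.trans (Units.ext (e.commutes _))
  adjoin_eq_top := by
    have h : Set.range (fun i => ((Units.map (e : A →* B) (T i) : Bˣ) : B)) =
        (e : A →ₐ[k] B) '' Set.range fun i => (T i : A) :=
      Set.range_comp e fun i => (T i : A)
    rw [h, ← AlgHom.map_adjoin, hT.adjoin_eq_top, Algebra.map_top]
    exact (AlgHom.range_eq_top _).2 e.surjective
  exists_algHom t ht hprod := by
    obtain ⟨f, hf⟩ := hT.exists_algHom t ht hprod
    exact ⟨f.comp (e.symm : B →ₐ[k] A), fun i => (congrArg f (e.symm_apply_apply _)).trans (hf i)⟩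

section

variable {G H : Type*} [Group G] [Group H] {D : StarDiagram} {c : ℂˣ →* G} {c' : ℂˣ →* H} {q : ℂˣ}
  (f : G →* H) (hf : ∀ a, f (c a) = c' a)
include hf

theorem map_legGenerator (x p s : G) (i : Fin D.legs) :
    f (legGenerator D c q x p s i) = legGenerator D c' q (f x) (f p) (f s) i := by
  revert i
  cases D
  · refine forall_fin_four.2 ⟨?_, ?_, ?_, ?_⟩ <;> simp [legGenerator, hf]
  all_goals refine forall_fin_three.2 ⟨?_, ?_, ?_⟩ <;> simp [legGenerator, ← hf]

theorem map_weylTriple (t : Fin D.legs → G) :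
    weylTriple D c' q (fun i => f (t i)) =
      (f (weylTriple D c q t).1, f (weylTriple D c q t).2.1, f (weylTriple D c q t).2.2) := by
  cases D <;> simp [weylTriple, ← hf]

end

/-- The isomorphism of `B(q)` with the semidirect product. -/
theorem exists_algEquiv (D : StarDiagram) (q : ℂˣ) : ∃ e : BAlgebra D q ≃ₐ[ℂ] SemidirectWeyl D q,
    ∀ i, Units.map (e : BAlgebra D q →* SemidirectWeyl D q) (BAlgebra.generator D q i) =
      legGenerator D (scalar _) q (SemidirectWeyl.X D q) (SemidirectWeyl.P D q)
        (SemidirectWeyl.S D q) i := by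
  let T := BAlgebra.generator D q
  have hT := BAlgebra.isPresentation D q
  let T' := legGenerator D (scalar _) q (SemidirectWeyl.X D q) (SemidirectWeyl.P D q)
    (SemidirectWeyl.S D q)
  have hT' : IsLegTuple D (scalar _) q T' :=
    isLegTuple_legGenerator mul_scalar (SemidirectWeyl.isWeylTriple D q)
  obtain ⟨φ, hφ⟩ := hT.exists_algHom T' hT'.pow_eq_one hT'.prod_eq
  have hφT : ∀ i, Units.map (φ : BAlgebra D q →* SemidirectWeyl D q) (T i) = T' i :=
    fun i => Units.ext (hφ i)
  let w := weylTriple D (scalar _) q T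
  have hw : legGenerator D (scalar _) q w.1 w.2.1 w.2.2 = T :=
    legGenerator_weylTriple mul_scalar (BAlgebra.isLegTuple D q)
  have hw' : IsWeylTriple D (scalar _) q w.1 w.2.1 w.2.2 :=
    isWeylTriple_of_isLegTuple mul_scalar (by rw [hw]; exact BAlgebra.isLegTuple D q)
  obtain ⟨ψ, hψX, hψP, hψS⟩ := SemidirectWeyl.exists_lift hw'
  have hψ : ∀ i, Units.map (ψ : SemidirectWeyl D q →* BAlgebra D q) (T' i) = T i := fun i => by
    rw [map_legGenerator _ (map_scalar ψ), hψX, hψP, hψS, hw]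
  have hφw := map_weylTriple (D := D) (q := q)
    (Units.map (φ : BAlgebra D q →* SemidirectWeyl D q)) (map_scalar φ) T
  simp only [hφT] at hφw
  rw [weylTriple_legGenerator D _ mul_scalar] at hφw
  simp only [Prod.mk.injEq] at hφw
  obtain ⟨hφX, hφP, hφS⟩ := hφw
  have h1 : φ.comp ψ = AlgHom.id ℂ _ := by
    refine SemidirectWeyl.algHom_ext ?_ ?_ ?_
    · exact (congrArg _ hψX).trans hφX.symm
    · exact (congrArg _ hψP).trans hφP.symm
    · exact (congrArg _ hψS).trans hφS.symm
  have h2 : ψ.comp φ = AlgHom.id ℂ _ := by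
    refine AlgHom.ext_of_adjoin_eq_top hT.adjoin_eq_top ?_
    rintro _ ⟨i, rfl⟩
    exact (congrArg ψ (hφ i)).trans (congrArg Units.val (hψ i))
  exact ⟨AlgEquiv.ofAlgHom φ ψ h1 h2, hφT⟩

end

noncomputable section

/-! ### Hochschild homology and cohomology of the two algebras -/

open QWeyl Hochschild MonomialGroup

section

variable {B : Type} [Ring B] [Algebra ℂ B] {D : StarDiagram} {q : ℂˣ} {x p s : Bˣ}
  (h : IsWeylTriple D (scalar B) q x p s)
include h

/-- Up to powers of `q`, the generators `T i` are the monomials `MonomialGroup.generator`. -/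
theorem mk_legGenerator (i : Fin D.legs) :
    ((legGenerator D (scalar B) q x p s i : Bˣ) : Bˣ ⧸ Subgroup.zpowers (scalar B q)) =
      monomialHom (isWeylTriple_mk h) (MonomialGroup.generator D i) := by
  have h0 : ((scalar B q : Bˣ) : Bˣ ⧸ Subgroup.zpowers (scalar B q)) = 1 :=
    (QuotientGroup.eq_one_iff _).2 (Subgroup.mem_zpowers _)
  have h1 : monomialHom (isWeylTriple_mk h) (rotation D) = s := by
    rw [monomialHom_apply, monomial, angle_rotation, exponent_rotation]
    simp
  rw [MonomialGroup.generator, map_mul, map_pow, h1, monomialHom_apply, monomial_lattice]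
  revert i
  cases D
  · refine forall_fin_four.2 ⟨?_, ?_, ?_, ?_⟩ <;> simp [legGenerator, generatorData, h0]
  all_goals refine forall_fin_three.2 ⟨?_, ?_, ?_⟩ <;> simp [legGenerator, generatorData, h0]

/-- The scalar `q` that appears when `x` is written in terms of the `T i` is their product. -/
theorem mem_closure_legGenerator :
    x ∈ Subgroup.closure (Set.range (legGenerator D (scalar B) q x p s)) := by
  have ht := isLegTuple_legGenerator mul_scalar h
  have hw := congrArg Prod.fst (weylTriple_legGenerator (q := q) (x := x) (p := p) (s := s) D
    (scalar B) mul_scalar)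
  generalize legGenerator D (scalar B) q x p s = t at ht hw
  let K := Subgroup.closure (Set.range t)
  have hK : ∀ i, t i ∈ K := fun i => Subgroup.subset_closure ⟨i, rfl⟩
  have hq : scalar B q ∈ K := by
    rw [← ht.prod_eq, partialProd_last]
    refine K.list_prod_mem fun u hu => ?_
    obtain ⟨i, rfl⟩ := (List.mem_ofFn' _ _).1 hu
    exact hK i
  change x ∈ K
  rw [← show _ = x from hw]
  cases D
  · exact K.mul_mem (K.inv_mem (hK _)) (hK _)
  · exact K.mul_mem (by rw [map_inv]; exact K.inv_mem hq) (K.mul_mem (K.inv_mem (hK _)) (hK _))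
  · refine K.mul_mem ?_ (K.mul_mem (K.inv_mem (hK _)) (hK _))
    rw [map_inv, map_pow]
    exact K.inv_mem (K.pow_mem hq _)
  · exact K.mul_mem (K.inv_mem (K.pow_mem (hK _) _)) (hK _)

omit h in
theorem lattice_pow_injective :
    Function.Injective fun n : ℕ => (lattice (1, 0) : MonomialGroup D) ^ n := fun m n e => by
  have hn : ∀ n : ℕ, (lattice (1, 0) : MonomialGroup D) ^ n = lattice (n, 0) := fun n => by
    have := lattice_zpow_mul_zpow (D := D) n 0
    rwa [zpow_zero, mul_one, zpow_natCast] at this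
  have e1 := congrArg exponent (((hn m).symm.trans e).trans (hn n))
  rw [exponent_lattice, exponent_lattice, Prod.mk.injEq] at e1
  exact Nat.cast_injective e1.1

variable (b : Module.Basis (MonomialGroup D) ℂ B) (hb : ∀ g, b g = (monomial x p s g : Bˣ))
  (hq : ∀ n : ℕ, 0 < n → q ^ n ≠ 1)
include hb hq

/-- The commutator quotient has a basis given by the classes of `1` and of the powers
`T i ^ j`, `0 < j < d_i`. -/
theorem nonempty_quotient_commutatorSpace_equiv :
    Nonempty ((B ⧸ commutatorSpace ℂ B) ≃ₗ[ℂ] (Fin (D.rank + 1) → ℂ)) := by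
  have hB : Nontrivial B := ⟨b 1, 0, b.ne_zero 1⟩
  have hu := twistedBasis h b hb
  have hxy := isSeparatingPair h hq
  let t : ClassIndex D → Bˣ
    | none => 1
    | some ⟨i, j⟩ => legGenerator D (scalar B) q x p s i ^ ((j : ℕ) + 1)
  have htν : ∀ a, ∃ n : ℤ, t a = scalar B (q ^ n) * monomial x p s (representative D a) := by
    intro a
    refine exists_eq_scalar_mul_monomial h ?_
    match a with
    | none => exact (map_one _).symm
    | some ⟨i, j⟩ =>
      change ((legGenerator D (scalar B) q x p s i ^ ((j : ℕ) + 1) : Bˣ) :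
        Bˣ ⧸ Subgroup.zpowers (scalar B q)) = _
      rw [QuotientGroup.mk_pow, mk_legGenerator h, ← map_pow]
      rfl
  have ht : ∀ a, IsOfFinOrder (t a) := by
    intro a
    match a with
    | none => exact IsOfFinOrder.one
    | some ⟨i, j⟩ =>
      refine IsOfFinOrder.pow (isOfFinOrder_iff_pow_eq_one.2 ⟨D.legOrder i,
        Nat.pos_of_ne_zero (legOrder_ne_zero D i),
        (isLegTuple_legGenerator mul_scalar h).pow_eq_one i⟩)
  obtain ⟨e⟩ := hu.nonempty_quotient_commutatorSpace_equiv hq htν ht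
    (fun _ _ => eq_of_isConj_representative) fun g => by
      by_cases h0 : angle g = 0
      · -- A monomial `x ^ i p ^ j ≠ 1` does not commute with both `x` and `p`.
        by_cases h1 : g = 1
        · exact .inl ⟨none, h1 ▸ IsConj.refl _⟩
        · right
          have hcomm : lattice (1, 0) * g * (lattice (1, 0))⁻¹ = g := by
            rw [eq_lattice_mul_rotation_pow g, h0, pow_zero, mul_one, ← lattice_add, add_comm,
              lattice_add, mul_inv_cancel_right]
          rcases hxy.free_or g h1 with h2 | ⟨h2, h3, h4 | h4⟩
          · exact absurd (h2 1 0 (by rw [zpow_one, zpow_zero, mul_one, hcomm])).1 one_ne_zero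
          · exact ⟨_, h2, h4⟩
          · exact ⟨_, h3, h4⟩
      · exact .inl (exists_isConj_representative h0)
  exact ⟨e.trans (LinearEquiv.funCongrLeft ℂ ℂ
    (Fintype.equivFinOfCardEq (card_classIndex (D := D))).symm)⟩

/-- The center, the derivations and the commutators of an algebra with a basis of monomials
determine its Hochschild homology and cohomology. -/
theorem hochschild_of_isPresentation
    (hT : IsPresentation (legGenerator D (scalar B) q x p s) D.legOrder q) :
    (Nonempty (cohomology ℂ B 0 ≃ₗ[ℂ] ℂ) ∧ Subsingleton (cohomology ℂ B 1) ∧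
      Nonempty (cohomology ℂ B 2 ≃ₗ[ℂ] (Fin (D.rank + 1) → ℂ)) ∧
      ∀ i : ℕ, 2 < i → Subsingleton (cohomology ℂ B i)) ∧
    (Nonempty (homology ℂ B 0 ≃ₗ[ℂ] (Fin (D.rank + 1) → ℂ)) ∧ Subsingleton (homology ℂ B 1) ∧
      Nonempty (homology ℂ B 2 ≃ₗ[ℂ] ℂ) ∧
      ∀ i : ℕ, 2 < i → Subsingleton (homology ℂ B i)) := by
  have hB : Nontrivial B := ⟨b 1, 0, b.ne_zero 1⟩
  have hu := twistedBasis h b hb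
  have hxy := isSeparatingPair h hq
  have hx : monomial x p s (lattice (1, 0) : MonomialGroup D) ∈
      Subgroup.closure (Set.range (legGenerator D (scalar B) q x p s)) := by
    rw [monomial_lattice, zpow_one, zpow_zero, mul_one]
    exact mem_closure_legGenerator h
  have hreg := hu.eq_zero_of_mul_conj_eq lattice_pow_injective hx
  have hinner : ∀ δ : B →ₗ[ℂ] B, (∀ a b, δ (a * b) = a * δ b + δ a * b) →
      ∃ m, ∀ a, δ a = a * m - m * a := fun δ hδ =>
    hxy.exists_eq_commutator hu δ hδ hT.d_ne_zero hT.pow_eq_one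
      (fun i => by
        obtain ⟨n, hn⟩ := exists_eq_scalar_mul_monomial h (mk_legGenerator h i)
        exact ⟨n, _, hn⟩) hT.adjoin_eq_top
  obtain ⟨ecenter⟩ := hxy.nonempty_center_equiv hu
  obtain ⟨ecomm⟩ := nonempty_quotient_commutatorSpace_equiv h b hb hq
  obtain ⟨e0⟩ := hT.nonempty_cohomology_zero_equiv hreg
  obtain ⟨e2⟩ := hT.nonempty_cohomology_two_equiv hreg
  obtain ⟨e0'⟩ := hT.nonempty_homology_zero_equiv hreg
  obtain ⟨e2'⟩ := hT.nonempty_homology_two_equiv hreg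
  exact ⟨⟨⟨e0.trans ecenter⟩, hT.subsingleton_cohomology_one hreg hinner, ⟨e2.trans ecomm⟩,
      fun i hi => hT.subsingleton_cohomology_of_two_lt hreg i hi⟩,
    ⟨⟨e0'.trans ecomm⟩, hT.subsingleton_homology_one hreg hinner, ⟨e2'.trans ecenter⟩,
      fun i hi => hT.subsingleton_homology_of_two_lt hreg i hi⟩⟩

end

end

theorem theorem3p1 (D : StarDiagram) (q : ℂˣ) (hq : ∀ n : ℕ, 0 < n → q ^ n ≠ 1) :
    Nonempty (BAlgebra D q ≃ₐ[ℂ] SemidirectWeyl D q) ∧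
      (Nonempty (Hochschild.cohomology ℂ (BAlgebra D q) 0 ≃ₗ[ℂ] ℂ) ∧
        Subsingleton (Hochschild.cohomology ℂ (BAlgebra D q) 1) ∧
        Nonempty (Hochschild.cohomology ℂ (BAlgebra D q) 2 ≃ₗ[ℂ] (Fin (D.rank + 1) → ℂ)) ∧
        ∀ i : ℕ, 2 < i → Subsingleton (Hochschild.cohomology ℂ (BAlgebra D q) i)) ∧
      (Nonempty (Hochschild.homology ℂ (BAlgebra D q) 0 ≃ₗ[ℂ] (Fin (D.rank + 1) → ℂ)) ∧
        Subsingleton (Hochschild.homology ℂ (BAlgebra D q) 1) ∧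
        Nonempty (Hochschild.homology ℂ (BAlgebra D q) 2 ≃ₗ[ℂ] ℂ) ∧
        ∀ i : ℕ, 2 < i → Subsingleton (Hochschild.homology ℂ (BAlgebra D q) i)) ∧
      (Nonempty (Hochschild.cohomology ℂ (SemidirectWeyl D q) 0 ≃ₗ[ℂ] ℂ) ∧
        Subsingleton (Hochschild.cohomology ℂ (SemidirectWeyl D q) 1) ∧
        Nonempty (Hochschild.cohomology ℂ (SemidirectWeyl D q) 2 ≃ₗ[ℂ] (Fin (D.rank + 1) → ℂ)) ∧
        ∀ i : ℕ, 2 < i → Subsingleton (Hochschild.cohomology ℂ (SemidirectWeyl D q) i)) ∧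
      (Nonempty (Hochschild.homology ℂ (SemidirectWeyl D q) 0 ≃ₗ[ℂ] (Fin (D.rank + 1) → ℂ)) ∧
        Subsingleton (Hochschild.homology ℂ (SemidirectWeyl D q) 1) ∧
        Nonempty (Hochschild.homology ℂ (SemidirectWeyl D q) 2 ≃ₗ[ℂ] ℂ) ∧
        ∀ i : ℕ, 2 < i → Subsingleton (Hochschild.homology ℂ (SemidirectWeyl D q) i)) := by
  obtain ⟨e, he⟩ := exists_algEquiv D q
  obtain ⟨b, hb⟩ := SemidirectWeyl.exists_basis D q
  have h := SemidirectWeyl.isWeylTriple D q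
  have hT := BAlgebra.isPresentation D q
  have hT' : Hochschild.IsPresentation (legGenerator D (QWeyl.scalar (SemidirectWeyl D q)) q
      (SemidirectWeyl.X D q) (SemidirectWeyl.P D q) (SemidirectWeyl.S D q)) D.legOrder q := by
    rw [← funext he]
    exact hT.map e
  -- The generators and the basis of the semidirect product are carried over to `B(q)`.
  let f := Units.map (e.symm : SemidirectWeyl D q →* BAlgebra D q)
  have hf : ∀ a, f (QWeyl.scalar _ a) = QWeyl.scalar _ a := fun a =>
    Units.ext (e.symm.commutes a)
  have hB := h.map f
  rw [show f.comp (QWeyl.scalar _) = QWeyl.scalar _ from MonoidHom.ext hf] at hB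
  have hTB : BAlgebra.generator D q = legGenerator D (QWeyl.scalar (BAlgebra D q)) q
      (f (SemidirectWeyl.X D q)) (f (SemidirectWeyl.P D q)) (f (SemidirectWeyl.S D q)) :=
    funext fun i => by
      rw [← map_legGenerator f hf, ← he]
      exact Units.ext (e.symm_apply_apply _).symm
  rw [hTB] at hT
  have h1 := hochschild_of_isPresentation hB (b.map e.symm.toLinearEquiv) (fun g => by
    rw [Module.Basis.map_apply, hb, ← map_monomial]
    rfl) hq hT
  have h2 := hochschild_of_isPresentation h b hb hq hT'
  exact ⟨⟨e⟩, h1.1, h1.2, h2.1, h2.2⟩
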